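/- **Setting.** Let $G=(\mathcal V,\mathcal E)$ be a finite directed acyclic graph whose vertices are product categories. Category $U$ has a finite product set $\mathbf N_U$ with prices $r^U_i\in\mathbb R$, and the options $\mathbf N_U^+=\mathbf N_U\cup\{0_U\}$, where $0_U$ (no purchase) has price $0$. Each category carries a Markov chain choice model $\phi_U=(\psi^U,\rho^U)$, where $\psi^U$ is a probability vector on $\mathbf N_U^+$ and $\rho^U$ is a stochastic matrix on $\mathbf N_U^+$ from which $0_U$ is reachable from every product. For $S\subseteq\mathbf N_U$ put $S^+=S\cup\{0_U\}$; $\phi_U(j,S)$ is the probability that the chain with initial law $\psi^U$ and transition matrix $\rho^U$, stopped on first being in $S^+$, stops at $j\in S^+$. For each edge $(U,W)$ and each $i\in\mathbf N_U^+$ let $\lambda^{i}$ be a probability vector on $\mathbf N_W^+$, and let $\phi_{W|i}$ be the Markov chain choice model $(\lambda^{i},\rho^W)$. A customer starts in all root categories (those without incoming edges), choosing there according to $\phi_U(\cdot,S_U)$; after selecting option $i$ in $U$ the customer proceeds in parallel along every edge $(U,W)$, selecting $j\in S_W^+$ with probability $\phi_{W|i}(j,S_W)$, and so on. The expected revenue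 $R(\{S_U\})$ is the expected total price of all selections, where along each directed path $U_0\to\dots\to U_k$ from a root the choices $i_0,\dots,i_k$ have probability $\phi_{U_0}(i_0,S_{U_0})\prod_{l\ge1}\phi_{U_l|i_{l-1}}(i_l,S_{U_l})$ and the last one contributes its price. A set of assortments $\{S_U^*\}_{U\in\mathcal V}$ is optimal if it maximizes $R$ over all sets of assortments $S_U\subseteq\mathbf N_U$. **Algorithm.** Process the categories in a reverse topological order (children before parents). For category $U$ put, for $i\in\mathbf N_U^+$, $$r'_{i}=r^U_{i}+\sum_{W\in\mathrm{Children}(U)}\ \sum_{j\in S_W^{*,+}}\phi_{W|i}(j,S_W^*)\,r'_{j},$$ and let $S_U^*$ be an invariant optimal assortment for these prices, i.e. one that maximizes $\sum_{j\in S^+} r'_j\,\phi(j,S)$ over $S\subseteq\mathbf N_U$, where $\phi$ is the Markov chain choice model $(\psi,\rho^U)$, simultaneously for every initial distribution $\psi$. Return $\{S_U^*\}_{U\in\mathcal V}$. **Theorem.** For all such data, the algorithm can be carried out (the required invariant optimal assortments exist), and whatever reverse topological order and whatever invariant optimal assortments it uses, its output $\{S^*_U\}_{U\in\mathcal V}$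 is optimal. Moreover, the algorithm can be carried out in polynomial time: there are one program (of a random access machine on rational numbers with logarithmic cost, where each operation is charged the bit length of the numbers involved) and one polynomial $p$ such that on every instance with rational data of total bit length $L$ the program halts with cost at most $p(L)$ and returns an output of the algorithm, which is therefore an optimal set of assortments. -/

import Mathlib

namespace CrossCat

/-! ## Data of a multi-category market -/

/-- The data of a multi-category market over a number field `K`. There are `m` categories; category
`u` has the products `Fin (n u)`, and its options are `Option (Fin (n u))`, where `none` is the
no-purchase option. `psi u`, `rho u` are the initial arrival vector and the transition matrix of
the Markov chain choice model of category `u`; `lam u w i` is the cross-category transition vector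
`λ^i` on the options of `w` after option `i` has been chosen in `u`
(only its values on edges `u → w` matter). -/
structure MarketData (K : Type) where
  m : ℕ
  n : Fin m → ℕ
  edge : Fin m → Fin m → Bool
  price : (u : Fin m) → Fin (n u) → K
  psi : (u : Fin m) → Option (Fin (n u)) → K
  rho : (u : Fin m) → Option (Fin (n u)) → Option (Fin (n u)) → K
  lam : (u w : Fin m) → Option (Fin (n u)) → Option (Fin (n w)) → K

/-- A market with rational data, seen as a market with real data. -/
noncomputable def MarketData.toReal (d : MarketData ℚ) : MarketData ℝ where
  m := d.m
  n := d.n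
  edge := d.edge
  price u i := (d.price u i : ℝ)
  psi u j := (d.psi u j : ℝ)
  rho u i j := (d.rho u i j : ℝ)
  lam u w i j := (d.lam u w i j : ℝ)

/-- A probability vector. -/
def IsProb {α : Type} [Fintype α] (p : α → ℝ) : Prop :=
  (∀ a, 0 ≤ p a) ∧ ∑ a, p a = 1

/-- The within-category transition matrix of a Markov chain choice model: it is stochastic, and
from every product the no-purchase option can be reached, i.e. the chain stops almost surely
whatever assortment is offered. -/
def IsTransition {n : ℕ} (ρ : Option (Fin n) → Option (Fin n) → ℝ) : Prop :=
  (∀ i, IsProb (ρ i)) ∧ ∀ i, Relation.ReflTransGen (fun a b => 0 < ρ a b) i none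

/-- The data form a market: the category graph is acyclic, every category carries a Markov chain
choice model, and the cross-category transition vectors on the edges are probability vectors. -/
structure MarketData.Valid (d : MarketData ℝ) : Prop where
  acyclic : ∀ u, ¬ Relation.TransGen (fun a b => d.edge a b = true) u u
  psi_prob : ∀ u, IsProb (d.psi u)
  rho_trans : ∀ u, IsTransition (d.rho u)
  lam_prob : ∀ u w, d.edge u w = true → ∀ i, IsProb (d.lam u w i)

/-! ## The Markov chain choice model -/

/-- `visit ψ ρ S t j`: probability that the Markov chain with initial law `ψ` and transition matrix
`ρ`, stopped as soon as it is in `S ∪ {no purchase}`, has not stopped before time `t` and is in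
state `j` at time `t`. -/
def visit {n : ℕ} (ψ : Option (Fin n) → ℝ) (ρ : Option (Fin n) → Option (Fin n) → ℝ)
    (S : Finset (Fin n)) : ℕ → Option (Fin n) → ℝ
  | 0, j => ψ j
  | t + 1, j => ∑ k ∈ (Finset.insertNone S)ᶜ, visit ψ ρ S t k * ρ k j

/-- Choice probability `φ(j, S)` of the Markov chain choice model `(ψ, ρ)`: the probability that
the chain stops in `j ∈ S ∪ {no purchase}`. -/
noncomputable def choiceProb {n : ℕ} (ψ : Option (Fin n) → ℝ)
    (ρ : Option (Fin n) → Option (Fin n) → ℝ) (S : Finset (Fin n)) (j : Option (Fin n)) : ℝ :=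
  if j ∈ Finset.insertNone S then ∑' t : ℕ, visit ψ ρ S t j else 0

/-- Expected revenue of the assortment `S` in a single category with option prices `r`
(the no-purchase option may carry a price). -/
noncomputable def singleRevenue {n : ℕ} (ψ : Option (Fin n) → ℝ)
    (ρ : Option (Fin n) → Option (Fin n) → ℝ) (r : Option (Fin n) → ℝ)
    (S : Finset (Fin n)) : ℝ :=
  ∑ j ∈ Finset.insertNone S, r j * choiceProb ψ ρ S j

/-- `S` is an invariant optimal unconstrained assortment for the prices `r` and the transition
matrix `ρ`: it is optimal for every initial arrival distribution. -/
def IsInvariantOptimal {n : ℕ} (ρ : Option (Fin n) → Option (Fin n) → ℝ)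
    (r : Option (Fin n) → ℝ) (S : Finset (Fin n)) : Prop :=
  ∀ ψ, IsProb ψ → ∀ T : Finset (Fin n), singleRevenue ψ ρ r T ≤ singleRevenue ψ ρ r S

/-! ## The multi-category choice model and its expected revenue -/

namespace MarketData

/-- A set of assortments, one for each category. -/
abbrev Assortments {K : Type} (d : MarketData K) : Type := (u : Fin d.m) → Finset (Fin (d.n u))

variable (d : MarketData ℝ)

/-- A root category: no incoming edge. -/
def IsRoot (u : Fin d.m) : Prop := ∀ v, d.edge v u = false

instance (u : Fin d.m) : Decidable (d.IsRoot u) := by unfold IsRoot; infer_instance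

/-- Price of an option; no purchase has price `0`. -/
def optPrice (u : Fin d.m) (i : Option (Fin (d.n u))) : ℝ := i.elim 0 (d.price u)

/-- `φ_{w|i}(j, T)`: choice probability in category `w` after option `i` was chosen in its
parent `u`, i.e. in the Markov chain choice model with initial law `λ^i` and the transition
matrix of `w`. -/
noncomputable def condChoice (u w : Fin d.m) (i : Option (Fin (d.n u))) (T : Finset (Fin (d.n w)))
    (j : Option (Fin (d.n w))) : ℝ :=
  choiceProb (d.lam u w i) (d.rho w) T j

/-- `select S t w j`: expected number of times that option `j` is selected in category `w` when
`w` is reached from a root category along a directed path with exactly `t` edges.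
The customer starts in all root categories, and after selecting an option in `u` proceeds in
parallel to all children of `u`. -/
noncomputable def select (S : d.Assortments) : ℕ → (w : Fin d.m) → Option (Fin (d.n w)) → ℝ
  | 0, w, j => if d.IsRoot w then choiceProb (d.psi w) (d.rho w) (S w) j else 0
  | t + 1, w, j => ∑ u with d.edge u w = true, ∑ i ∈ Finset.insertNone (S u),
      select S t u i * d.condChoice u w i (S w) j

/-- Total expected revenue of a set of assortments. In an acyclic graph on `m` categories every
directed path has fewer than `m` edges. -/
noncomputable def revenue (S : d.Assortments) : ℝ :=
  ∑ t ∈ Finset.range d.m, ∑ u, ∑ i ∈ Finset.insertNone (S u), d.optPrice u i * d.select S t u i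

/-- A jointly optimal set of unconstrained assortments. -/
def IsOptimal (S : d.Assortments) : Prop := ∀ T : d.Assortments, d.revenue T ≤ d.revenue S

/-! ## The backward induction algorithm -/

/-- The working memory of the algorithm: the assortments and the adjusted option prices that have
been computed so far. -/
structure AlgState where
  assort : d.Assortments
  adj : (u : Fin d.m) → Option (Fin (d.n u)) → ℝ

/-- Adjusted prices of category `u`, from the stored assortments and adjusted prices of its
children. -/
noncomputable def adjusted (s : d.AlgState) (u : Fin d.m) (i : Option (Fin (d.n u))) : ℝ :=
  d.optPrice u i + ∑ w with d.edge u w = true, ∑ j ∈ Finset.insertNone (s.assort w),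
    d.condChoice u w i (s.assort w) j * s.adj w j

/-- A subroutine that returns, for a category and option prices, an assortment. -/
abbrev Subroutine : Type :=
  (u : Fin d.m) → (Option (Fin (d.n u)) → ℝ) → Finset (Fin (d.n u))

/-- The subroutine always returns an invariant optimal unconstrained assortment. -/
def Subroutine.Correct {d : MarketData ℝ} (opt : d.Subroutine) : Prop :=
  ∀ u r, IsInvariantOptimal (d.rho u) r (opt u r)

/-- One pass of the loop: compute the adjusted prices of `u`, then its assortment. -/
noncomputable def algStep (opt : d.Subroutine) (s : d.AlgState) (u : Fin d.m) : d.AlgState where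
  assort := Function.update s.assort u (opt u (d.adjusted s u))
  adj := Function.update s.adj u (d.adjusted s u)

/-- The algorithm: process the categories in the given order and return the assortments. -/
noncomputable def alg (opt : d.Subroutine) (order : List (Fin d.m)) : d.Assortments :=
  (order.foldl (d.algStep opt) ⟨fun _ => ∅, fun _ _ => 0⟩).assort

/-- A reverse topological order: every category occurs exactly once, children before parents. -/
def IsReverseTopological (order : List (Fin d.m)) : Prop :=
  order.Nodup ∧ (∀ u, u ∈ order) ∧ order.Pairwise (fun a b => d.edge a b = false)

/-- `S` is a possible output of the algorithm. -/
def IsAlgOutput (S : d.Assortments) : Prop :=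
  ∃ (opt : d.Subroutine) (order : List (Fin d.m)),
    opt.Correct ∧ d.IsReverseTopological order ∧ d.alg opt order = S

end MarketData

/-! ## Machine model: structured random access programs with rational cells, logarithmic cost

A store consists of arrays `0, 1, 2, …` of rational numbers with four natural indices each (scalars
and lower-dimensional arrays use index `0` in the remaining positions). Programs are built from
assignments, sequencing, branching and loops; every operation is charged the bit length of the
numbers involved. -/

/-- Array name and four indices give a cell content. -/
abbrev Store : Type := ℕ → ℕ → ℕ → ℕ → ℕ → ℚ

/-- Bit length of a rational number (reduced numerator and denominator). -/
def bits (q : ℚ) : ℕ := Nat.size q.num.natAbs + Nat.size q.den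

/-- Arithmetic expressions of programs. -/
inductive Expr : Type
  | lit (z : ℤ)
  | get (a : ℕ) (i j k l : Expr)
  | add (e f : Expr)
  | sub (e f : Expr)
  | mul (e f : Expr)
  | div (e f : Expr)

/-- Value of an expression; indices are rounded down to natural numbers, and `x / 0 = 0`. -/
def Expr.eval (s : Store) : Expr → ℚ
  | .lit z => z
  | .get a i j k l => s a ⌊i.eval s⌋₊ ⌊j.eval s⌋₊ ⌊k.eval s⌋₊ ⌊l.eval s⌋₊
  | .add e f => e.eval s + f.eval s
  | .sub e f => e.eval s - f.eval s
  | .mul e f => e.eval s * f.eval s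
  | .div e f => e.eval s / f.eval s

/-- Cost of evaluating an expression: each subexpression costs one step plus the bit length of
its value. -/
def Expr.cost (s : Store) : Expr → ℕ
  | .lit z => 1 + bits z
  | .get a i j k l => i.cost s + j.cost s + k.cost s + l.cost s + 1 +
      bits (Expr.eval s (.get a i j k l))
  | .add e f => e.cost s + f.cost s + 1 + bits (e.eval s + f.eval s)
  | .sub e f => e.cost s + f.cost s + 1 + bits (e.eval s - f.eval s)
  | .mul e f => e.cost s + f.cost s + 1 + bits (e.eval s * f.eval s)
  | .div e f => e.cost s + f.cost s + 1 + bits (e.eval s / f.eval s)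

/-- Programs. -/
inductive Cmd : Type
  | skip
  | assign (a : ℕ) (i j k l : Expr) (e : Expr)
  | seq (c₁ c₂ : Cmd)
  | ifLe (e f : Expr) (c₁ c₂ : Cmd)
  | whileLt (e f : Expr) (c : Cmd)

/-- Writing `v` into the cell `a[i, j, k, l]`. -/
def Store.set (s : Store) (a i j k l : ℕ) (v : ℚ) : Store :=
  fun a' i' j' k' l' =>
    if a' = a ∧ i' = i ∧ j' = j ∧ k' = k ∧ l' = l then v else s a' i' j' k' l'

/-- `Run c s t s'`: the program `c`, started in the store `s`, halts in the store `s'` after a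
computation of total cost `t`. -/
inductive Run : Cmd → Store → ℕ → Store → Prop
  | skip (s : Store) : Run .skip s 1 s
  | assign (s : Store) (a : ℕ) (i j k l e : Expr) :
      Run (.assign a i j k l e) s
        (i.cost s + j.cost s + k.cost s + l.cost s + e.cost s + 1)
        (s.set a ⌊i.eval s⌋₊ ⌊j.eval s⌋₊ ⌊k.eval s⌋₊ ⌊l.eval s⌋₊ (e.eval s))
  | seq {c₁ c₂ : Cmd} {s₁ s₂ s₃ : Store} {t₁ t₂ : ℕ} :
      Run c₁ s₁ t₁ s₂ → Run c₂ s₂ t₂ s₃ → Run (.seq c₁ c₂) s₁ (t₁ + t₂ + 1) s₃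
  | ifTrue {e f : Expr} {c₁ c₂ : Cmd} {s s' : Store} {t : ℕ} :
      e.eval s ≤ f.eval s → Run c₁ s t s' →
      Run (.ifLe e f c₁ c₂) s (e.cost s + f.cost s + t + 1) s'
  | ifFalse {e f : Expr} {c₁ c₂ : Cmd} {s s' : Store} {t : ℕ} :
      ¬ e.eval s ≤ f.eval s → Run c₂ s t s' →
      Run (.ifLe e f c₁ c₂) s (e.cost s + f.cost s + t + 1) s'
  | whileStop {e f : Expr} {c : Cmd} {s : Store} :
      ¬ e.eval s < f.eval s → Run (.whileLt e f c) s (e.cost s + f.cost s + 1) s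
  | whileLoop {e f : Expr} {c : Cmd} {s₁ s₂ s₃ : Store} {t₁ t₂ : ℕ} :
      e.eval s₁ < f.eval s₁ → Run c s₁ t₁ s₂ → Run (.whileLt e f c) s₂ t₂ s₃ →
      Run (.whileLt e f c) s₁ (e.cost s₁ + f.cost s₁ + t₁ + t₂ + 1) s₃

/-! ## Input, input size, output -/

/-- Index of an option: `0` for no purchase, `1, …, n` for the products. -/
def optIdx {n : ℕ} (o : Option (Fin n)) : ℕ := o.elim 0 (fun i => i.val + 1)

namespace MarketData

/-- The store holds the input `d` in the arrays `0, …, 6`. -/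
structure Loaded (d : MarketData ℚ) (s : Store) : Prop where
  num : s 0 0 0 0 0 = d.m
  size : ∀ u : Fin d.m, s 1 u 0 0 0 = d.n u
  edge : ∀ u w : Fin d.m, s 2 u w 0 0 = if d.edge u w = true then 1 else 0
  price : ∀ (u : Fin d.m) (i : Fin (d.n u)), s 3 u (optIdx (some i)) 0 0 = d.price u i
  psi : ∀ (u : Fin d.m) (j : Option (Fin (d.n u))), s 4 u (optIdx j) 0 0 = d.psi u j
  rho : ∀ (u : Fin d.m) (i j : Option (Fin (d.n u))), s 5 u (optIdx i) (optIdx j) 0 = d.rho u i j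
  lam : ∀ u w : Fin d.m, d.edge u w = true →
    ∀ (i : Option (Fin (d.n u))) (j : Option (Fin (d.n w))),
      s 6 u w (optIdx i) (optIdx j) = d.lam u w i j

/-- The array `7` of the store holds the indicator of the set of assortments `S`. -/
def Holds {d : MarketData ℚ} (S : d.Assortments) (s : Store) : Prop :=
  ∀ (u : Fin d.m) (i : Fin (d.n u)), s 7 u (optIdx (some i)) 0 0 = if i ∈ S u then 1 else 0

/-- Input size: total bit length of the data. -/
def bitSize (d : MarketData ℚ) : ℕ :=
  ∑ u, (1 + ∑ i, bits (d.price u i) + ∑ j, bits (d.psi u j) + ∑ i, ∑ j, bits (d.rho u i j)) +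
  ∑ u, ∑ w, (1 + if d.edge u w = true then ∑ i, ∑ j, bits (d.lam u w i j) else 0)

end MarketData

end CrossCat

namespace CrossCat

open Filter Topology

/-! One category. Offering `S` means stopping an absorbing chain on entering `S ∪ {no purchase}`.
Suppose `V` dominates the prices, is superharmonic on the products, equals the price on `S ∪ {no
purchase}` and is harmonic elsewhere. The mean of `V` over the running chain starts at `ψ · V` and
tends to `0`, because no purchase is reachable from everywhere. Comparing its decrements with the
rewards collected shows that every assortment earns at most `ψ · V` and that `S` earns exactly this
(`IsStoppingValue.singleRevenue_le`, `IsStoppingValue.singleRevenue_eq`). Neither `V` nor `S`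
depends on `ψ`, so `S` is invariant optimal.

Such a pair is found by state elimination. Starting from all products, one keeps the matrix `B` of
first entry probabilities and deletes, by a Gaussian pivot, any product whose price is below its
expected price at the next entry. Deleted states continue to prefer running
(`FirstEntry.le_sum_eliminate`), and when no deletion is possible `V` can be read off
(`FirstEntry.isStoppingValue`).

All categories. An adjusted price is a price plus the optimal expected revenue downstream. For
arbitrary assortments, the expected price collected at depth `t` is at most the expected adjusted
price at depth `t` minus that at depth `t + 1`. Here the optimality of the children is used for each
of the initial laws `λ^i`, hence the need for invariance. The sum over `t` telescopes, the graph
being acyclic, and everything is an equality for the assortments of the algorithm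
(`IsBackward.isOptimal`).

Polynomial time. The program performs the elimination in rational arithmetic and sweeps over all
categories `m` times, treating a category once its children are settled. The number of steps is
clearly polynomial; the bit lengths are the issue. By Cramer's rule the first entry probabilities
have a common denominator at most `n! D^n`, where `n` counts the options and `D` is a common
denominator of the transition matrix, whatever eliminations led to them
(`FirstEntry.exists_hasDenom`). So each category lengthens a common denominator of all stored values
by polynomially many bits only. Costs are handled by a total correctness calculus `Ok` for programs
with counting loops. The final store solves the equations `IsBackward` of the backward induction,
and each solution is an output of the algorithm (`IsBackward.isAlgOutput`). -/

/-! ## Optimal stopping of a Markov chain -/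

/-- `V` is the value function of the stopping problem with rewards `r`, and stopping on entering
`S ∪ {no purchase}` is an optimal rule. -/
structure IsStoppingValue {K : Type} [Field K] [LinearOrder K] {n : ℕ}
    (ρ : Option (Fin n) → Option (Fin n) → K) (r : Option (Fin n) → K) (S : Finset (Fin n))
    (V : Option (Fin n) → K) : Prop where
  stopped : ∀ i ∈ Finset.insertNone S, V i = r i
  running : ∀ i ∉ Finset.insertNone S, V i = ∑ j, ρ i j * V j
  reward_le : ∀ i, r i ≤ V i
  excessive : ∀ i, i ≠ none → ∑ j, ρ i j * V j ≤ V i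

section Visit

variable {n : ℕ} {ψ : Option (Fin n) → ℝ} {ρ : Option (Fin n) → Option (Fin n) → ℝ}

theorem visit_nonneg (hψ : ∀ i, 0 ≤ ψ i) (hρ : ∀ i j, 0 ≤ ρ i j) (S : Finset (Fin n)) (t : ℕ)
    (j : Option (Fin n)) : 0 ≤ visit ψ ρ S t j := by
  induction t generalizing j with
  | zero => exact hψ j
  | succ t ih => exact Finset.sum_nonneg fun k _ => mul_nonneg (ih k) (hρ k j)

theorem sum_visit_succ (S : Finset (Fin n)) (t : ℕ) (f : Option (Fin n) → ℝ) :
    ∑ j, visit ψ ρ S (t + 1) j * f j =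
      ∑ k ∈ (Finset.insertNone S)ᶜ, visit ψ ρ S t k * ∑ j, ρ k j * f j := by
  simp only [visit, Finset.sum_mul, Finset.mul_sum]
  rw [Finset.sum_comm]
  simp only [mul_assoc]

theorem sum_stopped_add_sum_succ (hρ : ∀ i, ∑ j, ρ i j = 1) (S : Finset (Fin n)) (t : ℕ) :
    ∑ j ∈ Finset.insertNone S, visit ψ ρ S t j + ∑ j, visit ψ ρ S (t + 1) j =
      ∑ j, visit ψ ρ S t j := by
  have h := sum_visit_succ (ψ := ψ) (ρ := ρ) S t (fun _ => 1)
  simp only [mul_one, hρ] at h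
  rw [h, Finset.sum_add_sum_compl]

/-- Mass is conserved: what stopped before time `N` plus what is present at time `N` is the initial
mass, which therefore bounds the partial sums. -/
theorem summable_visit (hψ : ∀ i, 0 ≤ ψ i) (hρ : ∀ i, IsProb (ρ i)) {S : Finset (Fin n)}
    {j : Option (Fin n)} (hj : j ∈ Finset.insertNone S) : Summable fun t => visit ψ ρ S t j := by
  have nn := visit_nonneg hψ (fun i => (hρ i).1) S
  have tele : ∀ N, ∑ t ∈ Finset.range N, ∑ j ∈ Finset.insertNone S, visit ψ ρ S t j +
      ∑ j, visit ψ ρ S N j = ∑ j, ψ j := by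
    intro N
    induction N with
    | zero => simp [visit]
    | succ N ih =>
      rw [Finset.sum_range_succ, add_assoc, sum_stopped_add_sum_succ fun i => (hρ i).2, ih]
  refine summable_of_sum_range_le (c := ∑ j, ψ j) (fun t => nn t j) fun N => ?_
  rw [← tele N]
  refine le_add_of_le_of_nonneg (Finset.sum_le_sum fun t _ => ?_)
    (Finset.sum_nonneg fun i _ => nn N i)
  exact Finset.single_le_sum (f := fun j => visit ψ ρ S t j) (fun i _ => nn t i) hj

/-- Induction backwards along a path to `none`. A running state `k` passes the fraction `ρ k i` of
its mass to its successor `i`, so its mass is at most that of `i` one step later divided by `ρ k i`.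
States that stop the chain, `none` among them, are covered by summability. -/
theorem tendsto_visit (hψ : ∀ i, 0 ≤ ψ i) (hρ : IsTransition ρ) (S : Finset (Fin n))
    (j : Option (Fin n)) : Tendsto (fun t => visit ψ ρ S t j) atTop (𝓝 0) := by
  have nn := visit_nonneg hψ (fun i => (hρ.1 i).1) S
  refine Relation.ReflTransGen.head_induction_on
    (motive := fun i _ => Tendsto (fun t => visit ψ ρ S t i) atTop (𝓝 0)) (hρ.2 j) ?_ ?_
  · exact (summable_visit hψ hρ.1 (by simp)).tendsto_atTop_zero
  · intro k i hki _ ih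
    by_cases hk : k ∈ Finset.insertNone S
    · exact (summable_visit hψ hρ.1 hk).tendsto_atTop_zero
    · have ih' := ((tendsto_add_atTop_iff_nat 1).2 ih).div_const (ρ k i)
      rw [zero_div] at ih'
      refine squeeze_zero (fun t => nn t k) (fun t => ?_) ih'
      rw [le_div_iff₀ hki]
      exact Finset.single_le_sum (f := fun k => visit ψ ρ S t k * ρ k i)
        (fun l _ => mul_nonneg (nn t l) ((hρ.1 l).1 i)) (Finset.mem_compl.2 hk)

theorem choiceProb_nonneg (hψ : ∀ i, 0 ≤ ψ i) (hρ : ∀ i j, 0 ≤ ρ i j) (S : Finset (Fin n))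
    (j : Option (Fin n)) : 0 ≤ choiceProb ψ ρ S j := by
  unfold choiceProb
  split_ifs
  · exact tsum_nonneg fun t => visit_nonneg hψ hρ S t j
  · exact le_rfl

theorem hasSum_singleRevenue (hψ : ∀ i, 0 ≤ ψ i) (hρ : ∀ i, IsProb (ρ i))
    (r : Option (Fin n) → ℝ) (S : Finset (Fin n)) :
    HasSum (fun t => ∑ j ∈ Finset.insertNone S, r j * visit ψ ρ S t j)
      (singleRevenue ψ ρ r S) := by
  refine hasSum_sum fun j hj => ?_
  rw [choiceProb, if_pos hj]
  exact (summable_visit hψ hρ hj).hasSum.mul_left _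

/-- Valid for any `V` and `S`. The optimality of a stopping rule is decided by comparing these
decrements, term by term, with the rewards collected at time `t`. -/
theorem singleRevenue_tendsto_telescope (hψ : ∀ i, 0 ≤ ψ i) (hρ : IsTransition ρ)
    (V : Option (Fin n) → ℝ) (S : Finset (Fin n)) :
    Tendsto (fun N => ∑ t ∈ Finset.range N,
      (∑ j, visit ψ ρ S t j * V j - ∑ j, visit ψ ρ S (t + 1) j * V j)) atTop
      (𝓝 (∑ j, ψ j * V j)) := by
  simp only [Finset.sum_range_sub']
  have h : Tendsto (fun N => ∑ j, visit ψ ρ S N j * V j) atTop (𝓝 (∑ j : Option (Fin n), 0 * V j)) :=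
    tendsto_finsetSum _ fun j _ => (tendsto_visit hψ hρ S j).mul_const _
  simpa [visit] using h.const_sub (∑ j, visit ψ ρ S 0 j * V j)

theorem IsStoppingValue.singleRevenue_le {r V : Option (Fin n) → ℝ} {S : Finset (Fin n)}
    (hV : IsStoppingValue ρ r S V) (hψ : ∀ i, 0 ≤ ψ i) (hρ : IsTransition ρ)
    (T : Finset (Fin n)) : singleRevenue ψ ρ r T ≤ ∑ j, ψ j * V j := by
  refine le_of_tendsto_of_tendsto' (hasSum_singleRevenue hψ hρ.1 r T).tendsto_sum_nat
    (singleRevenue_tendsto_telescope hψ hρ V T) fun N => Finset.sum_le_sum fun t _ => ?_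
  have nn := visit_nonneg hψ (fun i => (hρ.1 i).1) T t
  rw [sum_visit_succ, ← Finset.sum_add_sum_compl (Finset.insertNone T)
    (fun j => visit ψ ρ T t j * V j), add_sub_assoc, ← Finset.sum_sub_distrib]
  refine le_add_of_le_of_nonneg (Finset.sum_le_sum fun j _ => ?_)
    (Finset.sum_nonneg fun k hk => ?_)
  · rw [mul_comm]
    exact mul_le_mul_of_nonneg_left (hV.reward_le j) (nn j)
  · rw [← mul_sub]
    -- `none` always stops the chain, so a running state is a product; this is why `excessive` may
    -- omit `none`.
    refine mul_nonneg (nn k) (sub_nonneg.2 (hV.excessive k ?_))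
    rintro rfl
    simp at hk

theorem IsStoppingValue.singleRevenue_eq {r V : Option (Fin n) → ℝ} {S : Finset (Fin n)}
    (hV : IsStoppingValue ρ r S V) (hψ : ∀ i, 0 ≤ ψ i) (hρ : IsTransition ρ) :
    singleRevenue ψ ρ r S = ∑ j, ψ j * V j := by
  refine tendsto_nhds_unique (hasSum_singleRevenue hψ hρ.1 r S).tendsto_sum_nat
    ((singleRevenue_tendsto_telescope hψ hρ V S).congr fun N => Finset.sum_congr rfl fun t _ => ?_)
  rw [sum_visit_succ, ← Finset.sum_add_sum_compl (Finset.insertNone S)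
    (fun j => visit ψ ρ S t j * V j), add_sub_assoc, ← Finset.sum_sub_distrib]
  rw [Finset.sum_eq_zero (s := (Finset.insertNone S)ᶜ), add_zero]
  · refine Finset.sum_congr rfl fun j hj => ?_
    rw [hV.stopped j hj, mul_comm]
  · intro k hk
    rw [← hV.running k (Finset.mem_compl.1 hk), sub_self]

/-- `V` does not involve the initial law, so the same `S` attains the bound `ψ · V` for every `ψ`.
-/
theorem IsStoppingValue.isInvariantOptimal {r V : Option (Fin n) → ℝ} {S : Finset (Fin n)}
    (hV : IsStoppingValue ρ r S V) (hρ : IsTransition ρ) : IsInvariantOptimal ρ r S :=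
  fun _ hψ T => (hV.singleRevenue_le hψ.1 hρ T).trans_eq (hV.singleRevenue_eq hψ.1 hρ).symm

end Visit


/-! ## State elimination -/

set_option linter.unusedSectionVars false

section Elimination

variable {K α : Type} [Field K] [LinearOrder K] [IsStrictOrderedRing K] [Fintype α]

/-- A stochastic matrix from all of whose states `z` is reachable. -/
structure Absorbs (ρ : α → α → K) (z : α) : Prop where
  nonneg : ∀ i j, 0 ≤ ρ i j
  sum_eq_one : ∀ i, ∑ j, ρ i j = 1
  reach : ∀ i, Relation.ReflTransGen (fun a b => 0 < ρ a b) i z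

theorem Absorbs.le_one {ρ : α → α → K} {z : α} (h : Absorbs ρ z) (i j : α) : ρ i j ≤ 1 :=
  (h.sum_eq_one i).symm ▸ Finset.single_le_sum (f := ρ i) (fun k _ => h.nonneg i k)
    (Finset.mem_univ j)

/-- A path to `z` cannot leave a closed set. Closed sets that avoid `z` are the source of the
contradictions below. -/
theorem Absorbs.of_closed {ρ : α → α → K} {z : α} (h : Absorbs ρ z) {X : α → Prop}
    (hX : ∀ i, X i → ∀ j, 0 < ρ i j → X j) {i : α} (hi : X i) : X z :=
  Relation.ReflTransGen.head_induction_on (motive := fun i _ => X i → X z) (h.reach i) id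
    (fun hki _ ih hk => ih (hX _ hk _ hki)) hi

/-- If an average of numbers `≤ c` is `≥ c`, then every number of positive weight equals `c`. -/
theorem Absorbs.eq_of_le_average {ρ : α → α → K} {z : α} (h : Absorbs ρ z) {i : α} {y : α → K}
    {c : K} (hy : ∀ j, y j ≤ c) (hc : c ≤ ∑ j, ρ i j * y j) {j : α} (hj : 0 < ρ i j) :
    y j = c := by
  have h0 : ∑ k, ρ i k * (c - y k) ≤ 0 := by
    simp only [mul_sub, Finset.sum_sub_distrib, ← Finset.sum_mul, h.sum_eq_one, one_mul]
    linarith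
  have h1 := Finset.single_le_sum (f := fun k => ρ i k * (c - y k))
    (fun k _ => mul_nonneg (h.nonneg i k) (sub_nonneg.2 (hy k))) (Finset.mem_univ j)
  have h2 : c - y j ≤ 0 := by
    by_contra hlt
    exact absurd (h1.trans h0) (not_le.2 (mul_pos hj (not_le.1 hlt)))
  exact le_antisymm (hy j) (by linarith)

variable [DecidableEq α]

/-- `B i j` is the probability that the chain with transition matrix `ρ`, started in `i`, enters
`A` at time `≥ 1` for the first time in `j`. -/
structure FirstEntry (ρ : α → α → K) (A : Finset α) (B : α → α → K) : Prop where
  nonneg : ∀ i j, 0 ≤ B i j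
  sum_eq_one : ∀ i, ∑ j, B i j = 1
  support : ∀ i, ∀ j ∉ A, B i j = 0
  step : ∀ i, ∀ j ∈ A, B i j = ρ i j + ∑ k ∈ Aᶜ, ρ i k * B k j

theorem FirstEntry.univ {ρ : α → α → K} {z : α} (h : Absorbs ρ z) :
    FirstEntry ρ Finset.univ ρ where
  nonneg := h.nonneg
  sum_eq_one := h.sum_eq_one
  support _ j hj := absurd (Finset.mem_univ j) hj
  step i j _ := by simp

variable {ρ B : α → α → K} {A : Finset α} {z : α}

theorem FirstEntry.le_one (hB : FirstEntry ρ A B) (i j : α) : B i j ≤ 1 :=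
  (hB.sum_eq_one i).symm ▸ Finset.single_le_sum (f := B i) (fun k _ => hB.nonneg i k)
    (Finset.mem_univ j)

/-- If the return to `k` were certain, the states outside `A` or equal to `k` from which `A` is
entered surely in `k` would form a closed set. It avoids `z`, which lies in `A` and differs from
`k`. -/
theorem FirstEntry.pivot_lt_one (h : Absorbs ρ z) (hB : FirstEntry ρ A B) (hz : z ∈ A) {k : α}
    (hk : k ∈ A) (hkz : k ≠ z) : B k k < 1 := by
  refine lt_of_le_of_ne (hB.le_one k k) fun hkk => ?_
  have hX := h.of_closed (X := fun i => (i ∉ A ∨ i = k) ∧ B i k = 1) (i := k) ?_ ⟨Or.inr rfl, hkk⟩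
  · rcases hX.1 with h1 | h1
    · exact h1 hz
    · exact hkz h1.symm
  · rintro i ⟨-, hi⟩ j hij
    -- The averaged function is the probability of entering in `k` once the chain has moved to `j`:
    -- `1` at `k`, `0` on the rest of `A`, `B j k` outside. Its mean under `ρ i` is `B i k = 1`.
    have key : (if j = k then 1 else if j ∈ A then 0 else B j k) = 1 := by
      refine h.eq_of_le_average (y := fun j => if j = k then 1 else if j ∈ A then 0 else B j k)
        (fun j => ?_) ?_ hij
      · split_ifs
        exacts [le_rfl, zero_le_one, hB.le_one j k]
      · refine hi.symm.le.trans ((hB.step i k hk).le.trans ?_)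
        rw [← Finset.sum_add_sum_compl A]
        refine add_le_add ?_ (Finset.sum_le_sum fun l hl => ?_)
        · rw [Finset.sum_eq_single_of_mem k hk]
          · simp
          · intro l hl hlk
            simp [hlk, hl]
        · have hl' := Finset.mem_compl.1 hl
          have hlk : l ≠ k := fun e => hl' (e ▸ hk)
          simp [hlk, hl']
    split_ifs at key with h1 h2
    · exact ⟨Or.inr h1, h1 ▸ hkk⟩
    · exact absurd key zero_ne_one
    · exact ⟨Or.inl h2, key⟩

/-- Eliminating the state `k` from the set of states at which the chain is observed. -/
def eliminate (A : Finset α) (B : α → α → K) (k : α) (i j : α) : K :=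
  if j ∈ A.erase k then B i j + B i k * B k j / (1 - B k k) else 0

/-- Column `k` of `B` vanishes already. Hence the program may eliminate a product without testing
whether it is still present. -/
theorem FirstEntry.eliminate_of_notMem (hB : FirstEntry ρ A B) {k : α} (hk : k ∉ A) :
    eliminate A B k = B := by
  funext i j
  rw [eliminate, Finset.erase_eq_of_notMem hk, hB.support i k hk]
  split_ifs with hj
  · simp
  · exact (hB.support i j hj).symm

/-- The mass that entered at `k` is redistributed along row `k`, conditioned on not returning to
`k`. -/
theorem FirstEntry.sum_eliminate (hB : FirstEntry ρ A B) (k : α) (i : α) (r : α → K) :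
    ∑ j, eliminate A B k i j * r j =
      (∑ j, B i j * r j - B i k * r k) +
        B i k / (1 - B k k) * (∑ j, B k j * r j - B k k * r k) := by
  have key : ∀ i, ∑ j, B i j * r j - B i k * r k = ∑ j ∈ A.erase k, B i j * r j := by
    intro i
    rw [← Finset.sum_erase_eq_sub (Finset.mem_univ k)]
    refine (Finset.sum_subset (Finset.erase_subset_erase k (Finset.subset_univ A)) ?_).symm
    intro j hj hjA
    have : j ∉ A := fun hA => hjA (Finset.mem_erase.2 ⟨(Finset.mem_erase.1 hj).1, hA⟩)
    simp [hB.support i j this]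
  rw [key i, key k, Finset.mul_sum, ← Finset.sum_add_distrib]
  simp only [eliminate, ite_mul, zero_mul]
  rw [Finset.sum_ite_mem, Finset.univ_inter]
  refine Finset.sum_congr rfl fun j _ => by ring

/-- An entry into `A` at `k` is followed by a geometric number of returns to `k` before the chain
enters `A` elsewhere; the factor `1 / (1 - B k k)` sums these returns. -/
theorem FirstEntry.eliminate (h : Absorbs ρ z) (hB : FirstEntry ρ A B) (hz : z ∈ A) {k : α}
    (hkz : k ≠ z) : FirstEntry ρ (A.erase k) (eliminate A B k) := by
  by_cases hk : k ∈ A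
  swap
  · rw [hB.eliminate_of_notMem hk, Finset.erase_eq_of_notMem hk]
    exact hB
  have hlt := hB.pivot_lt_one h hz hk hkz
  have hne : 1 - B k k ≠ 0 := (sub_pos.2 hlt).ne'
  refine ⟨fun i j => ?_, fun i => ?_, fun i j hj => if_neg hj, fun i j hj => ?_⟩
  · rw [CrossCat.eliminate]
    split_ifs
    · exact add_nonneg (hB.nonneg i j)
        (div_nonneg (mul_nonneg (hB.nonneg i k) (hB.nonneg k j)) (sub_pos.2 hlt).le)
    · exact le_rfl
  · have := hB.sum_eliminate k i (fun _ => 1)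
    simp only [mul_one, hB.sum_eq_one] at this
    rw [this]
    field_simp
    ring
  · have hjA := (Finset.mem_erase.1 hj).2
    -- The unobserved states gain `k`. The step equations for the columns `j` and `k` turn the
    -- remaining sums over `Aᶜ` into `B i j - ρ i j` and `B i k - ρ i k`, and the claim becomes a
    -- rational identity.
    have hc : (A.erase k)ᶜ = insert k Aᶜ := by
      ext l
      simp only [Finset.mem_compl, Finset.mem_erase, Finset.mem_insert]
      tauto
    rw [hc, Finset.sum_insert (by simpa using hk)]
    simp only [CrossCat.eliminate, if_pos hj]
    have e1 : ∑ l ∈ Aᶜ, ρ i l * (B l j + B l k * B k j / (1 - B k k)) =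
        ∑ l ∈ Aᶜ, ρ i l * B l j + (∑ l ∈ Aᶜ, ρ i l * B l k) * (B k j / (1 - B k k)) := by
      rw [Finset.sum_mul, ← Finset.sum_add_distrib]
      exact Finset.sum_congr rfl fun l _ => by ring
    have e2 := hB.step i j hjA
    have e3 := hB.step i k hk
    rw [e1, eq_sub_of_add_eq' e2.symm, eq_sub_of_add_eq' e3.symm]
    field_simp
    ring

/-- First step analysis. The right side is the one-step mean of the candidate value function, so its
harmonicity and superharmonicity become statements about `∑ j, B i j * r j` alone. -/
theorem FirstEntry.sum_mul_eq (hB : FirstEntry ρ A B) (r : α → K) (i : α) :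
    ∑ j, B i j * r j =
      ∑ k, ρ i k * if k ∈ A then r k else ∑ j, B k j * r j := by
  have e : ∀ i, ∑ j, B i j * r j = ∑ j ∈ A, B i j * r j := fun i =>
    (Finset.sum_subset (Finset.subset_univ A) fun j _ hj => by simp [hB.support i j hj]).symm
  rw [← Finset.sum_add_sum_compl A fun k => ρ i k * _]
  have h1 : ∑ k ∈ A, ρ i k * (if k ∈ A then r k else ∑ j, B k j * r j) = ∑ k ∈ A, ρ i k * r k :=
    Finset.sum_congr rfl fun k hk => by rw [if_pos hk]
  have h2 : ∑ k ∈ Aᶜ, ρ i k * (if k ∈ A then r k else ∑ j, B k j * r j) =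
      ∑ j ∈ A, (∑ k ∈ Aᶜ, ρ i k * B k j) * r j := by
    simp only [Finset.sum_mul]
    rw [Finset.sum_comm]
    refine Finset.sum_congr rfl fun k hk => ?_
    rw [if_neg (Finset.mem_compl.1 hk), e, Finset.mul_sum]
    exact Finset.sum_congr rfl fun j _ => by ring
  rw [h1, h2, e, ← Finset.sum_add_distrib]
  exact Finset.sum_congr rfl fun j hj => by rw [hB.step i j hj, add_mul]

/-- Solving `r k ≤ ∑ j, B k j * r j` for `r k` shows that `r k` is at most the expected price of the
next entry outside `k`. Elimination replaces `r k` by the latter in every row, so the expectations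
can only grow. -/
theorem FirstEntry.le_sum_eliminate (h : Absorbs ρ z) (hB : FirstEntry ρ A B) (hz : z ∈ A)
    {k : α} (hkz : k ≠ z) {r : α → K} (hoff : ∀ i ∉ A, r i ≤ ∑ j, B i j * r j)
    (hk : r k ≤ ∑ j, B k j * r j) :
    ∀ i ∉ A.erase k, r i ≤ ∑ j, CrossCat.eliminate A B k i j * r j := by
  by_cases hkA : k ∈ A
  swap
  · rw [hB.eliminate_of_notMem hkA, Finset.erase_eq_of_notMem hkA]
    exact hoff
  have hpos : 0 < 1 - B k k := sub_pos.2 (hB.pivot_lt_one h hz hkA hkz)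
  intro i hi
  rw [hB.sum_eliminate]
  have hgain : r k ≤ (∑ j, B k j * r j - B k k * r k) / (1 - B k k) := by
    rw [le_div_iff₀ hpos]
    linarith
  rw [div_mul_eq_mul_div, mul_div_assoc]
  have hmul := mul_le_mul_of_nonneg_left hgain (hB.nonneg i k)
  by_cases hik : i = k
  · subst hik
    rw [mul_div_assoc']
    have : (∑ j, B i j * r j - B i i * r i) + B i i * (∑ j, B i j * r j - B i i * r i) / (1 - B i i)
        = (∑ j, B i j * r j - B i i * r i) / (1 - B i i) := by
      field_simp
      ring
    rw [this]
    exact hgain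
  · have := hoff i fun hiA => hi (Finset.mem_erase.2 ⟨hik, hiA⟩)
    linarith

end Elimination

/-! ### Existence of value functions by greedy elimination -/

section Value

variable {K : Type} [Field K] [LinearOrder K] [IsStrictOrderedRing K] {n : ℕ}
  {ρ B : Option (Fin n) → Option (Fin n) → K} {S : Finset (Fin n)} {r : Option (Fin n) → K}

/-- By `FirstEntry.sum_mul_eq` the one-step mean of this function is `∑ j, B i j * r j` at every
`i`. The two hypotheses then say that running is no worse outside the set and no better at its
products. -/
theorem FirstEntry.isStoppingValue (hB : FirstEntry ρ (Finset.insertNone S) B)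
    (hoff : ∀ i ∉ Finset.insertNone S, r i ≤ ∑ j, B i j * r j)
    (hbest : ∀ i ∈ S, ∑ j, B (some i) j * r j ≤ r (some i)) :
    IsStoppingValue ρ r S
      fun i => if i ∈ Finset.insertNone S then r i else ∑ j, B i j * r j where
  stopped _ hi := if_pos hi
  running i hi := by rw [← hB.sum_mul_eq, if_neg hi]
  reward_le i := by
    split_ifs with hi
    exacts [le_rfl, hoff i hi]
  excessive i hi := by
    rw [← hB.sum_mul_eq]
    split_ifs with h
    · obtain ⟨i, rfl⟩ := Option.ne_none_iff_exists'.1 hi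
      exact hbest i (by simpa using h)
    · exact le_rfl

theorem erase_insertNone (S : Finset (Fin n)) (k : Fin n) :
    (Finset.insertNone S).erase (some k) = Finset.insertNone (S.erase k) := by
  ext o
  cases o <;> simp

/-- Greedy elimination from the set of all products: each round with a violated `hbest` removes a
product, so the process ends. -/
theorem exists_isStoppingValue (h : Absorbs ρ none) (r : Option (Fin n) → K) :
    ∃ S V, IsStoppingValue ρ r S V := by
  suffices H : ∀ (S : Finset (Fin n)) (B : Option (Fin n) → Option (Fin n) → K),
      FirstEntry ρ (Finset.insertNone S) B →
      (∀ i ∉ Finset.insertNone S, r i ≤ ∑ j, B i j * r j) → ∃ S V, IsStoppingValue ρ r S V by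
    have e : Finset.insertNone (Finset.univ : Finset (Fin n)) = Finset.univ := by
      ext o
      cases o <;> simp
    exact H Finset.univ ρ (e ▸ FirstEntry.univ h) (by simp [e])
  intro S
  induction S using Finset.strongInduction with
  | H S ih =>
    intro B hB hoff
    by_cases hbest : ∀ i ∈ S, ∑ j, B (some i) j * r j ≤ r (some i)
    · exact ⟨S, _, hB.isStoppingValue hoff hbest⟩
    · push Not at hbest
      obtain ⟨k, hk, hlt⟩ := hbest
      have h1 := hB.eliminate h (by simp) (Option.some_ne_none k)
      have h2 := hB.le_sum_eliminate h (by simp) (Option.some_ne_none k) hoff hlt.le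
      rw [erase_insertNone] at h1 h2
      exact ih _ (Finset.erase_ssubset hk) _ h1 h2

theorem IsTransition.absorbs {ρ : Option (Fin n) → Option (Fin n) → ℝ} (h : IsTransition ρ) :
    Absorbs ρ none :=
  ⟨fun i => (h.1 i).1, fun i => (h.1 i).2, h.2⟩

theorem exists_isInvariantOptimal {ρ : Option (Fin n) → Option (Fin n) → ℝ} (h : IsTransition ρ)
    (r : Option (Fin n) → ℝ) : ∃ S, IsInvariantOptimal ρ r S := by
  obtain ⟨S, V, hV⟩ := exists_isStoppingValue h.absorbs r
  exact ⟨S, hV.isInvariantOptimal h⟩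

end Value

/-! ## Denominators of first entry probabilities -/

section Denominator

variable {α : Type} [Fintype α] [DecidableEq α] {ρ B : α → α → ℚ} {A : Finset α} {z : α}

/-- `q` is a fraction with denominator `E` (not necessarily reduced). -/
def HasDenom (E : ℕ) (q : ℚ) : Prop := ∃ a : ℤ, E * q = a

/-- Maximum principle for the chain killed on `A`: from a state where `|x|` is maximal and positive,
all successors are outside `A` and maximal too, so `z ∈ A` is never reached. -/
theorem Absorbs.eq_zero_of_killed (h : Absorbs ρ z) (hz : z ∈ A) {x : α → ℚ}
    (hx : ∀ i, x i = ∑ k ∈ Aᶜ, ρ i k * x k) : x = 0 := by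
  obtain ⟨i₀, -, hmax⟩ := Finset.exists_max_image Finset.univ (fun i => |x i|) ⟨z, Finset.mem_univ z⟩
  by_contra hne
  have hpos : 0 < |x i₀| := by
    obtain ⟨i, hi⟩ := Function.ne_iff.1 hne
    exact (abs_pos.2 hi).trans_le (hmax i (Finset.mem_univ i))
  have closed : ∀ i, |x i| = |x i₀| → ∀ j, 0 < ρ i j → j ∉ A ∧ |x j| = |x i₀| := by
    intro i hi j hij
    have key : (if j ∈ A then 0 else |x j|) = |x i₀| := by
      refine h.eq_of_le_average (y := fun j => if j ∈ A then 0 else |x j|) (fun j => ?_) ?_ hij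
      · split_ifs
        exacts [hpos.le, hmax j (Finset.mem_univ j)]
      · rw [← hi, hx i]
        refine (Finset.abs_sum_le_sum_abs _ _).trans ?_
        rw [← Finset.sum_add_sum_compl A]
        refine le_add_of_nonneg_of_le (Finset.sum_nonneg fun k hk => ?_)
          (Finset.sum_le_sum fun k hk => ?_)
        · simp [hk]
        · rw [abs_mul, abs_of_nonneg (h.nonneg i k), if_neg (Finset.mem_compl.1 hk)]
    split_ifs at key with h1
    · exact absurd key hpos.ne
    · exact ⟨h1, key⟩
  -- The maximum point `i₀` itself may lie in `A`; its successors do not, so the closed set is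
  -- entered at one of them.
  obtain ⟨j, -, hj⟩ : ∃ j ∈ Finset.univ, 0 < ρ i₀ j :=
    Finset.exists_lt_of_sum_lt (by simp [h.sum_eq_one])
  exact (h.of_closed (X := fun i => i ∉ A ∧ |x i| = |x i₀|) (fun i hi => closed i hi.2)
    (closed i₀ rfl j hj)).1 hz

/-- Each column of `B` solves a linear system whose matrix depends only on `ρ` and `A`, so Cramer's
rule provides one denominator for all entries. Bounding the pivots one after another would let the
bit lengths double in each elimination. -/
theorem FirstEntry.exists_hasDenom (h : Absorbs ρ z) (hB : FirstEntry ρ A B) (hz : z ∈ A) {D : ℕ}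
    (hD : 0 < D) (hden : ∀ i j, HasDenom D (ρ i j)) :
    ∃ Q : ℕ, 0 < Q ∧ Q ≤ (Fintype.card α).factorial * D ^ Fintype.card α ∧
      ∀ i j, HasDenom Q (B i j) := by
  choose N hN using hden
  -- `Z` is `D` times the identity minus the part of `ρ` that leads to states outside `A`; the
  -- factor `D` makes it integral.
  let Z : Matrix α α ℤ := fun i k => (if i = k then (D : ℤ) else 0) - if k ∈ A then 0 else N i k
  have hZ : ∀ i k, (Z i k : ℚ) = D * ((if i = k then 1 else 0) - if k ∈ A then 0 else ρ i k) := by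
    intro i k
    simp only [Z, Int.cast_sub, mul_sub]
    congr 1
    · split_ifs <;> simp
    · split_ifs <;> simp [hN]
  have hmul : ∀ (x : α → ℚ) i, (Z.map (Int.cast : ℤ → ℚ)).mulVec x i =
      D * (x i - ∑ k ∈ Aᶜ, ρ i k * x k) := by
    intro x i
    simp only [Matrix.mulVec, dotProduct, Matrix.map_apply, hZ, mul_assoc, ← Finset.mul_sum,
      sub_mul, Finset.sum_sub_distrib]
    congr 2
    · simp
    · rw [← Finset.sum_add_sum_compl A, Finset.sum_eq_zero (s := A), zero_add]
      · exact Finset.sum_congr rfl fun k hk => by rw [if_neg (Finset.mem_compl.1 hk)]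
      · intro k hk
        simp [hk]
  have hD' : (D : ℚ) ≠ 0 := by exact_mod_cast hD.ne'
  have hdet : Z.det ≠ 0 := by
    intro h0
    have h1 : (Z.map (Int.cast : ℤ → ℚ)).det = 0 := by
      have := (Int.castRingHom ℚ).map_det Z
      rw [h0, map_zero] at this
      exact this.symm
    obtain ⟨v, hv, hv0⟩ := Matrix.exists_mulVec_eq_zero_iff.2 h1
    refine hv (h.eq_zero_of_killed hz fun i => ?_)
    have := congrFun hv0 i
    rw [hmul] at this
    exact sub_eq_zero.1 ((mul_eq_zero.1 this).resolve_left hD')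
  have habs : ∀ i k, |Z i k| ≤ (D : ℤ) := by
    intro i k
    have : |(Z i k : ℚ)| ≤ D := by
      rw [hZ, abs_mul, abs_of_nonneg (Nat.cast_nonneg D)]
      refine mul_le_of_le_one_right (Nat.cast_nonneg D) ?_
      have h0 := h.nonneg i k
      have h1 := h.le_one i k
      rw [abs_le]
      split_ifs <;> constructor <;> linarith
    exact_mod_cast this
  refine ⟨Z.det.natAbs, Int.natAbs_pos.2 hdet, ?_, fun i j => ?_⟩
  -- All entries of `Z` are at most `D` in absolute value, so the Leibniz expansion gives `n! D^n`.
  · have := Matrix.det_le (abv := AbsoluteValue.abs) habs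
    simp only [AbsoluteValue.abs_apply, nsmul_eq_mul] at this
    zify
    exact_mod_cast this
  · suffices H : ∃ a : ℤ, (Z.det : ℚ) * B i j = a by
      obtain ⟨a, ha⟩ := H
      rcases Int.natAbs_eq Z.det with e | e
      · refine ⟨a, ?_⟩
        rw [← ha, e]
        simp
      · refine ⟨-a, ?_⟩
        rw [Int.cast_neg, ← ha, e]
        simp
    let y : α → ℤ := fun i => if j ∈ A then N i j else 0
    have hy : (Z.map (Int.cast : ℤ → ℚ)).mulVec (fun i => B i j) = fun i => (y i : ℚ) := by
      funext i
      rw [hmul]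
      simp only [y]
      split_ifs with hj
      · rw [hB.step i j hj, add_sub_cancel_right, hN]
      · simp [hB.support _ j hj]
    -- Multiplying `Z B = y` by the adjugate: `det Z` times column `j` of `B` is an integral vector.
    refine ⟨Z.adjugate.mulVec y i, ?_⟩
    have h1 := congrArg (fun v => (Z.map (Int.cast : ℤ → ℚ)).adjugate.mulVec v i) hy
    simp only [Matrix.mulVec_mulVec, Matrix.adjugate_mul, Matrix.smul_mulVec, Matrix.one_mulVec,
      Pi.smul_apply, smul_eq_mul] at h1
    have h2 : (Z.map (Int.cast : ℤ → ℚ)).det = (Z.det : ℚ) := ((Int.castRingHom ℚ).map_det Z).symm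
    have h3 : (Z.map (Int.cast : ℤ → ℚ)).adjugate = Z.adjugate.map (Int.cast : ℤ → ℚ) :=
      ((Int.castRingHom ℚ).map_adjugate Z).symm
    rw [h2, h3] at h1
    rw [h1]
    simp [Matrix.mulVec, dotProduct]

end Denominator


/-! ## The category graph and backward induction -/

-- The rank counts proper descendants. It is below `m` because `u` is not its own descendant, and it
-- drops along an edge because the child no longer counts itself.
open Classical in
theorem exists_rank {m : ℕ} {e : Fin m → Fin m → Bool}
    (h : ∀ u, ¬ Relation.TransGen (fun a b => e a b = true) u u) :
    ∃ rank : Fin m → ℕ, (∀ u, rank u < m) ∧ ∀ u w, e u w = true → rank w < rank u := by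
  refine ⟨fun u => (Finset.univ.filter fun w => Relation.TransGen (fun a b => e a b = true) u w).card,
    fun u => ?_, fun u w huw => Finset.card_lt_card ?_⟩
  · refine (Finset.card_lt_univ_of_notMem (x := u) ?_).trans_eq (Fintype.card_fin m)
    simpa using h u
  · refine Finset.ssubset_iff_subset_ne.2 ⟨fun x hx => ?_, fun heq => ?_⟩
    · simp only [Finset.mem_filter, Finset.mem_univ, true_and] at hx ⊢
      exact Relation.TransGen.head huw hx
    · have hw : w ∈ Finset.univ.filter fun x => Relation.TransGen (fun a b => e a b = true) w x := by
        rw [heq]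
        exact Finset.mem_filter.2 ⟨Finset.mem_univ w, Relation.TransGen.single huw⟩
      exact h w (by simpa using hw)

namespace MarketData

variable {d : MarketData ℝ}

theorem exists_isReverseTopological
    (h : ∀ u, ¬ Relation.TransGen (fun a b => d.edge a b = true) u u) :
    ∃ order, d.IsReverseTopological order := by
  obtain ⟨rank, -, hrank⟩ := exists_rank h
  refine ⟨(List.finRange d.m).mergeSort fun a b => decide (rank a ≤ rank b), ?_, ?_, ?_⟩
  · exact (List.mergeSort_perm _ _).nodup_iff.2 (List.nodup_finRange _)
  · intro u
    exact (List.mergeSort_perm _ _).mem_iff.2 (List.mem_finRange u)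
  · refine (List.pairwise_mergeSort (le := fun a b => decide (rank a ≤ rank b)) ?_ ?_ _).imp ?_
    · intro a b c hab hbc
      simp only [decide_eq_true_eq] at *
      exact hab.trans hbc
    · intro a b
      simpa using le_total (rank a) (rank b)
    · intro a b hab
      simp only [decide_eq_true_eq] at hab
      by_contra hne
      exact absurd (hrank a b (by simpa using hne)) (not_lt.2 hab)

/-- The assortments and adjusted prices in `s` satisfy the equations of the backward induction. -/
structure IsBackward (s : d.AlgState) : Prop where
  adj_eq : ∀ u, s.adj u = d.adjusted s u
  optimal : ∀ u, IsInvariantOptimal (d.rho u) (s.adj u) (s.assort u)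

theorem adjusted_congr {s s' : d.AlgState} {u : Fin d.m}
    (h : ∀ w, d.edge u w = true → s.assort w = s'.assort w ∧ s.adj w = s'.adj w) :
    d.adjusted s u = d.adjusted s' u := by
  funext i
  refine congrArg (d.optPrice u i + ·) (Finset.sum_congr rfl fun w hw => ?_)
  obtain ⟨h1, h2⟩ := h w (Finset.mem_filter.1 hw).2
  rw [h1, h2]

/-- Induction on the last category `v` processed. No earlier category has `v` as a child, nor has
`v` itself, so the update at `v` disturbs no adjusted price. Thus the equations hold in the final
state, not just at the time of processing. -/
theorem foldl_algStep_spec (hac : ∀ u, ¬ Relation.TransGen (fun a b => d.edge a b = true) u u)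
    (opt : d.Subroutine) (s₀ : d.AlgState) (l : List (Fin d.m)) (hnd : l.Nodup)
    (hpw : l.Pairwise fun a b => d.edge a b = false)
    (hch : ∀ u ∈ l, ∀ w, d.edge u w = true → w ∈ l) :
    ∀ u ∈ l, (l.foldl (d.algStep opt) s₀).adj u = d.adjusted (l.foldl (d.algStep opt) s₀) u ∧
      (l.foldl (d.algStep opt) s₀).assort u = opt u ((l.foldl (d.algStep opt) s₀).adj u) := by
  induction l using List.reverseRecOn with
  | nil => simp
  | append_singleton l v ih =>
    rw [List.nodup_append] at hnd
    rw [List.pairwise_append] at hpw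
    have hself : ∀ u, d.edge u u = false := fun u => by
      by_contra hne
      exact hac u (Relation.TransGen.single (by simpa using hne))
    have hch' : ∀ u ∈ l, ∀ w, d.edge u w = true → w ∈ l := by
      intro u hu w huw
      have hw := hch u (by simp [hu]) w huw
      rcases List.mem_append.1 hw with h | h
      · exact h
      · have := hpw.2.2 u hu w h
        simp [this] at huw
    have ih := ih hnd.1 hpw.1 hch'
    rw [List.foldl_append, List.foldl_cons, List.foldl_nil]
    set s := l.foldl (d.algStep opt) s₀
    have hne : ∀ u, u ≠ v → (d.algStep opt s v).assort u = s.assort u ∧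
        (d.algStep opt s v).adj u = s.adj u := fun u hu =>
      ⟨Function.update_of_ne hu _ _, Function.update_of_ne hu _ _⟩
    have hadj : ∀ u, d.edge u v = false →
        d.adjusted (d.algStep opt s v) u = d.adjusted s u := fun u hu =>
      adjusted_congr fun w hw => hne w fun e => by simp [e, hu] at hw
    intro u hu
    by_cases huv : u = v
    · subst huv
      rw [hadj u (hself u)]
      simp [algStep]
    · have hul : u ∈ l := by simpa [huv] using hu
      rw [hadj u (hpw.2.2 u hul v (by simp)), (hne u huv).1, (hne u huv).2]
      exact ih u hul

theorem IsAlgOutput.exists_isBackward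
    (hac : ∀ u, ¬ Relation.TransGen (fun a b => d.edge a b = true) u u)
    {S : d.Assortments} (h : d.IsAlgOutput S) :
    ∃ adj, IsBackward (d := d) ⟨S, adj⟩ := by
  obtain ⟨opt, order, hopt, ⟨hnd, hmem, hpw⟩, rfl⟩ := h
  have spec := foldl_algStep_spec hac opt ⟨fun _ => ∅, fun _ _ => 0⟩ order hnd hpw
    fun _ _ w _ => hmem w
  refine ⟨(order.foldl (d.algStep opt) ⟨fun _ => ∅, fun _ _ => 0⟩).adj,
    fun u => (spec u (hmem u)).1, fun u => ?_⟩
  have h2 := hopt u ((order.foldl (d.algStep opt) ⟨fun _ => ∅, fun _ _ => 0⟩).adj u)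
  rw [← (spec u (hmem u)).2] at h2
  exact h2

theorem Valid.exists_correct (hd : d.Valid) : ∃ opt : d.Subroutine, opt.Correct := by
  choose opt hopt using fun u r => exists_isInvariantOptimal (hd.rho_trans u) r
  exact ⟨opt, hopt⟩

theorem Valid.exists_isAlgOutput (hd : d.Valid) : ∃ S, d.IsAlgOutput S := by
  obtain ⟨opt, hopt⟩ := hd.exists_correct
  obtain ⟨order, horder⟩ := exists_isReverseTopological hd.acyclic
  exact ⟨_, opt, order, hopt, horder, rfl⟩

-- Needed because the program follows no prescribed order and calls no subroutine for arbitrary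
-- prices; all that is known of its result is that it solves the equations.
open Classical in
theorem IsBackward.isAlgOutput (hd : d.Valid) {s : d.AlgState} (hs : IsBackward s) :
    d.IsAlgOutput s.assort := by
  obtain ⟨opt₀, hopt₀⟩ := hd.exists_correct
  obtain ⟨order, horder⟩ := exists_isReverseTopological hd.acyclic
  obtain ⟨rank, -, hrank⟩ := exists_rank hd.acyclic
  -- A subroutine tailored to `s`: by induction on the rank, the algorithm asks it for `u` exactly
  -- at the prices `s.adj u`, where it answers with the given assortment.
  let opt : d.Subroutine := fun u r => if r = s.adj u then s.assort u else opt₀ u r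
  have hopt : opt.Correct := by
    intro u r
    simp only [opt]
    split_ifs with h
    · rw [h]
      exact hs.optimal u
    · exact hopt₀ u r
  refine ⟨opt, order, hopt, horder, ?_⟩
  have spec := foldl_algStep_spec hd.acyclic opt ⟨fun _ => ∅, fun _ _ => 0⟩ order horder.1
    horder.2.2 fun _ _ w _ => horder.2.1 w
  set s' := order.foldl (d.algStep opt) ⟨fun _ => ∅, fun _ _ => 0⟩ with hs'
  have key : ∀ k u, rank u < k → s'.assort u = s.assort u ∧ s'.adj u = s.adj u := by
    intro k
    induction k with
    | zero => intro u hu; omega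
    | succ k ih =>
      intro u hu
      obtain ⟨h1, h2⟩ := spec u (horder.2.1 u)
      have hadj : s'.adj u = s.adj u := by
        rw [h1, hs.adj_eq u]
        exact adjusted_congr fun w hw => ih w (by have := hrank u w hw; omega)
      refine ⟨?_, hadj⟩
      rw [h2, hadj]
      exact if_pos rfl
  funext u
  exact (key _ u (Nat.lt_succ_self _)).1

/-! ## Optimality of backward induction -/

theorem select_nonneg (hd : d.Valid) (T : d.Assortments) (t : ℕ) (w : Fin d.m)
    (j : Option (Fin (d.n w))) : 0 ≤ d.select T t w j := by
  have hρ : ∀ i j, 0 ≤ d.rho w i j := fun i => ((hd.rho_trans w).1 i).1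
  induction t generalizing w with
  | zero =>
    rw [select]
    split_ifs
    · exact choiceProb_nonneg (hd.psi_prob w).1 hρ _ _
    · exact le_rfl
  | succ t ih =>
    refine Finset.sum_nonneg fun u hu => Finset.sum_nonneg fun i _ => mul_nonneg ?_ ?_
    · exact ih u i fun i => ((hd.rho_trans u).1 i).1
    · exact choiceProb_nonneg (hd.lam_prob u w (Finset.mem_filter.1 hu).2 i).1 hρ _ _

/-- The rank grows by at least one per edge backwards, so a root from which `w` is reached by `t`
edges would have rank at least `m`. -/
theorem select_eq_zero {rank : Fin d.m → ℕ} (hm : ∀ u, rank u < d.m)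
    (hrank : ∀ u w, d.edge u w = true → rank w < rank u) (T : d.Assortments) (t : ℕ) (w : Fin d.m)
    (j : Option (Fin (d.n w))) (h : d.m ≤ rank w + t) : d.select T t w j = 0 := by
  induction t generalizing w with
  | zero => exact absurd (hm w) (by omega)
  | succ t ih =>
    refine Finset.sum_eq_zero fun u hu => Finset.sum_eq_zero fun i _ => ?_
    have := hrank u w (Finset.mem_filter.1 hu).2
    rw [ih u i (by omega), zero_mul]

/-- The expected total adjusted price of the options selected after exactly `t` edges. -/
noncomputable def potential (adj : (u : Fin d.m) → Option (Fin (d.n u)) → ℝ) (T : d.Assortments)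
    (t : ℕ) : ℝ :=
  ∑ w, ∑ j ∈ Finset.insertNone (T w), d.select T t w j * adj w j

theorem potential_zero (adj : (u : Fin d.m) → Option (Fin (d.n u)) → ℝ) (T : d.Assortments) :
    potential adj T 0 =
      ∑ w, if d.IsRoot w then singleRevenue (d.psi w) (d.rho w) (adj w) (T w) else 0 := by
  refine Finset.sum_congr rfl fun w _ => ?_
  simp only [select]
  split_ifs
  · exact Finset.sum_congr rfl fun j _ => mul_comm _ _
  · simp

theorem potential_succ (adj : (u : Fin d.m) → Option (Fin (d.n u)) → ℝ) (T : d.Assortments)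
    (t : ℕ) :
    potential adj T (t + 1) = ∑ u, ∑ i ∈ Finset.insertNone (T u), d.select T t u i *
      ∑ w with d.edge u w = true, singleRevenue (d.lam u w i) (d.rho w) (adj w) (T w) := by
  have h1 : potential adj T (t + 1) = ∑ w, ∑ u, if d.edge u w = true then
      ∑ i ∈ Finset.insertNone (T u), d.select T t u i *
        singleRevenue (d.lam u w i) (d.rho w) (adj w) (T w) else 0 := by
    refine Finset.sum_congr rfl fun w _ => ?_
    simp only [select, Finset.sum_mul]
    rw [Finset.sum_comm, Finset.sum_filter]
    refine Finset.sum_congr rfl fun u _ => ?_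
    split_ifs
    · rw [Finset.sum_comm]
      refine Finset.sum_congr rfl fun i _ => ?_
      rw [singleRevenue, Finset.mul_sum]
      exact Finset.sum_congr rfl fun j _ => by rw [condChoice]; ring
    · rfl
  rw [h1, Finset.sum_comm]
  refine Finset.sum_congr rfl fun u _ => ?_
  simp only [Finset.mul_sum]
  rw [Finset.sum_comm, Finset.sum_filter]

theorem adjusted_eq (s : d.AlgState) (u : Fin d.m) (i : Option (Fin (d.n u))) :
    d.adjusted s u i = d.optPrice u i + ∑ w with d.edge u w = true,
      singleRevenue (d.lam u w i) (d.rho w) (s.adj w) (s.assort w) := by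
  refine congrArg (d.optPrice u i + ·) (Finset.sum_congr rfl fun w _ =>
    Finset.sum_congr rfl fun j _ => mul_comm _ _)

/-- The subtracted sum is what the next level would be worth, in adjusted prices, if the children
offered the assortments in `s`. By `potential_succ`, replacing these by `T` turns it into the next
potential. -/
theorem IsBackward.price_eq {s : d.AlgState} (hs : IsBackward s) (T : d.Assortments) (t : ℕ) :
    ∑ u, ∑ i ∈ Finset.insertNone (T u), d.optPrice u i * d.select T t u i =
      potential s.adj T t - ∑ u, ∑ i ∈ Finset.insertNone (T u), d.select T t u i *
        ∑ w with d.edge u w = true,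
          singleRevenue (d.lam u w i) (d.rho w) (s.adj w) (s.assort w) := by
  rw [potential, ← Finset.sum_sub_distrib]
  refine Finset.sum_congr rfl fun u _ => ?_
  rw [← Finset.sum_sub_distrib]
  refine Finset.sum_congr rfl fun i _ => ?_
  rw [hs.adj_eq u, adjusted_eq]
  ring

theorem IsBackward.isOptimal (hd : d.Valid) {s : d.AlgState} (hs : IsBackward s) :
    d.IsOptimal s.assort := by
  obtain ⟨rank, hm, hrank⟩ := exists_rank hd.acyclic
  have hend : ∀ T : d.Assortments, potential s.adj T d.m = 0 := fun T =>
    Finset.sum_eq_zero fun w _ => Finset.sum_eq_zero fun j _ => by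
      rw [select_eq_zero hm hrank T d.m w j (by omega), zero_mul]
  have htele : ∀ T : d.Assortments, ∑ t ∈ Finset.range d.m,
      (potential s.adj T t - potential s.adj T (t + 1)) = potential s.adj T 0 := fun T => by
    rw [Finset.sum_range_sub', hend, sub_zero]
  intro T
  calc d.revenue T
      ≤ ∑ t ∈ Finset.range d.m, (potential s.adj T t - potential s.adj T (t + 1)) := by
        refine Finset.sum_le_sum fun t _ => ?_
        rw [hs.price_eq T t, potential_succ]
        refine sub_le_sub_left (Finset.sum_le_sum fun u _ => Finset.sum_le_sum fun i _ => ?_) _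
        -- Invariance at work: the assortment of `w` must be optimal for `λ^i`, whichever option `i`
        -- of whichever parent was chosen.
        exact mul_le_mul_of_nonneg_left (Finset.sum_le_sum fun w hw => hs.optimal w _
          (hd.lam_prob u w (Finset.mem_filter.1 hw).2 i) (T w)) (select_nonneg hd T t u i)
    _ = potential s.adj T 0 := htele T
    _ ≤ potential s.adj s.assort 0 := by
        rw [potential_zero, potential_zero]
        refine Finset.sum_le_sum fun w _ => ?_
        split_ifs
        · exact hs.optimal w _ (hd.psi_prob w) (T w)
        · exact le_rfl
    _ = ∑ t ∈ Finset.range d.m, (potential s.adj s.assort t - potential s.adj s.assort (t + 1)) :=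
        (htele _).symm
    _ = d.revenue s.assort :=
        Finset.sum_congr rfl fun t _ => by rw [hs.price_eq s.assort t, potential_succ]

theorem IsAlgOutput.isOptimal (hd : d.Valid) {S : d.Assortments} (h : d.IsAlgOutput S) :
    d.IsOptimal S := by
  obtain ⟨adj, hS⟩ := h.exists_isBackward hd.acyclic
  exact hS.isOptimal hd

/-- Value functions of the categories that satisfy the backward recursion determine a solution
of the backward induction. -/
theorem isBackward_of_isStoppingValue (hd : d.Valid) {s : d.AlgState}
    {V : (u : Fin d.m) → Option (Fin (d.n u)) → ℝ}
    (hV : ∀ u, IsStoppingValue (d.rho u) (s.adj u) (s.assort u) (V u))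
    (hadj : ∀ u i, s.adj u i = d.optPrice u i +
      ∑ w with d.edge u w = true, ∑ j, d.lam u w i j * V w j) : IsBackward s where
  adj_eq u := by
    funext i
    rw [adjusted_eq, hadj]
    refine congrArg (d.optPrice u i + ·) (Finset.sum_congr rfl fun w hw => ?_)
    exact ((hV w).singleRevenue_eq (hd.lam_prob u w (Finset.mem_filter.1 hw).2 i).1
      (hd.rho_trans w)).symm
  optimal u := (hV u).isInvariantOptimal (hd.rho_trans u)

end MarketData


/-! ## Bit lengths -/

/-- The larger of the bit lengths of numerator and denominator. -/
def height (q : ℚ) : ℕ := max (Nat.size q.num.natAbs) (Nat.size q.den)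

theorem bits_le_two_mul_height (q : ℚ) : bits q ≤ 2 * height q := by
  have h1 : Nat.size q.num.natAbs ≤ height q := le_max_left _ _
  have h2 : Nat.size q.den ≤ height q := le_max_right _ _
  unfold bits
  omega

theorem height_le_bits (q : ℚ) : height q ≤ bits q :=
  max_le (Nat.le_add_right _ _) (Nat.le_add_left _ _)

theorem natAbs_num_lt (q : ℚ) : q.num.natAbs < 2 ^ height q :=
  Nat.size_le.1 (le_max_left _ _)

theorem den_lt (q : ℚ) : q.den < 2 ^ height q :=
  Nat.size_le.1 (le_max_right _ _)

theorem num_den_le_of_eq_div {q : ℚ} {a : ℤ} {b : ℕ} (hb : 0 < b) (h : q = a / b) :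
    q.num.natAbs ≤ a.natAbs ∧ q.den ≤ b := by
  have hb' : (b : ℤ) ≠ 0 := by exact_mod_cast hb.ne'
  have hq : q = Rat.divInt a b := by rw [h, Rat.divInt_eq_div]; simp
  constructor
  · by_cases ha : a = 0
    · simp [h, ha]
    · have := Rat.num_dvd a hb'
      rw [← hq] at this
      exact Nat.le_of_dvd (Int.natAbs_pos.2 ha) (Int.natAbs_dvd_natAbs.2 this)
  · have := Rat.den_dvd a b
    rw [← hq] at this
    exact Nat.le_of_dvd hb (by exact_mod_cast this)

theorem height_le_of_eq_div {q : ℚ} {a : ℤ} {b k : ℕ} (hb : 0 < b) (h : q = a / b)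
    (hak : a.natAbs < 2 ^ k) (hbk : b < 2 ^ k) : height q ≤ k := by
  obtain ⟨h1, h2⟩ := num_den_le_of_eq_div hb h
  exact max_le (Nat.size_le.2 (h1.trans_lt hak)) (Nat.size_le.2 (h2.trans_lt hbk))

/-- The maximum of the two bit lengths grows additively, up to one carry bit. Their sum `bits` would
not: each denominator enters the new numerator and the new denominator. -/
theorem height_add_le (x y : ℚ) : height (x + y) ≤ height x + height y + 1 := by
  have hx := natAbs_num_lt x
  have hy := natAbs_num_lt y
  have hx' := den_lt x
  have hy' := den_lt y
  refine height_le_of_eq_div (a := x.num * y.den + y.num * x.den) (b := x.den * y.den)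
    (Nat.mul_pos x.pos y.pos) ?_ ?_ ?_
  · have h1 : (x.den : ℚ) ≠ 0 := by exact_mod_cast x.den_nz
    have h2 : (y.den : ℚ) ≠ 0 := by exact_mod_cast y.den_nz
    conv_lhs => rw [← Rat.num_div_den x, ← Rat.num_div_den y]
    push_cast
    field_simp
  · refine (Int.natAbs_add_le _ _).trans_lt ?_
    rw [Int.natAbs_mul, Int.natAbs_mul, Int.natAbs_natCast, Int.natAbs_natCast]
    have h1 : x.num.natAbs * y.den < 2 ^ height x * 2 ^ height y := Nat.mul_lt_mul'' hx hy'
    have h2 : y.num.natAbs * x.den < 2 ^ height y * 2 ^ height x := Nat.mul_lt_mul'' hy hx'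
    rw [pow_succ, pow_add]
    linarith
  · have h1 : x.den * y.den < 2 ^ height x * 2 ^ height y := Nat.mul_lt_mul'' hx' hy'
    rw [pow_succ, pow_add]
    exact h1.trans_le (Nat.le_mul_of_pos_right _ two_pos)

theorem height_neg (x : ℚ) : height (-x) = height x := by simp [height]

theorem height_sub_le (x y : ℚ) : height (x - y) ≤ height x + height y + 1 := by
  rw [sub_eq_add_neg, ← height_neg y]
  exact height_add_le x (-y)

theorem height_mul_le (x y : ℚ) : height (x * y) ≤ height x + height y := by
  refine height_le_of_eq_div (a := x.num * y.num) (b := x.den * y.den)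
    (Nat.mul_pos x.pos y.pos) ?_ ?_ ?_
  · conv_lhs => rw [← Rat.num_div_den x, ← Rat.num_div_den y]
    push_cast
    rw [div_mul_div_comm]
  · rw [Int.natAbs_mul, pow_add]
    exact Nat.mul_lt_mul'' (natAbs_num_lt x) (natAbs_num_lt y)
  · rw [pow_add]
    exact Nat.mul_lt_mul'' (den_lt x) (den_lt y)

theorem height_inv_le (x : ℚ) : height x⁻¹ ≤ height x := by
  by_cases hx : x = 0
  · simp [hx]
  · have hn : x.num ≠ 0 := Rat.num_ne_zero.2 hx
    -- Denominators are natural numbers, so the sign of `x` has to move to the numerator of the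
    -- inverse.
    refine height_le_of_eq_div (a := x.num.sign * x.den) (b := x.num.natAbs)
      (Int.natAbs_pos.2 hn) ?_ ?_ (natAbs_num_lt x)
    · have h1 : (x.den : ℚ) ≠ 0 := by exact_mod_cast x.den_nz
      have h2 : (x.num.natAbs : ℚ) ≠ 0 := by exact_mod_cast (Int.natAbs_pos.2 hn).ne'
      have h3 : (x.num.sign : ℚ) * x.num.natAbs = x.num := by
        rw [← Int.cast_natCast (R := ℚ) x.num.natAbs, ← Int.cast_mul, Int.sign_mul_natAbs]
      have h4 : (x.num.sign : ℚ) ≠ 0 := by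
        exact_mod_cast fun h => hn (Int.sign_eq_zero_iff_zero.1 h)
      have h5 : (x.num.sign : ℚ) * x.num.sign = 1 := by
        rcases lt_or_gt_of_ne hn with h | h
        · simp [Int.sign_eq_neg_one_of_neg h]
        · simp [Int.sign_eq_one_of_pos h]
      conv_lhs => rw [← Rat.num_div_den x, ← h3]
      push_cast
      field_simp
      linarith
    · rw [Int.natAbs_mul, Int.natAbs_sign_of_ne_zero hn, one_mul, Int.natAbs_natCast]
      exact den_lt x

theorem height_div_le (x y : ℚ) : height (x / y) ≤ height x + height y := by
  rw [div_eq_mul_inv]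
  exact (height_mul_le x y⁻¹).trans (Nat.add_le_add_left (height_inv_le y) _)

theorem bits_natCast_le (n : ℕ) : bits (n : ℚ) ≤ n + 1 := by
  simp only [bits, Rat.num_natCast, Rat.den_natCast, Int.natAbs_natCast, Nat.size_one]
  exact Nat.add_le_add_right (Nat.size_le.2 Nat.lt_two_pow_self) 1

/-! ## Cost of expressions -/

namespace Expr

/-- Bound for the height of the value of an expression, relative to the size of the cells read. -/
def heightBound : Expr → ℕ
  | .lit z => height z
  | .get _ _ _ _ _ => 1
  | .add e f => e.heightBound + f.heightBound + 1
  | .sub e f => e.heightBound + f.heightBound + 1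
  | .mul e f => e.heightBound + f.heightBound
  | .div e f => e.heightBound + f.heightBound

/-- Bound for the cost of an expression, relative to the size of the cells read. -/
def costBound : Expr → ℕ
  | .lit z => 1 + bits z
  | .get _ i j k l => i.costBound + j.costBound + k.costBound + l.costBound + 1
  | .add e f => e.costBound + f.costBound + 1 + 2 * (e.heightBound + f.heightBound + 1)
  | .sub e f => e.costBound + f.costBound + 1 + 2 * (e.heightBound + f.heightBound + 1)
  | .mul e f => e.costBound + f.costBound + 1 + 2 * (e.heightBound + f.heightBound)
  | .div e f => e.costBound + f.costBound + 1 + 2 * (e.heightBound + f.heightBound)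

/-- All cells read in the evaluation of the expression have at most `b` bits. -/
def Safe (b : ℕ) (s : Store) : Expr → Prop
  | .lit _ => True
  | .get a i j k l => i.Safe b s ∧ j.Safe b s ∧ k.Safe b s ∧ l.Safe b s ∧
      bits (s a ⌊i.eval s⌋₊ ⌊j.eval s⌋₊ ⌊k.eval s⌋₊ ⌊l.eval s⌋₊) ≤ b
  | .add e f => e.Safe b s ∧ f.Safe b s
  | .sub e f => e.Safe b s ∧ f.Safe b s
  | .mul e f => e.Safe b s ∧ f.Safe b s
  | .div e f => e.Safe b s ∧ f.Safe b s

variable {b : ℕ} {s : Store}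

theorem Safe.height_le {e : Expr} (h : e.Safe b s) :
    height (e.eval s) ≤ e.heightBound * (b + 1) := by
  induction e with
  | lit z => exact Nat.le_mul_of_pos_right _ (Nat.succ_pos b)
  | get a i j k l _ _ _ _ =>
    have := (height_le_bits _).trans h.2.2.2.2
    simp only [eval, heightBound]
    omega
  | add e f ihe ihf =>
    have := height_add_le (e.eval s) (f.eval s)
    have := ihe h.1
    have := ihf h.2
    simp only [eval, heightBound]
    linarith
  | sub e f ihe ihf =>
    have := height_sub_le (e.eval s) (f.eval s)
    have := ihe h.1
    have := ihf h.2
    simp only [eval, heightBound]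
    linarith
  | mul e f ihe ihf =>
    have := height_mul_le (e.eval s) (f.eval s)
    have := ihe h.1
    have := ihf h.2
    simp only [eval, heightBound]
    linarith
  | div e f ihe ihf =>
    have := height_div_le (e.eval s) (f.eval s)
    have := ihe h.1
    have := ihf h.2
    simp only [eval, heightBound]
    linarith

theorem Safe.cost_le {e : Expr} (h : e.Safe b s) : e.cost s ≤ e.costBound * (b + 1) := by
  induction e with
  | lit z => exact Nat.le_mul_of_pos_right _ (Nat.succ_pos b)
  | get a i j k l ihi ihj ihk ihl =>
    have hb : bits (eval s (.get a i j k l)) ≤ b := h.2.2.2.2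
    have := ihi h.1
    have := ihj h.2.1
    have := ihk h.2.2.1
    have := ihl h.2.2.2.1
    simp only [cost, costBound]
    linarith
  | add e f ihe ihf =>
    have := bits_le_two_mul_height (e.eval s + f.eval s)
    have := height_le (e := .add e f) h
    have := ihe h.1
    have := ihf h.2
    simp only [eval, heightBound, cost, costBound] at *
    linarith
  | sub e f ihe ihf =>
    have := bits_le_two_mul_height (e.eval s - f.eval s)
    have := height_le (e := .sub e f) h
    have := ihe h.1
    have := ihf h.2
    simp only [eval, heightBound, cost, costBound] at *
    linarith
  | mul e f ihe ihf =>
    have := bits_le_two_mul_height (e.eval s * f.eval s)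
    have := height_le (e := .mul e f) h
    have := ihe h.1
    have := ihf h.2
    simp only [eval, heightBound, cost, costBound] at *
    linarith
  | div e f ihe ihf =>
    have := bits_le_two_mul_height (e.eval s / f.eval s)
    have := height_le (e := .div e f) h
    have := ihe h.1
    have := ihf h.2
    simp only [eval, heightBound, cost, costBound] at *
    linarith

/-- The expression has the value `v`, and only cells of at most `b` bits are read. -/
structure Evals (b : ℕ) (s : Store) (e : Expr) (v : ℚ) : Prop where
  safe : e.Safe b s
  eval_eq : e.eval s = v

theorem Evals.zero : Evals b s (.lit 0) ((0 : ℕ) : ℚ) := ⟨trivial, by simp [eval]⟩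

theorem Evals.one : Evals b s (.lit 1) 1 := ⟨trivial, by simp [eval]⟩

theorem Evals.get {a i' j' k' l' : ℕ} {i j k l : Expr} (hi : Evals b s i i') (hj : Evals b s j j')
    (hk : Evals b s k k') (hl : Evals b s l l') (hb : bits (s a i' j' k' l') ≤ b) :
    Evals b s (.get a i j k l) (s a i' j' k' l') := by
  have e : s a ⌊i.eval s⌋₊ ⌊j.eval s⌋₊ ⌊k.eval s⌋₊ ⌊l.eval s⌋₊ = s a i' j' k' l' := by
    rw [hi.eval_eq, hj.eval_eq, hk.eval_eq, hl.eval_eq]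
    simp only [Nat.floor_natCast]
  exact ⟨⟨hi.safe, hj.safe, hk.safe, hl.safe, e.symm ▸ hb⟩, e⟩

variable {e f : Expr} {x y : ℚ}

theorem Evals.add (he : Evals b s e x) (hf : Evals b s f y) : Evals b s (.add e f) (x + y) :=
  ⟨⟨he.safe, hf.safe⟩, by rw [eval, he.eval_eq, hf.eval_eq]⟩

theorem Evals.sub (he : Evals b s e x) (hf : Evals b s f y) : Evals b s (.sub e f) (x - y) :=
  ⟨⟨he.safe, hf.safe⟩, by rw [eval, he.eval_eq, hf.eval_eq]⟩

theorem Evals.mul (he : Evals b s e x) (hf : Evals b s f y) : Evals b s (.mul e f) (x * y) :=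
  ⟨⟨he.safe, hf.safe⟩, by rw [eval, he.eval_eq, hf.eval_eq]⟩

theorem Evals.div (he : Evals b s e x) (hf : Evals b s f y) : Evals b s (.div e f) (x / y) :=
  ⟨⟨he.safe, hf.safe⟩, by rw [eval, he.eval_eq, hf.eval_eq]⟩

theorem Evals.succ {x : ℕ} (he : Evals b s e x) : Evals b s (.add e (.lit 1)) ((x + 1 : ℕ) : ℚ) := by
  rw [Nat.cast_succ]
  exact he.add Evals.one

theorem Evals.cost_le (h : Evals b s e x) : e.cost s ≤ e.costBound * (b + 1) := h.safe.cost_le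

/-- The scalar variable `a`. -/
def var (a : ℕ) : Expr := .get a (.lit 0) (.lit 0) (.lit 0) (.lit 0)

/-- The entry `a[e, f]` of a matrix. -/
def entry (a : ℕ) (e f : Expr) : Expr := .get a e f (.lit 0) (.lit 0)

theorem Evals.var {a : ℕ} (h : s a 0 0 0 0 = x) (hb : bits x ≤ b) : Evals b s (var a) x := by
  subst h
  exact Evals.get .zero .zero .zero .zero hb

theorem Evals.entry {a i j : ℕ} (he : Evals b s e i) (hf : Evals b s f j) (h : s a i j 0 0 = x)
    (hb : bits x ≤ b) : Evals b s (entry a e f) x := by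
  subst h
  exact Evals.get he hf .zero .zero hb

end Expr

/-! ## Programs with counting loops -/

/-- Programs whose only loops are counting loops. `loop v e c` runs `c` for the values
`0, 1, …, e - 1` of the variable `v`. -/
inductive Imp : Type
  | skip
  | assign (a : ℕ) (i j k l e : Expr)
  | seq (c₁ c₂ : Imp)
  | ifLe (e f : Expr) (c₁ c₂ : Imp)
  | loop (v : ℕ) (e : Expr) (c : Imp)

namespace Imp

/-- Setting a scalar variable. -/
def setVar (v : ℕ) (e : Expr) : Imp := .assign v (.lit 0) (.lit 0) (.lit 0) (.lit 0) e

/-- Setting an entry of a matrix. -/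
def setEntry (a : ℕ) (i j e : Expr) : Imp := .assign a i j (.lit 0) (.lit 0) e

/-- Translation into the machine language. -/
def toCmd : Imp → Cmd
  | .skip => .skip
  | .assign a i j k l e => .assign a i j k l e
  | .seq c₁ c₂ => .seq c₁.toCmd c₂.toCmd
  | .ifLe e f c₁ c₂ => .ifLe e f c₁.toCmd c₂.toCmd
  | .loop v e c => .seq (.assign v (.lit 0) (.lit 0) (.lit 0) (.lit 0) (.lit 0))
      (.whileLt (.var v) e (.seq c.toCmd
        (.assign v (.lit 0) (.lit 0) (.lit 0) (.lit 0) (.add (.var v) (.lit 1)))))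

/-- The arrays a program writes to. -/
def mods : Imp → List ℕ
  | .skip => []
  | .assign a _ _ _ _ _ => [a]
  | .seq c₁ c₂ => c₁.mods ++ c₂.mods
  | .ifLe _ _ c₁ c₂ => c₁.mods ++ c₂.mods
  | .loop v _ c => v :: c.mods

@[simp]
theorem mods_setVar (v : ℕ) (e : Expr) : (setVar v e).mods = [v] := rfl

@[simp]
theorem mods_setEntry (a : ℕ) (i j e : Expr) : (setEntry a i j e).mods = [a] := rfl

/-- Bound for the cost of an assignment. -/
def assignTime (i j k l e : Expr) (b : ℕ) : ℕ :=
  (i.costBound + j.costBound + k.costBound + l.costBound + e.costBound) * (b + 1) + 1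

/-- Bound for the cost of the loop control. -/
def guardTime (v : ℕ) (e : Expr) (b : ℕ) : ℕ :=
  ((Expr.var v).costBound + e.costBound) * (b + 1) + 1

/-- Bound for the cost of a program all of whose loops are executed at most `N` times, and that
reads cells of at most `b` bits only. -/
def time (N b : ℕ) : Imp → ℕ
  | .skip => 1
  | .assign _ i j k l e => assignTime i j k l e b
  | .seq c₁ c₂ => c₁.time N b + c₂.time N b + 1
  | .ifLe e f c₁ c₂ => (e.costBound + f.costBound) * (b + 1) + (c₁.time N b + c₂.time N b) + 1
  | .loop v e c => assignTime (.lit 0) (.lit 0) (.lit 0) (.lit 0) (.lit 0) b +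
      (N * (guardTime v e b + (c.time N b + assignTime (.lit 0) (.lit 0) (.lit 0) (.lit 0)
        (.add (.var v) (.lit 1)) b + 1)) + guardTime v e b) + 1

/-- The cost is linear in the bit length `b`, and each level of loop nesting adds one to the degree
in `N`. -/
theorem exists_time_le (c : Imp) :
    ∃ K e : ℕ, ∀ N b, c.time N b ≤ K * ((N + 1) ^ e * (b + 1)) := by
  have hpos : ∀ N b e : ℕ, 1 ≤ (N + 1) ^ e * (b + 1) := fun N b e => Nat.succ_le_of_lt (by positivity)
  have mono : ∀ {N b e e' : ℕ}, e ≤ e' → (N + 1) ^ e * (b + 1) ≤ (N + 1) ^ e' * (b + 1) :=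
    fun h => Nat.mul_le_mul_right _ (Nat.pow_le_pow_right (Nat.succ_pos _) h)
  induction c with
  | skip => exact ⟨1, 0, fun N b => by simp [time]⟩
  | assign a i j k l e =>
    refine ⟨i.costBound + j.costBound + k.costBound + l.costBound + e.costBound + 1, 0,
      fun N b => ?_⟩
    simp only [time, assignTime, pow_zero, one_mul]
    linarith
  | seq c₁ c₂ ih₁ ih₂ =>
    obtain ⟨K₁, e₁, h₁⟩ := ih₁
    obtain ⟨K₂, e₂, h₂⟩ := ih₂
    refine ⟨K₁ + K₂ + 1, max e₁ e₂, fun N b => ?_⟩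
    have g₁ := (h₁ N b).trans (Nat.mul_le_mul_left K₁ (mono (le_max_left e₁ e₂)))
    have g₂ := (h₂ N b).trans (Nat.mul_le_mul_left K₂ (mono (le_max_right e₁ e₂)))
    have := hpos N b (max e₁ e₂)
    simp only [time]
    linarith
  | ifLe e f c₁ c₂ ih₁ ih₂ =>
    obtain ⟨K₁, e₁, h₁⟩ := ih₁
    obtain ⟨K₂, e₂, h₂⟩ := ih₂
    refine ⟨e.costBound + f.costBound + K₁ + K₂ + 1, max e₁ e₂, fun N b => ?_⟩
    have g₁ := (h₁ N b).trans (Nat.mul_le_mul_left K₁ (mono (le_max_left e₁ e₂)))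
    have g₂ := (h₂ N b).trans (Nat.mul_le_mul_left K₂ (mono (le_max_right e₁ e₂)))
    have := hpos N b (max e₁ e₂)
    have g₃ : (e.costBound + f.costBound) * (b + 1) ≤
        (e.costBound + f.costBound) * ((N + 1) ^ max e₁ e₂ * (b + 1)) :=
      Nat.mul_le_mul_left _ (Nat.le_mul_of_pos_left _ (by positivity))
    simp only [time]
    linarith
  | loop v e c ih =>
    obtain ⟨K, k, h⟩ := ih
    -- The bound has the form `c * (b + 1) + 1`, so `A = c + 1` works; it is found by unification.
    -- Likewise for the next two.
    obtain ⟨A, hA⟩ : ∃ A, ∀ b, assignTime (.lit 0) (.lit 0) (.lit 0) (.lit 0) (.lit 0) b ≤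
        A * (b + 1) := ⟨_, fun b => Nat.add_one_le_iff.2 (Nat.lt_of_lt_of_le
          (Nat.lt_add_of_pos_right (Nat.succ_pos b)) (le_of_eq (Nat.succ_mul _ _).symm))⟩
    obtain ⟨A', hA'⟩ : ∃ A, ∀ b, assignTime (.lit 0) (.lit 0) (.lit 0) (.lit 0)
        (.add (.var v) (.lit 1)) b ≤ A * (b + 1) := ⟨_, fun b => Nat.add_one_le_iff.2
          (Nat.lt_of_lt_of_le (Nat.lt_add_of_pos_right (Nat.succ_pos b))
            (le_of_eq (Nat.succ_mul _ _).symm))⟩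
    obtain ⟨G, hG⟩ : ∃ G, ∀ b, guardTime v e b ≤ G * (b + 1) := ⟨_, fun b => Nat.add_one_le_iff.2
          (Nat.lt_of_lt_of_le (Nat.lt_add_of_pos_right (Nat.succ_pos b))
            (le_of_eq (Nat.succ_mul _ _).symm))⟩
    refine ⟨A + G + K + A' + G + 2, k + 1, fun N b => ?_⟩
    have hX : b + 1 ≤ (N + 1) ^ k * (b + 1) := Nat.le_mul_of_pos_left _ (by positivity)
    have hmul : ∀ {C t : ℕ}, t ≤ C * (b + 1) → t ≤ C * ((N + 1) ^ k * (b + 1)) := fun ht =>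
      ht.trans (Nat.mul_le_mul_left _ hX)
    have h1 := hmul (hA b)
    have h2 := hmul (hA' b)
    have h3 := hmul (hG b)
    have h4 := h N b
    have h5 := hpos N b k
    simp only [time]
    set X := (N + 1) ^ k * (b + 1)
    -- The extra factor `N + 1` splits into `N * X` for the passes and `X` for the initialization
    -- and the last test.
    have e1 : (N + 1) ^ (k + 1) * (b + 1) = N * X + X := by
      simp only [X, pow_succ]
      ring
    rw [e1]
    have h6 : guardTime v e b + (c.time N b + assignTime (.lit 0) (.lit 0) (.lit 0) (.lit 0)
        (.add (.var v) (.lit 1)) b + 1) ≤ (G + K + A' + 1) * X := by linarith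
    have h7 := Nat.mul_le_mul_left N h6
    have e2 : N * ((G + K + A' + 1) * X) = (G + K + A' + 1) * (N * X) := by ring
    rw [e2] at h7
    have h8 : 0 ≤ N * X := Nat.zero_le _
    nlinarith [Nat.zero_le (A * (N * X)), Nat.zero_le (G * (N * X)), Nat.zero_le (K * X),
      Nat.zero_le (A' * X), Nat.zero_le (G * X)]

end Imp

/-- The stores agree outside the arrays of `l`. -/
def Agree (l : List ℕ) (s s' : Store) : Prop := ∀ a, a ∉ l → s' a = s a

theorem Store.set_ne (s : Store) {a a' : ℕ} (h : a' ≠ a) (i j k l : ℕ) (v : ℚ) :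
    s.set a i j k l v a' = s a' := by
  funext i' j' k' l'
  simp [Store.set, h]

theorem Store.set_same (s : Store) (a i j k l : ℕ) (v : ℚ) : s.set a i j k l v a i j k l = v := by
  simp [Store.set]

/-! ### Total correctness rules with running time and frame condition -/

namespace Imp

variable {N b : ℕ} {s : Store} {Q : Store → Prop}

/-- The program `c`, started in the store `s`, halts within the time bound for at most `N`
iterations of each loop and cells of at most `b` bits in a store that satisfies `Q` and differs from
`s` in the modified arrays only. -/
def Ok (N b : ℕ) (c : Imp) (s : Store) (Q : Store → Prop) : Prop :=
  ∃ t s', Run c.toCmd s t s' ∧ t ≤ c.time N b ∧ Agree c.mods s s' ∧ Q s'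

theorem Ok.mono {c : Imp} {Q' : Store → Prop} (h : Ok N b c s Q)
    (hQ : ∀ s', Agree c.mods s s' → Q s' → Q' s') : Ok N b c s Q' := by
  obtain ⟨t, s', h1, h2, h3, h4⟩ := h
  exact ⟨t, s', h1, h2, h3, hQ s' h3 h4⟩

theorem Ok.skip (h : Q s) : Ok N b .skip s Q := ⟨1, s, .skip s, le_rfl, fun _ _ => rfl, h⟩

theorem Ok.assign {a i' j' k' l' : ℕ} {i j k l e : Expr} {x : ℚ} (hi : i.Evals b s i')
    (hj : j.Evals b s j') (hk : k.Evals b s k') (hl : l.Evals b s l') (he : e.Evals b s x)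
    (h : Q (s.set a i' j' k' l' x)) : Ok N b (.assign a i j k l e) s Q := by
  have hrun := Run.assign s a i j k l e
  rw [hi.eval_eq, hj.eval_eq, hk.eval_eq, hl.eval_eq, he.eval_eq] at hrun
  simp only [Nat.floor_natCast] at hrun
  refine ⟨_, _, hrun, ?_, fun a' ha' => s.set_ne (by simpa [mods] using ha') _ _ _ _ _, h⟩
  have := hi.cost_le
  have := hj.cost_le
  have := hk.cost_le
  have := hl.cost_le
  have := he.cost_le
  simp only [time, assignTime]
  linarith

theorem Ok.setVar {v : ℕ} {e : Expr} {x : ℚ} (he : e.Evals b s x) (h : Q (s.set v 0 0 0 0 x)) :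
    Ok N b (.setVar v e) s Q := Ok.assign .zero .zero .zero .zero he h

theorem Ok.setEntry {a i' j' : ℕ} {i j e : Expr} {x : ℚ} (hi : i.Evals b s i')
    (hj : j.Evals b s j') (he : e.Evals b s x) (h : Q (s.set a i' j' 0 0 x)) :
    Ok N b (.setEntry a i j e) s Q := Ok.assign hi hj .zero .zero he h

theorem Ok.seq {c₁ c₂ : Imp} (h : Ok N b c₁ s fun s' => Ok N b c₂ s' Q) :
    Ok N b (.seq c₁ c₂) s Q := by
  obtain ⟨t, s', h1, h2, h3, t', s'', h1', h2', h3', h4⟩ := h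
  refine ⟨_, s'', .seq h1 h1', by simp only [time]; omega, fun a ha => ?_, h4⟩
  simp only [mods, List.mem_append, not_or] at ha
  rw [h3' a ha.2, h3 a ha.1]

theorem Ok.ifLe {e f : Expr} {x y : ℚ} {c₁ c₂ : Imp} (he : e.Evals b s x) (hf : f.Evals b s y)
    (h₁ : x ≤ y → Ok N b c₁ s Q) (h₂ : y < x → Ok N b c₂ s Q) : Ok N b (.ifLe e f c₁ c₂) s Q := by
  have := he.cost_le
  have := hf.cost_le
  by_cases h : x ≤ y
  · obtain ⟨t, s', r1, r2, r3, r4⟩ := h₁ h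
    refine ⟨_, s', .ifTrue (by rwa [he.eval_eq, hf.eval_eq]) r1, ?_, fun a ha => r3 a ?_, r4⟩
    · simp only [time]
      linarith
    · simp only [mods, List.mem_append, not_or] at ha
      exact ha.1
  · obtain ⟨t, s', r1, r2, r3, r4⟩ := h₂ (not_le.1 h)
    refine ⟨_, s', .ifFalse (by rwa [he.eval_eq, hf.eval_eq]) r1, ?_, fun a ha => r3 a ?_, r4⟩
    · simp only [time]
      linarith
    · simp only [mods, List.mem_append, not_or] at ha
      exact ha.2

/-- Rule for counting loops: `I x` is the invariant at the start of the pass number `x`. -/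
theorem Ok.loop {v n : ℕ} {e : Expr} {c : Imp} (hv : v ∉ c.mods) (hn : n ≤ N) (hb : N + 1 ≤ b)
    (I : ℕ → Store → Prop) (hI : ∀ x s s', Agree [v] s s' → I x s → I x s')
    (he : ∀ s', Agree (v :: c.mods) s s' → e.Evals b s' n) (h0 : I 0 s)
    (hstep : ∀ x < n, ∀ s', Agree (v :: c.mods) s s' → s' v 0 0 0 0 = x → I x s' →
      Ok N b c s' (I (x + 1)))
    (hend : ∀ s', Agree (v :: c.mods) s s' → I n s' → Q s') : Ok N b (.loop v e c) s Q := by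
  have hset : ∀ s' (y : ℚ), Agree [v] s' (s'.set v 0 0 0 0 y) := fun s' y a ha =>
    s'.set_ne (by simpa using ha) _ _ _ _ _
  have hsub : ∀ s' y, Agree (v :: c.mods) s s' → Agree (v :: c.mods) s (s'.set v 0 0 0 0 y) :=
    fun s' y h a ha => by
      rw [s'.set_ne (fun e => ha (by simp [e])), h a ha]
  have hbits : ∀ x ≤ n, bits (x : ℚ) ≤ b := fun x hx => (bits_natCast_le x).trans (by omega)
  -- Induction on the number `y` of passes still to come; the last term of the bound is the failing
  -- test at the end.
  have key : ∀ y x, x + y = n → ∀ s', Agree (v :: c.mods) s s' → s' v 0 0 0 0 = x → I x s' →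
      ∃ t s'', Run (.whileLt (.var v) e (.seq c.toCmd
        (.assign v (.lit 0) (.lit 0) (.lit 0) (.lit 0) (.add (.var v) (.lit 1))))) s' t s'' ∧
        t ≤ y * (guardTime v e b + (c.time N b + assignTime (.lit 0) (.lit 0) (.lit 0) (.lit 0)
        (.add (.var v) (.lit 1)) b + 1)) + guardTime v e b ∧ Agree (v :: c.mods) s s'' ∧ I n s'' := by
    intro y
    induction y with
    | zero =>
      intro x hx s' hs' hxv hIx
      obtain rfl : x = n := by omega
      have h1 := Expr.Evals.var hxv (hbits x le_rfl)
      have h2 := he s' hs'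
      refine ⟨_, s', .whileStop (by rw [h1.eval_eq, h2.eval_eq]; exact lt_irrefl _), ?_, hs', hIx⟩
      have := h1.cost_le
      have := h2.cost_le
      simp only [guardTime]
      linarith
    | succ y ih =>
      intro x hx s' hs' hxv hIx
      have h1 := Expr.Evals.var hxv (hbits x (by omega))
      have h2 := he s' hs'
      obtain ⟨t, s₁, r1, r2, r3, r4⟩ := hstep x (by omega) s' hs' hxv hIx
      have hs₁ : Agree (v :: c.mods) s s₁ := fun a ha => by
        rw [r3 a (fun h => ha (List.mem_cons_of_mem _ h)), hs' a ha]
      have hv₁ : s₁ v 0 0 0 0 = x := by rw [r3 v hv, hxv]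
      have h3 : (Expr.add (.var v) (.lit 1)).Evals b s₁ ((x + 1 : ℕ) : ℚ) :=
        (Expr.Evals.var hv₁ (hbits x (by omega))).succ
      obtain ⟨t', s₂, q1, q2, q3, q4⟩ := Ok.assign (N := N) (a := v)
        (Q := fun s₂ => s₂ = s₁.set v 0 0 0 0 ((x + 1 : ℕ) : ℚ)) .zero .zero .zero .zero h3 rfl
      subst q4
      -- The counter is advanced after the body; `hI` carries the invariant over this write.
      obtain ⟨t'', s₃, p1, p2, p3, p4⟩ := ih (x + 1) (by omega) _ (hsub s₁ _ hs₁)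
        (s₁.set_same _ _ _ _ _ _) (hI _ _ _ (hset s₁ _) r4)
      refine ⟨_, s₃, .whileLoop (by
        rw [h1.eval_eq, h2.eval_eq]; exact_mod_cast (by omega : x < n)) (.seq r1 q1) p1, ?_, p3, p4⟩
      have := h1.cost_le
      have := h2.cost_le
      simp only [time, guardTime] at *
      linarith
  obtain ⟨t', s₂, q1, q2, q3, q4⟩ := Ok.assign (N := N) (a := v)
    (Q := fun s₂ => s₂ = s.set v 0 0 0 0 ((0 : ℕ) : ℚ)) .zero .zero .zero .zero (Expr.Evals.zero (s := s)
      (b := b)) rfl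
  subst q4
  obtain ⟨t, s', p1, p2, p3, p4⟩ := key n 0 (by omega) _ (hsub s _ fun _ _ => rfl)
    (s.set_same _ _ _ _ _ _) (hI _ _ _ (hset s _) h0)
  refine ⟨_, s', .seq q1 p1, ?_, p3, hend s' p3 p4⟩
  have := Nat.mul_le_mul_right (guardTime v e b + (c.time N b + assignTime (.lit 0) (.lit 0) (.lit 0)
    (.lit 0) (.add (.var v) (.lit 1)) b + 1)) hn
  simp only [time] at *
  linarith

/-- Summation loop. -/
def sumLoop (acc v : ℕ) (e f : Expr) : Imp := .loop v e (.setVar acc (.add (.var acc) f))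

theorem Ok.sumLoop {acc v n : ℕ} {e f : Expr} {a : ℚ} {g : ℕ → ℚ} (hva : v ≠ acc) (hn : n ≤ N)
    (hb : N + 1 ≤ b) (ha : s acc 0 0 0 0 = a)
    (he : ∀ s', Agree [v, acc] s s' → e.Evals b s' n)
    (hf : ∀ x < n, ∀ s', Agree [v, acc] s s' → s' v 0 0 0 0 = x → f.Evals b s' (g x))
    (hbits : ∀ x < n, bits (a + ∑ y ∈ Finset.range x, g y) ≤ b)
    (hend : ∀ s', Agree [v, acc] s s' → s' acc 0 0 0 0 = a + ∑ y ∈ Finset.range n, g y → Q s') :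
    Ok N b (sumLoop acc v e f) s Q := by
  refine Ok.loop (n := n) (by simpa using hva) hn hb
    (fun x s' => s' acc 0 0 0 0 = a + ∑ y ∈ Finset.range x, g y) ?_ he (by simpa using ha) ?_ hend
  · intro x s s' hs h
    rw [hs acc (by simpa using hva.symm), h]
  · intro x hx s' hs' hxv hI
    refine Ok.setVar ((Expr.Evals.var hI (hbits x hx)).add (hf x hx s' hs' hxv)) ?_
    rw [Store.set_same, Finset.sum_range_succ, add_assoc]

/-- Rule for loops whose pass number `x` sets the entry `A[r, x]` and no other entry of `A`. -/
theorem Ok.fillRow {v A r n : ℕ} {e : Expr} {c : Imp} {f : ℕ → ℚ} (hv : v ∉ c.mods) (hvA : A ≠ v)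
    (hn : n ≤ N) (hb : N + 1 ≤ b)
    (he : ∀ s', Agree (v :: c.mods) s s' → e.Evals b s' n)
    (hstep : ∀ x < n, ∀ s', Agree (v :: c.mods) s s' → s' v 0 0 0 0 = x →
      (∀ i ≠ r, s' A i = s A i) → Ok N b c s' fun s'' => s'' A = s'.set A r x 0 0 (f x) A)
    (hend : ∀ s', Agree (v :: c.mods) s s' → (∀ x < n, s' A r x 0 0 = f x) →
      (∀ i ≠ r, s' A i = s A i) → Q s') : Ok N b (.loop v e c) s Q := by
  refine Ok.loop (n := n) hv hn hb
    (fun x s' => (∀ y < x, s' A r y 0 0 = f y) ∧ ∀ i ≠ r, s' A i = s A i) ?_ he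
    ⟨fun y hy => absurd hy (Nat.not_lt_zero y), fun _ _ => rfl⟩ ?_ fun s' hs' h => hend s' hs' h.1 h.2
  · intro x s₁ s₂ hs h
    rwa [hs A (by simpa using hvA)]
  · intro x hx s' hs' hxv ⟨hI1, hI2⟩
    refine (hstep x hx s' hs' hxv hI2).mono fun s'' _ h => ?_
    simp only [h]
    refine ⟨fun y hy => ?_, fun i hi => ?_⟩
    · by_cases hyx : y = x
      · subst hyx
        exact Store.set_same _ _ _ _ _ _ _
      · have := hI1 y (by omega)
        simpa [Store.set, hyx] using this
    · rw [← hI2 i hi]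
      funext j k l
      simp [Store.set, hi]

/-- Filling a matrix. -/
def fill (A v w : ℕ) (e f g : Expr) : Imp :=
  .loop v e (.loop w f (.setEntry A (.var v) (.var w) g))

theorem Ok.fill {A v w n m : ℕ} {e f g : Expr} {F : ℕ → ℕ → ℚ} (hvw : v ≠ w) (hvA : v ≠ A)
    (hwA : w ≠ A) (hn : n ≤ N) (hm : m ≤ N) (hb : N + 1 ≤ b)
    (he : ∀ s', Agree [v, w, A] s s' → e.Evals b s' n)
    (hf : ∀ s', Agree [v, w, A] s s' → f.Evals b s' m)
    (hg : ∀ x < n, ∀ y < m, ∀ s', Agree [v, w, A] s s' → s' v 0 0 0 0 = x → s' w 0 0 0 0 = y →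
      g.Evals b s' (F x y))
    (hend : ∀ s', Agree [v, w, A] s s' → (∀ x < n, ∀ y < m, s' A x y 0 0 = F x y) → Q s') :
    Ok N b (fill A v w e f g) s Q := by
  refine Ok.loop (n := n) (by simp [mods, hvw, hvA]) hn hb
    (fun x s' => ∀ i < x, ∀ y < m, s' A i y 0 0 = F i y) ?_ he (fun i hi => absurd hi (Nat.not_lt_zero i)) ?_ hend
  · intro x s₁ s₂ hs h
    rwa [hs A (by simpa using hvA.symm)]
  · intro x hx s₁ hs₁ hxv hI
    have htr : ∀ s', Agree [w, A] s₁ s' → Agree [v, w, A] s s' := fun s' h a ha => by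
      rw [h a (fun h' => ha (List.mem_cons_of_mem _ h')), hs₁ a ha]
    have hbits : ∀ x ≤ N, bits (x : ℚ) ≤ b := fun x hx => (bits_natCast_le x).trans (by omega)
    refine Ok.fillRow (A := A) (r := x) (f := F x) (n := m) (by simpa using hwA) hwA.symm hm hb
      (fun s' h => hf s' (htr s' h)) ?_ ?_
    · intro y hy s' hs' hyw _
      have hxv' : s' v 0 0 0 0 = x := by
        rw [hs' v (by simp [hvw, hvA]), hxv]
      exact Ok.setEntry (.var hxv' (hbits x (by omega))) (.var hyw (hbits y (by omega)))
        (hg x hx y hy s' (htr s' hs') hxv' hyw) rfl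
    · intro s' hs' h1 h2 i hi y hy
      by_cases hix : i = x
      · subst hix
        exact h1 y hy
      · rw [h2 i hix]
        exact hI i (by omega) y hy

end Imp


/-! ## Rational numbers with bounded denominator and absolute value -/

theorem HasDenom.add {E : ℕ} {x y : ℚ} (hx : HasDenom E x) (hy : HasDenom E y) :
    HasDenom E (x + y) := by
  obtain ⟨a, ha⟩ := hx
  obtain ⟨c, hc⟩ := hy
  exact ⟨a + c, by rw [mul_add, ha, hc, Int.cast_add]⟩

theorem HasDenom.mul {E E' : ℕ} {x y : ℚ} (hx : HasDenom E x) (hy : HasDenom E' y) :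
    HasDenom (E * E') (x * y) := by
  obtain ⟨a, ha⟩ := hx
  obtain ⟨c, hc⟩ := hy
  exact ⟨a * c, by rw [Nat.cast_mul, mul_mul_mul_comm, ha, hc, Int.cast_mul]⟩

theorem HasDenom.of_dvd {E E' : ℕ} {x : ℚ} (hx : HasDenom E x) (h : E ∣ E') : HasDenom E' x := by
  obtain ⟨k, rfl⟩ := h
  have := (⟨k, by simp⟩ : HasDenom k 1)
  simpa using hx.mul this

theorem HasDenom.den (x : ℚ) : HasDenom x.den x := ⟨x.num, by rw [mul_comm, Rat.mul_den_eq_num]⟩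

/-- `q` is a fraction with denominator `E` and `|q| ≤ M`. -/
structure Fine (E : ℕ) (M q : ℚ) : Prop where
  hasDenom : HasDenom E q
  abs_le : |q| ≤ M

namespace Fine

variable {E E' : ℕ} {M M' x y : ℚ}

theorem nonneg (hx : Fine E M x) : 0 ≤ M := (abs_nonneg x).trans hx.abs_le

theorem zero (hM : 0 ≤ M) : Fine E M 0 := ⟨⟨0, by simp⟩, by simpa using hM⟩

theorem mono (hx : Fine E M x) (hE : E ∣ E') (hM : M ≤ M') : Fine E' M' x :=
  ⟨hx.hasDenom.of_dvd hE, hx.abs_le.trans hM⟩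

theorem add (hx : Fine E M x) (hy : Fine E M' y) : Fine E (M + M') (x + y) :=
  ⟨hx.hasDenom.add hy.hasDenom, (abs_add_le x y).trans (add_le_add hx.abs_le hy.abs_le)⟩

theorem mul (hx : Fine E M x) (hy : Fine E' M' y) : Fine (E * E') (M * M') (x * y) :=
  ⟨hx.hasDenom.mul hy.hasDenom, by
    rw [abs_mul]
    exact mul_le_mul hx.abs_le hy.abs_le (abs_nonneg y) hx.nonneg⟩

/-- Summation leaves the common denominator alone and enlarges only the absolute value. Adding up
heights would make the bound grow with every term. -/
theorem sum {ι : Type} {s : Finset ι} {f : ι → ℚ} (hf : ∀ i ∈ s, Fine E M (f i)) :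
    Fine E (s.card * M) (∑ i ∈ s, f i) := by
  classical
  induction s using Finset.induction_on with
  | empty => exact zero (by simp)
  | insert i s hi ih =>
    rw [Finset.sum_insert hi, Finset.card_insert_of_notMem hi, Nat.cast_succ, add_one_mul, add_comm (f i)]
    exact (ih fun j hj => hf j (Finset.mem_insert_of_mem hj)).add
      (hf i (Finset.mem_insert_self i s))

theorem bits_le {e f : ℕ} (hx : Fine E (2 ^ f) x) (hE : 0 < E) (hEe : E ≤ 2 ^ e) :
    bits x ≤ (f + e + 1) + (e + 1) := by
  obtain ⟨a, ha⟩ := hx.hasDenom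
  have hE' : (E : ℚ) ≠ 0 := by exact_mod_cast hE.ne'
  obtain ⟨h1, h2⟩ := num_den_le_of_eq_div (q := x) (a := a) hE (by rw [← ha]; field_simp)
  have h3 : a.natAbs ≤ 2 ^ (f + e) := by
    have : |(a : ℚ)| ≤ 2 ^ f * 2 ^ e := by
      rw [← ha, abs_mul, abs_of_nonneg (Nat.cast_nonneg E), mul_comm]
      exact mul_le_mul hx.abs_le (by exact_mod_cast hEe) (Nat.cast_nonneg E) (by positivity)
    rw [pow_add]
    zify
    exact_mod_cast this
  refine add_le_add (Nat.size_le.2 ?_) (Nat.size_le.2 ?_)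
  · exact (h1.trans h3).trans_lt (Nat.pow_lt_pow_right one_lt_two (Nat.lt_succ_self _))
  · exact (h2.trans hEe).trans_lt (Nat.pow_lt_pow_right one_lt_two (Nat.lt_succ_self _))

end Fine

theorem den_le_two_pow_bits (q : ℚ) : q.den ≤ 2 ^ bits q :=
  ((den_lt q).trans_le (Nat.pow_le_pow_right two_pos (height_le_bits q))).le

theorem abs_le_two_pow_bits (q : ℚ) : |q| ≤ 2 ^ bits q := by
  have h1 : |q| ≤ q.num.natAbs := by
    conv_lhs => rw [← Rat.num_div_den q]
    rw [abs_div, Nat.abs_cast, Nat.cast_natAbs, Int.cast_abs]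
    exact div_le_self (abs_nonneg _) (by exact_mod_cast q.pos)
  have h2 : (q.num.natAbs : ℚ) ≤ 2 ^ bits q := by
    exact_mod_cast ((natAbs_num_lt q).trans_le
      (Nat.pow_le_pow_right two_pos (height_le_bits q))).le
  exact h1.trans h2

/-- A common denominator of finitely many rational numbers, bounded by their bit lengths. -/
theorem exists_common_denom {ι : Type} (s : Finset ι) (f : ι → ℚ) :
    ∃ D : ℕ, 0 < D ∧ D ≤ 2 ^ ∑ i ∈ s, bits (f i) ∧ ∀ i ∈ s, HasDenom D (f i) := by
  refine ⟨∏ i ∈ s, (f i).den, Finset.prod_pos fun i _ => (f i).pos, ?_, fun i hi =>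
    (HasDenom.den (f i)).of_dvd (Finset.dvd_prod_of_mem (fun i => (f i).den) hi)⟩
  rw [← Finset.prod_pow_eq_pow_sum]
  exact Finset.prod_le_prod' fun i _ => den_le_two_pow_bits (f i)

/-! ## Bit lengths in state elimination -/

theorem factorial_le_two_pow (n : ℕ) : n.factorial ≤ 2 ^ (n * n) := by
  refine (Nat.factorial_le_pow n).trans ?_
  rw [pow_mul]
  exact Nat.pow_le_pow_left Nat.lt_two_pow_self.le n

/-- The bound for the exponents by which one step of the backward induction increases the
denominators and the absolute values. -/
def stepBits (L : ℕ) : ℕ := 2 * L * L + 3 * L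

/-- The bound for the bit lengths of all numbers in the computation. -/
def cellBits (L : ℕ) : ℕ := 3 * (stepBits L * (L * L + 1)) + L + 2

namespace MarketData

variable {d : MarketData ℚ}

theorem bits_pos (q : ℚ) : 1 ≤ bits q :=
  (Nat.size_pos.2 q.pos).trans_le (Nat.le_add_left _ _)

theorem card_le_bitSize (d : MarketData ℚ) : d.m ≤ d.bitSize := by
  have h : ∑ _u : Fin d.m, 1 = d.m := by simp
  rw [← h]
  refine le_add_right (Finset.sum_le_sum fun u _ => ?_)
  omega

theorem term_le_bitSize (d : MarketData ℚ) (u : Fin d.m) :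
    (1 + ∑ i, bits (d.price u i) + ∑ j, bits (d.psi u j) + ∑ i, ∑ j, bits (d.rho u i j)) +
      ∑ w, (if d.edge u w = true then ∑ i, ∑ j, bits (d.lam u w i j) else 0) ≤ d.bitSize := by
  refine add_le_add ?_ ?_
  · exact Finset.single_le_sum (f := fun u => 1 + ∑ i, bits (d.price u i) + ∑ j, bits (d.psi u j) +
      ∑ i, ∑ j, bits (d.rho u i j)) (fun _ _ => Nat.zero_le _) (Finset.mem_univ u)
  · refine le_trans (Finset.sum_le_sum fun w _ => Nat.le_add_left _ 1) ?_
    exact Finset.single_le_sum (f := fun u => ∑ w, (1 + if d.edge u w = true then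
      ∑ i, ∑ j, bits (d.lam u w i j) else 0)) (fun _ _ => Nat.zero_le _) (Finset.mem_univ u)

theorem size_lt_bitSize (d : MarketData ℚ) (u : Fin d.m) : d.n u + 1 < d.bitSize := by
  have h := d.term_le_bitSize u
  have h1 : ∑ _j : Option (Fin (d.n u)), 1 ≤ ∑ j, bits (d.psi u j) :=
    Finset.sum_le_sum fun j _ => bits_pos _
  simp only [Finset.sum_const, Finset.card_univ, Fintype.card_option, Fintype.card_fin,
    smul_eq_mul, mul_one] at h1
  omega

theorem bits_price_le (u : Fin d.m) (i : Fin (d.n u)) : bits (d.price u i) ≤ d.bitSize := by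
  have h := d.term_le_bitSize u
  have h1 := Finset.single_le_sum (f := fun i => bits (d.price u i)) (fun _ _ => Nat.zero_le _)
    (Finset.mem_univ i)
  omega

theorem sum_bits_rho_le (u : Fin d.m) :
    ∑ p : Option (Fin (d.n u)) × Option (Fin (d.n u)), bits (d.rho u p.1 p.2) ≤ d.bitSize := by
  have h := d.term_le_bitSize u
  simp only [Fintype.sum_prod_type]
  omega

theorem bits_rho_le (u : Fin d.m) (i j : Option (Fin (d.n u))) :
    bits (d.rho u i j) ≤ d.bitSize :=
  (Finset.single_le_sum (f := fun p : Option (Fin (d.n u)) × Option (Fin (d.n u)) =>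
    bits (d.rho u p.1 p.2)) (fun _ _ => Nat.zero_le _) (Finset.mem_univ (i, j))).trans
      (sum_bits_rho_le u)

theorem sum_bits_lam_le (u : Fin d.m) :
    ∑ w, (if d.edge u w = true then ∑ p : Option (Fin (d.n u)) × Option (Fin (d.n w)),
      bits (d.lam u w p.1 p.2) else 0) ≤ d.bitSize := by
  have h := d.term_le_bitSize u
  simp only [Fintype.sum_prod_type]
  omega

theorem bits_lam_le {u w : Fin d.m} (huw : d.edge u w = true) (i : Option (Fin (d.n u)))
    (j : Option (Fin (d.n w))) : bits (d.lam u w i j) ≤ d.bitSize := by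
  refine le_trans ?_ (sum_bits_lam_le u)
  refine le_trans ?_ (Finset.single_le_sum (f := fun w => if d.edge u w = true then
    ∑ p : Option (Fin (d.n u)) × Option (Fin (d.n w)), bits (d.lam u w p.1 p.2) else 0)
    (fun _ _ => Nat.zero_le _) (Finset.mem_univ w))
  rw [if_pos huw]
  exact Finset.single_le_sum (f := fun p : Option (Fin (d.n u)) × Option (Fin (d.n w)) =>
    bits (d.lam u w p.1 p.2)) (fun _ _ => Nat.zero_le _) (Finset.mem_univ (i, j))

/-- A common denominator of the prices and the outgoing transition vectors of a category. -/
theorem exists_denom_price_lam (u : Fin d.m) :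
    ∃ D : ℕ, 0 < D ∧ D ≤ 2 ^ (2 * d.bitSize) ∧ (∀ i, HasDenom D (d.price u i)) ∧
      ∀ w, d.edge u w = true → ∀ i j, HasDenom D (d.lam u w i j) := by
  obtain ⟨D₁, h1, h2, h3⟩ := exists_common_denom Finset.univ (d.price u)
  choose D₂ g1 g2 g3 using fun w => exists_common_denom Finset.univ
    fun p : Option (Fin (d.n u)) × Option (Fin (d.n w)) => d.lam u w p.1 p.2
  -- Non-edges contribute the factor `1`: their transition vectors are not part of the input and do
  -- not count in its size.
  refine ⟨D₁ * ∏ w, (if d.edge u w = true then D₂ w else 1), Nat.mul_pos h1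
    (Finset.prod_pos fun w _ => ?_), ?_, fun i => (h3 i (Finset.mem_univ i)).of_dvd
      (Dvd.intro _ rfl), fun w huw i j => (g3 w (i, j) (Finset.mem_univ _)).of_dvd ?_⟩
  · split_ifs
    exacts [g1 w, one_pos]
  · rw [two_mul, pow_add]
    refine Nat.mul_le_mul (h2.trans (Nat.pow_le_pow_right two_pos ?_)) (le_trans ?_
      (Nat.pow_le_pow_right two_pos (sum_bits_lam_le u)))
    · have h := d.term_le_bitSize u
      omega
    · rw [← Finset.prod_pow_eq_pow_sum]
      refine Finset.prod_le_prod' fun w _ => ?_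
      split_ifs
      · exact g2 w
      · simp
  · refine dvd_mul_of_dvd_right ?_ _
    have := Finset.dvd_prod_of_mem (fun w => if d.edge u w = true then D₂ w else 1)
      (Finset.mem_univ w)
    rwa [if_pos huw] at this

/-- Denominators of first entry probabilities are bounded in terms of the input size. -/
theorem exists_denom_firstEntry {u : Fin d.m} (hρ : Absorbs (d.rho u) none)
    {S : Finset (Fin (d.n u))} {B : Option (Fin (d.n u)) → Option (Fin (d.n u)) → ℚ}
    (hB : FirstEntry (d.rho u) (Finset.insertNone S) B) :
    ∃ Q : ℕ, 0 < Q ∧ Q ≤ 2 ^ (2 * d.bitSize * d.bitSize) ∧ ∀ i j, Fine Q 1 (B i j) := by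
  obtain ⟨D, h1, h2, h3⟩ := exists_common_denom Finset.univ
    fun p : Option (Fin (d.n u)) × Option (Fin (d.n u)) => d.rho u p.1 p.2
  obtain ⟨Q, g1, g2, g3⟩ := hB.exists_hasDenom hρ (by simp) h1 fun i j =>
    h3 (i, j) (Finset.mem_univ _)
  refine ⟨Q, g1, g2.trans ?_, fun i j => ⟨g3 i j, by
    rw [abs_of_nonneg (hB.nonneg i j)]; exact hB.le_one i j⟩⟩
  have hn : Fintype.card (Option (Fin (d.n u))) ≤ d.bitSize := by
    rw [Fintype.card_option, Fintype.card_fin]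
    exact (d.size_lt_bitSize u).le
  -- The two halves of the exponent, with `L` the input size: `n! ≤ 2 ^ (n * n)` gives one `L * L`,
  -- and `D ^ n ≤ (2 ^ L) ^ n` the other.
  rw [mul_assoc, two_mul, pow_add]
  refine Nat.mul_le_mul ((factorial_le_two_pow _).trans
    (Nat.pow_le_pow_right two_pos (Nat.mul_le_mul hn hn))) ?_
  refine (Nat.pow_le_pow_left (h2.trans (Nat.pow_le_pow_right two_pos (sum_bits_rho_le u))) _).trans ?_
  rw [← pow_mul]
  exact Nat.pow_le_pow_right two_pos (Nat.mul_le_mul_left _ hn)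

end MarketData


/-! ## Loops over the options of a category -/

/-- The option with index `x`. -/
def optAt (n x : ℕ) : Option (Fin n) := if h : x - 1 < n ∧ 0 < x then some ⟨x - 1, h.1⟩ else none

theorem optIdx_lt {n : ℕ} (o : Option (Fin n)) : optIdx o < n + 1 := by
  cases o with
  | none => exact Nat.succ_pos n
  | some i => exact Nat.succ_lt_succ i.2

theorem optAt_optIdx {n : ℕ} (o : Option (Fin n)) : optAt n (optIdx o) = o := by
  cases o with
  | none => simp [optAt, optIdx]
  | some i => simp [optAt, optIdx]

theorem optIdx_optAt {n x : ℕ} (hx : x < n + 1) : optIdx (optAt n x) = x := by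
  unfold optAt
  split_ifs with h
  · simp only [optIdx, Option.elim_some]
    omega
  · simp only [optIdx, Option.elim_none]
    omega

theorem optIdx_injective {n : ℕ} : Function.Injective (optIdx : Option (Fin n) → ℕ) :=
  Function.LeftInverse.injective optAt_optIdx

theorem optAt_injOn {n x : ℕ} (hx : x ≤ n + 1) :
    Set.InjOn (optAt n) (Finset.range x : Set ℕ) := by
  intro a ha c hc h
  have ha' := Finset.mem_range.1 ha
  have hc' := Finset.mem_range.1 hc
  rw [← optIdx_optAt (n := n) (x := a) (by omega), h, optIdx_optAt (by omega)]

theorem sum_range_optAt {n : ℕ} (g : Option (Fin n) → ℚ) :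
    ∑ y ∈ Finset.range (n + 1), g (optAt n y) = ∑ o, g o := by
  rw [← Finset.sum_image (optAt_injOn le_rfl)]
  congr 1
  ext o
  simp only [Finset.mem_image, Finset.mem_range, Finset.mem_univ, iff_true]
  exact ⟨optIdx o, optIdx_lt o, optAt_optIdx o⟩

namespace Imp

variable {N b : ℕ} {s : Store} {Q : Store → Prop}

/-- The partial sums run over initial segments of indices, which are particular sets of options.
Bounding the sums over all sets `T` avoids any reference to the order of summation. -/
theorem Ok.sumLoop_opt {acc v n : ℕ} {e f : Expr} {a : ℚ} {g : Option (Fin n) → ℚ} (hva : v ≠ acc)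
    (hn : n + 1 ≤ N) (hb : N + 1 ≤ b) (ha : s acc 0 0 0 0 = a)
    (he : ∀ s', Agree [v, acc] s s' → e.Evals b s' (n + 1 : ℕ))
    (hf : ∀ o, ∀ s', Agree [v, acc] s s' → s' v 0 0 0 0 = (optIdx o : ℕ) → f.Evals b s' (g o))
    (hbits : ∀ T : Finset (Option (Fin n)), bits (a + ∑ o ∈ T, g o) ≤ b)
    (hend : ∀ s', Agree [v, acc] s s' → s' acc 0 0 0 0 = a + ∑ o, g o → Q s') :
    Ok N b (Imp.sumLoop acc v e f) s Q := by
  refine Ok.sumLoop (n := n + 1) (g := fun x => g (optAt n x)) hva hn hb ha he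
    (fun x hx s' hs' hxv => hf _ s' hs' (by rw [hxv, optIdx_optAt hx])) (fun x hx => ?_)
    fun s' hs' h => hend s' hs' (by rw [h, sum_range_optAt])
  rw [← Finset.sum_image (f := g) (optAt_injOn (n := n) hx.le)]
  exact hbits _

theorem Ok.fillRow_opt {v A r n : ℕ} {e : Expr} {c : Imp} {f : Option (Fin n) → ℚ}
    (hv : v ∉ c.mods) (hvA : A ≠ v) (hn : n + 1 ≤ N) (hb : N + 1 ≤ b)
    (he : ∀ s', Agree (v :: c.mods) s s' → e.Evals b s' (n + 1 : ℕ))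
    (hstep : ∀ o, ∀ s', Agree (v :: c.mods) s s' → s' v 0 0 0 0 = (optIdx o : ℕ) →
      (∀ i ≠ r, s' A i = s A i) → Ok N b c s' fun s'' => s'' A = s'.set A r (optIdx o) 0 0 (f o) A)
    (hend : ∀ s', Agree (v :: c.mods) s s' → (∀ o, s' A r (optIdx o) 0 0 = f o) →
      (∀ i ≠ r, s' A i = s A i) → Q s') : Ok N b (.loop v e c) s Q := by
  refine Ok.fillRow (n := n + 1) (f := fun x => f (optAt n x)) hv hvA hn hb he ?_
    fun s' hs' h1 h2 => hend s' hs' (fun o => by rw [h1 _ (optIdx_lt o), optAt_optIdx]) h2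
  intro x hx s' hs' hxv h
  have := hstep (optAt n x) s' hs' (by rw [hxv, optIdx_optAt hx]) h
  rwa [optIdx_optAt hx] at this

theorem Ok.fill_opt {A v w n : ℕ} {e f g : Expr} {F : Option (Fin n) → Option (Fin n) → ℚ}
    (hvw : v ≠ w) (hvA : v ≠ A) (hwA : w ≠ A) (hn : n + 1 ≤ N) (hb : N + 1 ≤ b)
    (he : ∀ s', Agree [v, w, A] s s' → e.Evals b s' (n + 1 : ℕ))
    (hf : ∀ s', Agree [v, w, A] s s' → f.Evals b s' (n + 1 : ℕ))
    (hg : ∀ i j, ∀ s', Agree [v, w, A] s s' → s' v 0 0 0 0 = (optIdx i : ℕ) →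
      s' w 0 0 0 0 = (optIdx j : ℕ) → g.Evals b s' (F i j))
    (hend : ∀ s', Agree [v, w, A] s s' → (∀ i j, s' A (optIdx i) (optIdx j) 0 0 = F i j) → Q s') :
    Ok N b (Imp.fill A v w e f g) s Q :=
  Ok.fill (n := n + 1) (m := n + 1) (F := fun x y => F (optAt n x) (optAt n y)) hvw hvA hwA hn hn
    hb he hf (fun x hx y hy s' hs' hxv hyw => hg _ _ s' hs' (by rw [hxv, optIdx_optAt hx])
      (by rw [hyw, optIdx_optAt hy]))
    fun s' hs' h => hend s' hs' fun i j => by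
      rw [h _ (optIdx_lt i) _ (optIdx_lt j), optAt_optIdx, optAt_optIdx]

end Imp

/-! ## Reading the input -/

/-- `Fine.bits_le` gives `f + 2 * e + 2` bits. The budget allows denominator and absolute value
exponents of about `stepBits L * (L * L + 1)`, plus `L` for the initial bound on absolute values. -/
theorem bits_le_cellBits {L E e f : ℕ} {x : ℚ} (hx : Fine E (2 ^ f) x) (hE : 0 < E)
    (hEe : E ≤ 2 ^ e) (h : f + 2 * e ≤ 3 * (stepBits L * (L * L + 1)) + L) :
    bits x ≤ cellBits L := by
  refine (hx.bits_le hE hEe).trans ?_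
  unfold cellBits
  omega

theorem le_cellBits (L : ℕ) : L + 2 ≤ cellBits L := by
  unfold cellBits
  omega

theorem bits_zero_le (L : ℕ) : bits 0 ≤ cellBits L := by
  have : bits 0 ≤ 1 := by simpa using bits_natCast_le 0
  exact this.trans (by have := le_cellBits L; omega)

theorem bits_one_le (L : ℕ) : bits 1 ≤ cellBits L := by
  have : bits 1 ≤ 2 := by simpa using bits_natCast_le 1
  exact this.trans (by have := le_cellBits L; omega)

theorem bits_ite_le (L : ℕ) (p : Prop) [Decidable p] : bits (if p then 1 else 0) ≤ cellBits L := by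
  split_ifs
  exacts [bits_one_le L, bits_zero_le L]

theorem bits_nat_le {L x : ℕ} (hx : x ≤ L) : bits (x : ℚ) ≤ cellBits L :=
  (bits_natCast_le x).trans (by have := le_cellBits L; omega)

/-- The number of options of the category with index `e`. -/
def numOptions (e : Expr) : Expr := .add (.entry 1 e (.lit 0)) (.lit 1)

namespace MarketData.Loaded

variable {d : MarketData ℚ} {s : Store}

theorem agree (hs : d.Loaded s) {l : List ℕ} {s' : Store} (h : Agree l s s')
    (hl : ∀ a < 7, a ∉ l) : d.Loaded s' where
  num := by rw [h 0 (hl 0 (by decide))]; exact hs.num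
  size u := by rw [h 1 (hl 1 (by decide))]; exact hs.size u
  edge u w := by rw [h 2 (hl 2 (by decide))]; exact hs.edge u w
  price u i := by rw [h 3 (hl 3 (by decide))]; exact hs.price u i
  psi u j := by rw [h 4 (hl 4 (by decide))]; exact hs.psi u j
  rho u i j := by rw [h 5 (hl 5 (by decide))]; exact hs.rho u i j
  lam u w huw i j := by rw [h 6 (hl 6 (by decide))]; exact hs.lam u w huw i j

variable {e f g h : Expr}

theorem evals_num (hs : d.Loaded s) : (Expr.var 0).Evals (cellBits d.bitSize) s d.m :=
  .var hs.num (bits_nat_le d.card_le_bitSize)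

theorem evals_size (hs : d.Loaded s) {u : Fin d.m}
    (he : e.Evals (cellBits d.bitSize) s (u : ℕ)) :
    (Expr.entry 1 e (.lit 0)).Evals (cellBits d.bitSize) s (d.n u) :=
  .entry he .zero (hs.size u) (bits_nat_le (by have := d.size_lt_bitSize u; omega))

theorem evals_numOptions (hs : d.Loaded s) {u : Fin d.m}
    (he : e.Evals (cellBits d.bitSize) s (u : ℕ)) :
    (numOptions e).Evals (cellBits d.bitSize) s (d.n u + 1 : ℕ) :=
  (hs.evals_size he).succ

theorem evals_edge (hs : d.Loaded s) {u w : Fin d.m}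
    (he : e.Evals (cellBits d.bitSize) s (u : ℕ)) (hf : f.Evals (cellBits d.bitSize) s (w : ℕ)) :
    (Expr.entry 2 e f).Evals (cellBits d.bitSize) s (if d.edge u w = true then 1 else 0) :=
  .entry he hf (hs.edge u w) (bits_ite_le _ _)

theorem evals_price (hs : d.Loaded s) {u : Fin d.m} {i : Fin (d.n u)}
    (he : e.Evals (cellBits d.bitSize) s (u : ℕ))
    (hf : f.Evals (cellBits d.bitSize) s (optIdx (some i) : ℕ)) :
    (Expr.entry 3 e f).Evals (cellBits d.bitSize) s (d.price u i) :=
  .entry he hf (hs.price u i) (by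
    have := bits_price_le u i
    have := le_cellBits d.bitSize
    omega)

theorem evals_rho (hs : d.Loaded s) {u : Fin d.m} {i j : Option (Fin (d.n u))}
    (he : e.Evals (cellBits d.bitSize) s (u : ℕ))
    (hf : f.Evals (cellBits d.bitSize) s (optIdx i : ℕ))
    (hg : g.Evals (cellBits d.bitSize) s (optIdx j : ℕ)) :
    (Expr.get 5 e f g (.lit 0)).Evals (cellBits d.bitSize) s (d.rho u i j) := by
  rw [← hs.rho u i j]
  refine .get he hf hg .zero ?_
  rw [hs.rho u i j]
  have := bits_rho_le u i j
  have := le_cellBits d.bitSize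
  omega

theorem evals_lam (hs : d.Loaded s) {u w : Fin d.m} (huw : d.edge u w = true)
    {i : Option (Fin (d.n u))} {j : Option (Fin (d.n w))}
    (he : e.Evals (cellBits d.bitSize) s (u : ℕ))
    (hf : f.Evals (cellBits d.bitSize) s (w : ℕ))
    (hg : g.Evals (cellBits d.bitSize) s (optIdx i : ℕ))
    (hh : h.Evals (cellBits d.bitSize) s (optIdx j : ℕ)) :
    (Expr.get 6 e f g h).Evals (cellBits d.bitSize) s (d.lam u w i j) := by
  rw [← hs.lam u w huw i j]
  refine .get he hf hg hh ?_
  rw [hs.lam u w huw i j]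
  have := bits_lam_le huw i j
  have := le_cellBits d.bitSize
  omega

end MarketData.Loaded


open CrossCat.Imp (Ok)

/-! ## The program for a single category

The variables are: `9` the category, `20` the product that may be eliminated, `13` and `21` options,
`11` a child category, `22` an accumulator. The arrays are: `7` the assortments, `10` the flags of
the settled categories, `15` the adjusted prices, `16` the values, `17` the first entry
probabilities, and `18` their copy. -/

/-- The matrix on the options of a category stored in an array. -/
def mat (n : ℕ) (Y : ℕ → ℕ → ℕ → ℕ → ℚ) (i j : Option (Fin n)) : ℚ := Y (optIdx i) (optIdx j) 0 0

/-- The vector on the options of a category stored in row `u` of an array. -/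
def row (n u : ℕ) (X : ℕ → ℕ → ℕ → ℕ → ℚ) (i : Option (Fin n)) : ℚ := X u (optIdx i) 0 0

/-- The option that is to be eliminated. -/
def pivotExpr : Expr := .add (.var 20) (.lit 1)

/-- Elimination of a product. -/
def eliminateProg : Imp :=
  .seq (.setEntry 7 (.var 9) pivotExpr (.lit 0))
    (.seq
      (.fill 18 13 21 (numOptions (.var 9)) (numOptions (.var 9))
        (.mul (.entry 7 (.var 9) (.var 21))
          (.add (.entry 17 (.var 13) (.var 21))
            (.div (.mul (.entry 17 (.var 13) pivotExpr) (.entry 17 pivotExpr (.var 21)))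
              (.sub (.lit 1) (.entry 17 pivotExpr pivotExpr))))))
      (.fill 17 13 21 (numOptions (.var 9)) (numOptions (.var 9))
        (.entry 18 (.var 13) (.var 21))))

/-- The expected price at the next entry, from the option with index `e`. -/
def expectProg (e : Expr) : Imp :=
  .seq (.setVar 22 (.lit 0))
    (.sumLoop 22 21 (numOptions (.var 9)) (.mul (.entry 17 e (.var 21)) (.entry 15 (.var 9) (.var 21))))

/-- Repeated passes through the products that eliminate those with a price below the expected price
at the next entry. -/
def sweepProg : Imp :=
  .loop 19 (.entry 1 (.var 9) (.lit 0)) (.loop 20 (.entry 1 (.var 9) (.lit 0))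
    (.seq (expectProg pivotExpr)
      (.ifLe (.var 22) (.entry 15 (.var 9) pivotExpr) .skip eliminateProg)))

/-- Initialization of the elimination. -/
def initProg : Imp :=
  .seq (.fill 17 13 21 (numOptions (.var 9)) (numOptions (.var 9))
      (.get 5 (.var 9) (.var 13) (.var 21) (.lit 0)))
    (.loop 13 (numOptions (.var 9)) (.setEntry 7 (.var 9) (.var 13) (.lit 1)))

/-- Computation of the values of the options. -/
def valueProg : Imp :=
  .loop 13 (numOptions (.var 9))
    (.seq (expectProg (.var 13))
      (.setEntry 16 (.var 9) (.var 13)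
        (.add (.mul (.entry 7 (.var 9) (.var 13)) (.entry 15 (.var 9) (.var 13)))
          (.mul (.sub (.lit 1) (.entry 7 (.var 9) (.var 13))) (.var 22)))))

/-- Computation of the adjusted prices. -/
def adjustProg : Imp :=
  .loop 13 (numOptions (.var 9))
    (.seq (.setVar 22 (.lit 0))
      (.seq (.ifLe (.lit 1) (.var 13) (.setVar 22 (.entry 3 (.var 9) (.var 13))) .skip)
        (.seq
          (.loop 11 (.var 0)
            (.ifLe (.lit 1) (.entry 2 (.var 9) (.var 11))
              (.sumLoop 22 21 (numOptions (.var 11))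
                (.mul (.get 6 (.var 9) (.var 11) (.var 13) (.var 21))
                  (.entry 16 (.var 11) (.var 21))))
              .skip))
          (.setEntry 15 (.var 9) (.var 13) (.var 22)))))

theorem Expr.Evals.zero' {b : ℕ} {s : Store} : Evals b s (.lit 0) 0 := by
  simpa using Evals.zero (b := b) (s := s)

namespace MarketData

variable {d : MarketData ℚ} {s : Store} {u : Fin d.m} {Q : Store → Prop}

theorem bits_optIdx_le (i : Option (Fin (d.n u))) : bits (optIdx i : ℕ) ≤ cellBits d.bitSize :=
  bits_nat_le (by have := optIdx_lt i; have := d.size_lt_bitSize u; omega)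

theorem bits_index_le (u : Fin d.m) : bits ((u : ℕ) : ℚ) ≤ cellBits d.bitSize :=
  bits_nat_le (u.2.le.trans d.card_le_bitSize)

/-- The arrays `X` and `Y` hold the indicator of `S` and the first entry probabilities of
`S ∪ {no purchase}`, and the eliminated products have been eliminated rightly. -/
structure Eliminated (d : MarketData ℚ) (u : Fin d.m) (r : Option (Fin (d.n u)) → ℚ)
    (X Y : ℕ → ℕ → ℕ → ℕ → ℚ) (S : Finset (Fin (d.n u))) : Prop where
  row : ∀ o : Option (Fin (d.n u)), X u (optIdx o) 0 0 = if o ∈ Finset.insertNone S then 1 else 0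
  entry : FirstEntry (d.rho u) (Finset.insertNone S) (mat (d.n u) Y)
  off : ∀ i ∉ Finset.insertNone S, r i ≤ ∑ j, mat (d.n u) Y i j * r j

theorem bits_firstEntry_le (hρ : Absorbs (d.rho u) none) {S : Finset (Fin (d.n u))}
    {B : Option (Fin (d.n u)) → Option (Fin (d.n u)) → ℚ}
    (hB : FirstEntry (d.rho u) (Finset.insertNone S) B) (i j : Option (Fin (d.n u))) :
    bits (B i j) ≤ cellBits d.bitSize := by
  obtain ⟨Q, h1, h2, h3⟩ := exists_denom_firstEntry hρ hB
  refine bits_le_cellBits (f := 0) (by simpa using h3 i j) h1 h2 ?_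
  have h4 : stepBits d.bitSize ≤ stepBits d.bitSize * (d.bitSize * d.bitSize + 1) :=
    Nat.le_mul_of_pos_right _ (Nat.succ_pos _)
  have h5 : stepBits d.bitSize = 2 * d.bitSize * d.bitSize + 3 * d.bitSize := rfl
  linarith

theorem eliminateProg_ok (hs : d.Loaded s) (hρ : Absorbs (d.rho u) none)
    (hu : s 9 0 0 0 0 = (u : ℕ)) {k : Fin (d.n u)} (hk : s 20 0 0 0 0 = (k : ℕ))
    {r : Option (Fin (d.n u)) → ℚ} {S : Finset (Fin (d.n u))}
    (h : Eliminated d u r (s 7) (s 17) S)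
    (hr : r (some k) ≤ ∑ j, mat (d.n u) (s 17) (some k) j * r j) :
    Ok d.bitSize (cellBits d.bitSize) eliminateProg s fun s' =>
      Eliminated d u r (s' 7) (s' 17) (S.erase k) ∧ (∀ w ≠ (u : ℕ), s' 7 w = s 7 w) ∧
        mat (d.n u) (s' 17) = eliminate (Finset.insertNone S) (mat (d.n u) (s 17)) (some k) := by
  have hn : d.n u + 1 ≤ d.bitSize := (d.size_lt_bitSize u).le
  have hb : d.bitSize + 1 ≤ cellBits d.bitSize := by have := le_cellBits d.bitSize; omega
  have evu : ∀ s', s' 9 = s 9 → (Expr.var 9).Evals (cellBits d.bitSize) s' (u : ℕ) := fun s' e =>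
    .var (by rw [e, hu]) (bits_index_le u)
  have evk : ∀ s', s' 20 = s 20 →
      pivotExpr.Evals (cellBits d.bitSize) s' (optIdx (some k) : ℕ) := fun s' e =>
    (Expr.Evals.var (by rw [e, hk]) (bits_nat_le (by have := k.2; omega))).succ
  have hB' := h.entry.eliminate hρ (by simp) (Option.some_ne_none k)
  have hoff' := h.entry.le_sum_eliminate hρ (by simp) (Option.some_ne_none k) h.off hr
  rw [erase_insertNone] at hB' hoff'
  refine Ok.seq (Ok.setEntry (evu s rfl) (evk s rfl) .zero' ?_)
  set s₁ := s.set 7 u (optIdx (some k)) 0 0 0 with hs₁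
  have e₁ : ∀ a, a ≠ 7 → s₁ a = s a := fun a ha => s.set_ne ha _ _ _ _ _
  have L₁ : d.Loaded s₁ := hs.agree (l := [7]) (fun a ha => e₁ a (by simpa using ha)) (by decide)
  have row₁ : ∀ o : Option (Fin (d.n u)), s₁ 7 u (optIdx o) 0 0 =
      if o ∈ Finset.insertNone (S.erase k) then 1 else 0 := by
    intro o
    by_cases ho : o = some k
    · subst ho
      simp [hs₁, Store.set]
    · have h1 : optIdx o ≠ optIdx (some k) := fun e => ho (optIdx_injective e)
      have h2 : s₁ 7 u (optIdx o) 0 0 = s 7 u (optIdx o) 0 0 := by simp [hs₁, Store.set, h1]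
      rw [h2, h.row, ← erase_insertNone]
      simp [ho]
  have rest₁ : ∀ w ≠ (u : ℕ), s₁ 7 w = s 7 w := by
    intro w hw
    funext i j l
    simp [hs₁, Store.set, hw]
  -- The new matrix is built in array `18`, because an update in place would overwrite the pivot row
  -- and column while they are still needed.
  refine Ok.seq (Ok.fill_opt (n := d.n u)
    (F := eliminate (Finset.insertNone S) (mat (d.n u) (s 17)) (some k)) (by decide) (by decide)
    (by decide) hn hb ?_ ?_ ?_ ?_)
  · exact fun s' hs' => (L₁.agree hs' (by decide)).evals_numOptions
      (evu s' (by rw [hs' 9 (by decide), e₁ 9 (by decide)]))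
  · exact fun s' hs' => (L₁.agree hs' (by decide)).evals_numOptions
      (evu s' (by rw [hs' 9 (by decide), e₁ 9 (by decide)]))
  · intro i j s' hs' hi hj
    have eu := evu s' (by rw [hs' 9 (by decide), e₁ 9 (by decide)])
    have ek := evk s' (by rw [hs' 20 (by decide), e₁ 20 (by decide)])
    have ei : (Expr.var 13).Evals (cellBits d.bitSize) s' (optIdx i : ℕ) := .var hi (bits_optIdx_le i)
    have ej : (Expr.var 21).Evals (cellBits d.bitSize) s' (optIdx j : ℕ) := .var hj (bits_optIdx_le j)
    have h17 : s' 17 = s 17 := by rw [hs' 17 (by decide), e₁ 17 (by decide)]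
    have eB : ∀ {e f : Expr} {i j : Option (Fin (d.n u))},
        e.Evals (cellBits d.bitSize) s' (optIdx i : ℕ) →
        f.Evals (cellBits d.bitSize) s' (optIdx j : ℕ) →
        (Expr.entry 17 e f).Evals (cellBits d.bitSize) s' (mat (d.n u) (s 17) i j) := fun he hf =>
      .entry he hf (by rw [h17, mat]) (bits_firstEntry_le hρ h.entry _ _)
    -- Multiplication by the flag of `j`, with `k` already cleared, plays the role of the case
    -- distinction in `eliminate`.
    have key := Expr.Evals.mul (.entry eu ej (by rw [hs' 7 (by decide), row₁ j]) (bits_ite_le _ _))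
      ((eB ei ej).add (((eB ei ek).mul (eB ek ej)).div (.sub .one (eB ek ek))))
    rw [ite_mul, one_mul, zero_mul, ← erase_insertNone] at key
    exact key
  intro s₂ hs₂ h18
  have L₂ : d.Loaded s₂ := L₁.agree hs₂ (by decide)
  refine Ok.fill_opt (n := d.n u)
    (F := eliminate (Finset.insertNone S) (mat (d.n u) (s 17)) (some k)) (by decide) (by decide)
    (by decide) hn hb ?_ ?_ ?_ ?_
  · exact fun s' hs' => (L₂.agree hs' (by decide)).evals_numOptions
      (evu s' (by rw [hs' 9 (by decide), hs₂ 9 (by decide), e₁ 9 (by decide)]))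
  · exact fun s' hs' => (L₂.agree hs' (by decide)).evals_numOptions
      (evu s' (by rw [hs' 9 (by decide), hs₂ 9 (by decide), e₁ 9 (by decide)]))
  · intro i j s' hs' hi hj
    exact .entry (.var hi (bits_optIdx_le i)) (.var hj (bits_optIdx_le j))
      (by rw [hs' 18 (by decide), h18]) (bits_firstEntry_le hρ hB' i j)
  · intro s₃ hs₃ h17
    have hm : mat (d.n u) (s₃ 17) =
        eliminate (Finset.insertNone S) (mat (d.n u) (s 17)) (some k) := by
      funext i j
      exact h17 i j
    have h7 : s₃ 7 = s₁ 7 := by rw [hs₃ 7 (by decide), hs₂ 7 (by decide)]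
    rw [h7]
    exact ⟨⟨row₁, hm ▸ hB', hm ▸ hoff'⟩, rest₁, hm⟩

/-- The prices are stored, and all sums in the course of the computation are short. -/
structure ShortSums (d : MarketData ℚ) (u : Fin d.m) (r : Option (Fin (d.n u)) → ℚ) : Prop where
  price : ∀ o, bits (r o) ≤ cellBits d.bitSize
  expect : ∀ S B, FirstEntry (d.rho u) (Finset.insertNone S) B →
    ∀ i (T : Finset (Option (Fin (d.n u)))), bits (∑ o ∈ T, B i o * r o) ≤ cellBits d.bitSize

theorem expectProg_ok (hs : d.Loaded s) (hρ : Absorbs (d.rho u) none)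
    (hu : s 9 0 0 0 0 = (u : ℕ)) {r : Option (Fin (d.n u)) → ℚ} {S : Finset (Fin (d.n u))}
    (hr : ∀ o : Option (Fin (d.n u)), s 15 u (optIdx o) 0 0 = r o) (hshort : ShortSums d u r)
    (hB : FirstEntry (d.rho u) (Finset.insertNone S) (mat (d.n u) (s 17)))
    {e : Expr} {i : Option (Fin (d.n u))}
    (he : ∀ s', Agree [21, 22] s s' → e.Evals (cellBits d.bitSize) s' (optIdx i : ℕ))
    (hend : ∀ s', Agree [21, 22] s s' →
      s' 22 0 0 0 0 = ∑ j, mat (d.n u) (s 17) i j * r j → Q s') :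
    Ok d.bitSize (cellBits d.bitSize) (expectProg e) s Q := by
  have hn : d.n u + 1 ≤ d.bitSize := (d.size_lt_bitSize u).le
  have hb : d.bitSize + 1 ≤ cellBits d.bitSize := by have := le_cellBits d.bitSize; omega
  refine Ok.seq (Ok.setVar .zero' ?_)
  set s₁ := s.set 22 0 0 0 0 0 with hs₁
  have e₁ : ∀ s', Agree [21, 22] s₁ s' → Agree [21, 22] s s' := fun s' hs' a ha => by
    rw [hs' a ha, hs₁, Store.set_ne]
    exact fun h => ha (by simp [h])
  have evu : ∀ s', Agree [21, 22] s₁ s' → (Expr.var 9).Evals (cellBits d.bitSize) s' (u : ℕ) :=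
    fun s' hs' => .var (by rw [e₁ s' hs' 9 (by decide), hu]) (bits_index_le u)
  refine Ok.sumLoop_opt (n := d.n u) (a := 0) (g := fun j => mat (d.n u) (s 17) i j * r j)
    (by decide) hn hb (s.set_same _ _ _ _ _ _) ?_ ?_ ?_ ?_
  · exact fun s' hs' => (hs.agree (e₁ s' hs') (by decide)).evals_numOptions (evu s' hs')
  · intro j s' hs' hj
    have ej : (Expr.var 21).Evals (cellBits d.bitSize) s' (optIdx j : ℕ) := .var hj (bits_optIdx_le j)
    exact .mul (.entry (he s' (e₁ s' hs')) ej (by rw [e₁ s' hs' 17 (by decide), mat])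
      (bits_firstEntry_le hρ hB _ _)) (.entry (evu s' hs') ej
        (by rw [e₁ s' hs' 15 (by decide), hr]) (hshort.price j))
  · intro T
    rw [zero_add]
    exact hshort.expect S _ hB i T
  · intro s' hs' h22
    exact hend s' (e₁ s' hs') (by rw [h22, zero_add])

/-- Eliminating a product changes `B` and may spoil products already checked, so a single pass is
not enough. But a pass that does not end with all remaining products checked has removed at least
one, hence `n` passes suffice. -/
theorem sweepProg_ok (hs : d.Loaded s) (hρ : Absorbs (d.rho u) none)
    (hu : s 9 0 0 0 0 = (u : ℕ)) {r : Option (Fin (d.n u)) → ℚ}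
    (hr : ∀ o : Option (Fin (d.n u)), s 15 u (optIdx o) 0 0 = r o) (hshort : ShortSums d u r)
    (h : Eliminated d u r (s 7) (s 17) Finset.univ)
    (hend : ∀ s', Agree sweepProg.mods s s' → ∀ S, Eliminated d u r (s' 7) (s' 17) S →
      (∀ i ∈ S, ∑ j, mat (d.n u) (s' 17) (some i) j * r j ≤ r (some i)) →
      (∀ w ≠ (u : ℕ), s' 7 w = s 7 w) → Q s') :
    Ok d.bitSize (cellBits d.bitSize) sweepProg s Q := by
  have hn : d.n u + 1 ≤ d.bitSize := (d.size_lt_bitSize u).le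
  have hb : d.bitSize + 1 ≤ cellBits d.bitSize := by have := le_cellBits d.bitSize; omega
  have evu : ∀ s', s' 9 = s 9 → (Expr.var 9).Evals (cellBits d.bitSize) s' (u : ℕ) := fun s' e =>
    .var (by rw [e, hu]) (bits_index_le u)
  refine Ok.loop (n := d.n u) (by decide) (by omega) hb (fun p s' => ∃ S,
    Eliminated d u r (s' 7) (s' 17) S ∧
    ((∀ i ∈ S, ∑ j, mat (d.n u) (s' 17) (some i) j * r j ≤ r (some i)) ∨ S.card + p ≤ d.n u) ∧
    ∀ w ≠ (u : ℕ), s' 7 w = s 7 w) ?_ ?_ ?_ ?_ ?_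
  · intro x s₁ s₂ h12 hI
    rwa [h12 7 (by decide), h12 17 (by decide)]
  · exact fun s' hs' => (hs.agree hs' (by decide)).evals_size (evu s' (hs' 9 (by decide)))
  · exact ⟨_, h, Or.inr (by simp), fun _ _ => rfl⟩
  · intro p hp s₁ hs₁ _ ⟨S, hS, hcard, hrest⟩
    -- During a pass: no product can be eliminated any more, or this pass has eliminated one
    -- already, or all remaining products before position `x` pass the test.
    refine Ok.loop (n := d.n u) (by decide) (by omega) hb (fun x s' => ∃ S,
      Eliminated d u r (s' 7) (s' 17) S ∧
      ((∀ i ∈ S, ∑ j, mat (d.n u) (s' 17) (some i) j * r j ≤ r (some i)) ∨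
        S.card + (p + 1) ≤ d.n u ∨ S.card + p ≤ d.n u ∧
        ∀ i ∈ S, i.val < x → ∑ j, mat (d.n u) (s' 17) (some i) j * r j ≤ r (some i)) ∧
      ∀ w ≠ (u : ℕ), s' 7 w = s 7 w) ?_ ?_ ?_ ?_ ?_
    · intro x s₁ s₂ h12 hI
      rwa [h12 7 (by decide), h12 17 (by decide)]
    · exact fun s' hs' => ((hs.agree hs₁ (by decide)).agree hs' (by decide)).evals_size
        (evu s' (by rw [hs' 9 (by decide), hs₁ 9 (by decide)]))
    · exact ⟨S, hS, hcard.imp_right fun hc => Or.inr ⟨hc, fun i _ hi => absurd hi (Nat.not_lt_zero _)⟩,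
        hrest⟩
    · intro x hx s₂ hs₂ hxv ⟨S, hS, hcase, hrest⟩
      obtain ⟨k, rfl⟩ : ∃ k : Fin (d.n u), x = k.val := ⟨⟨x, hx⟩, rfl⟩
      have L₂ : d.Loaded s₂ := (hs.agree hs₁ (by decide)).agree hs₂ (by decide)
      have h9 : s₂ 9 = s 9 := by rw [hs₂ 9 (by decide), hs₁ 9 (by decide)]
      have h15 : s₂ 15 = s 15 := by rw [hs₂ 15 (by decide), hs₁ 15 (by decide)]
      have evk : ∀ s', s' 20 = s₂ 20 →
          pivotExpr.Evals (cellBits d.bitSize) s' (optIdx (some k) : ℕ) := fun s' e =>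
        (Expr.Evals.var (by rw [e, hxv]) (bits_nat_le (by omega))).succ
      refine Ok.seq (expectProg_ok L₂ hρ (by rw [h9, hu]) (by rw [h15]; exact hr) hshort hS.entry
        (i := some k) (fun s' hs' => evk s' (hs' 20 (by decide))) fun s₃ hs₃ h22 => ?_)
      have h7 : s₃ 7 = s₂ 7 := hs₃ 7 (by decide)
      have h17 : s₃ 17 = s₂ 17 := hs₃ 17 (by decide)
      refine Ok.ifLe (.var h22 (hshort.expect S _ hS.entry _ _)) (.entry
        (evu s₃ (by rw [hs₃ 9 (by decide), h9])) (evk s₃ (hs₃ 20 (by decide)))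
        (by rw [hs₃ 15 (by decide), h15, hr]) (hshort.price _)) (fun hle => ?_) fun hlt => ?_
      · refine Ok.skip ?_
        rw [h7, h17]
        refine ⟨S, hS, hcase.imp_right fun hc => hc.imp_right fun hc => ⟨hc.1, fun i hi hik => ?_⟩,
          hrest⟩
        rcases Nat.lt_succ_iff_lt_or_eq.1 hik with h1 | h1
        · exact hc.2 i hi h1
        · rw [Fin.ext h1]
          exact hle
      · rw [← h7, ← h17] at hS
        rw [← h17] at hlt hcase
        refine (eliminateProg_ok (L₂.agree hs₃ (by decide)) hρ
          (by rw [hs₃ 9 (by decide), h9, hu]) (by rw [hs₃ 20 (by decide), hxv]) hS hlt.le).mono ?_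
        intro s₄ _ ⟨h1, h2, hm⟩
        refine ⟨S.erase k, h1, ?_, fun w hw => by rw [h2 w hw, h7, hrest w hw]⟩
        -- If `k` is gone already, the elimination changes neither the set nor the matrix, and
        -- position `k` holds no product to check.
        by_cases hk : k ∈ S
        · have hc := Finset.card_erase_add_one hk
          rcases hcase with h3 | h3 | h3
          · exact absurd (h3 k hk) (not_le.2 hlt)
          · exact Or.inr (Or.inl (by omega))
          · exact Or.inr (Or.inl (by omega))
        · rw [hS.entry.eliminate_of_notMem (by simpa using hk)] at hm
          rw [Finset.erase_eq_of_notMem hk, hm]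
          refine hcase.imp_right fun hc => hc.imp_right fun hc => ⟨hc.1, fun i hi hik => ?_⟩
          rcases Nat.lt_succ_iff_lt_or_eq.1 hik with h3 | h3
          · exact hc.2 i hi h3
          · exact absurd (Fin.ext h3 ▸ hi) hk
    · intro s' _ ⟨S, hS, hcase, hrest⟩
      refine ⟨S, hS, ?_, hrest⟩
      rcases hcase with h1 | h1 | h1
      · exact Or.inl h1
      · exact Or.inr h1
      · exact Or.inl fun i hi => h1.2 i hi i.2
  · intro s' hs' ⟨S, hS, hcase, hrest⟩
    refine hend s' hs' S hS ?_ hrest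
    rcases hcase with h1 | h1
    · exact h1
    · have : S = ∅ := Finset.card_eq_zero.1 (by omega)
      simp [this]

end MarketData


theorem Store.set_congr {s s' : Store} {a : ℕ} (h : s a = s' a) (i j k l : ℕ) (v : ℚ) :
    s.set a i j k l v a = s'.set a i j k l v a := by
  funext i' j' k' l'
  simp [Store.set, h]

namespace MarketData

variable {d : MarketData ℚ} {s : Store} {u : Fin d.m} {Q : Store → Prop}

theorem initProg_ok (hs : d.Loaded s) (hρ : Absorbs (d.rho u) none)
    (hu : s 9 0 0 0 0 = (u : ℕ)) (r : Option (Fin (d.n u)) → ℚ)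
    (hend : ∀ s', Agree initProg.mods s s' → Eliminated d u r (s' 7) (s' 17) Finset.univ →
      (∀ w ≠ (u : ℕ), s' 7 w = s 7 w) → Q s') :
    Ok d.bitSize (cellBits d.bitSize) initProg s Q := by
  have hn : d.n u + 1 ≤ d.bitSize := (d.size_lt_bitSize u).le
  have hb : d.bitSize + 1 ≤ cellBits d.bitSize := by have := le_cellBits d.bitSize; omega
  have evu : ∀ s', s' 9 = s 9 → (Expr.var 9).Evals (cellBits d.bitSize) s' (u : ℕ) := fun s' e =>
    .var (by rw [e, hu]) (bits_index_le u)
  refine Ok.seq (Ok.fill_opt (n := d.n u) (F := d.rho u) (by decide) (by decide) (by decide) hn hb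
    (fun s' hs' => (hs.agree hs' (by decide)).evals_numOptions (evu s' (hs' 9 (by decide))))
    (fun s' hs' => (hs.agree hs' (by decide)).evals_numOptions (evu s' (hs' 9 (by decide)))) ?_ ?_)
  · intro i j s' hs' hi hj
    exact (hs.agree hs' (by decide)).evals_rho (evu s' (hs' 9 (by decide)))
      (.var hi (bits_optIdx_le i)) (.var hj (bits_optIdx_le j))
  intro s₁ hs₁ h17
  -- The loop starts at index `0`, so no purchase gets the flag `1` as well, as the elimination
  -- formula requires.
  refine Ok.fillRow_opt (n := d.n u) (A := 7) (r := u) (f := fun _ => 1) (by decide) (by decide) hn hb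
    (fun s' hs' => ((hs.agree hs₁ (by decide)).agree hs' (by decide)).evals_numOptions
      (evu s' (by rw [hs' 9 (by decide), hs₁ 9 (by decide)]))) ?_ ?_
  · intro o s' hs' ho _
    exact Ok.setEntry (evu s' (by rw [hs' 9 (by decide), hs₁ 9 (by decide)]))
      (.var ho (bits_optIdx_le o)) .one rfl
  · intro s₂ hs₂ h7 hrest
    have e : Finset.insertNone (Finset.univ : Finset (Fin (d.n u))) = Finset.univ := by
      ext o
      cases o <;> simp
    have hm : mat (d.n u) (s₂ 17) = d.rho u := by
      funext i j
      rw [mat, hs₂ 17 (by decide), h17]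
    refine hend s₂ (fun a ha => ?_) ⟨fun o => by rw [h7, e]; simp, ?_, by simp [e]⟩
      fun w hw => by rw [hrest w hw, hs₁ 7 (by decide)]
    · have h1 : a ∉ [13, 21, 17] := fun h => ha (List.mem_append_left _ h)
      have h2 : a ∉ [13, 7] := fun h => ha (List.mem_append_right _ h)
      rw [hs₂ a h2, hs₁ a h1]
    · rw [hm, e]
      exact FirstEntry.univ hρ

theorem valueProg_ok (hs : d.Loaded s) (hρ : Absorbs (d.rho u) none)
    (hu : s 9 0 0 0 0 = (u : ℕ)) {r : Option (Fin (d.n u)) → ℚ} {S : Finset (Fin (d.n u))}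
    (hr : ∀ o : Option (Fin (d.n u)), s 15 u (optIdx o) 0 0 = r o) (hshort : ShortSums d u r)
    (h : Eliminated d u r (s 7) (s 17) S)
    (hend : ∀ s', Agree valueProg.mods s s' → (∀ o, row (d.n u) u (s' 16) o =
      if o ∈ Finset.insertNone S then r o else ∑ j, mat (d.n u) (s 17) o j * r j) →
      (∀ w ≠ (u : ℕ), s' 16 w = s 16 w) → Q s') :
    Ok d.bitSize (cellBits d.bitSize) valueProg s Q := by
  have hn : d.n u + 1 ≤ d.bitSize := (d.size_lt_bitSize u).le
  have hb : d.bitSize + 1 ≤ cellBits d.bitSize := by have := le_cellBits d.bitSize; omega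
  have evu : ∀ s', s' 9 = s 9 → (Expr.var 9).Evals (cellBits d.bitSize) s' (u : ℕ) := fun s' e =>
    .var (by rw [e, hu]) (bits_index_le u)
  refine Ok.fillRow_opt (n := d.n u) (A := 16) (r := u) (f := fun o =>
      if o ∈ Finset.insertNone S then r o else ∑ j, mat (d.n u) (s 17) o j * r j)
    (by decide) (by decide) hn hb
    (fun s' hs' => (hs.agree hs' (by decide)).evals_numOptions (evu s' (hs' 9 (by decide)))) ?_
    fun s' hs' h16 hrest => hend s' hs' h16 hrest
  intro o s₁ hs₁ ho _
  have h17 : s₁ 17 = s 17 := hs₁ 17 (by decide)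
  refine Ok.seq (expectProg_ok (hs.agree hs₁ (by decide)) hρ (by rw [hs₁ 9 (by decide), hu])
    (by rw [hs₁ 15 (by decide)]; exact hr) hshort (by rw [h17]; exact h.entry) (i := o)
    (fun s' hs' => .var (by rw [hs' 13 (by decide), ho]) (bits_optIdx_le o)) fun s₂ hs₂ h22 => ?_)
  have eu := evu s₂ (by rw [hs₂ 9 (by decide), hs₁ 9 (by decide)])
  have eo : (Expr.var 13).Evals (cellBits d.bitSize) s₂ (optIdx o : ℕ) :=
    .var (by rw [hs₂ 13 (by decide), ho]) (bits_optIdx_le o)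
  have e7 : (Expr.entry 7 (.var 9) (.var 13)).Evals (cellBits d.bitSize) s₂
      (if o ∈ Finset.insertNone S then 1 else 0) :=
    .entry eu eo (by rw [hs₂ 7 (by decide), hs₁ 7 (by decide), h.row]) (bits_ite_le _ _)
  have e15 : (Expr.entry 15 (.var 9) (.var 13)).Evals (cellBits d.bitSize) s₂ (r o) :=
    .entry eu eo (by rw [hs₂ 15 (by decide), hs₁ 15 (by decide), hr]) (hshort.price o)
  rw [h17] at h22
  have e22 := Expr.Evals.var h22 (hshort.expect S _ h.entry _ _)
  refine Ok.setEntry eu eo (.add (.mul e7 e15) (.mul (.sub .one e7) e22)) ?_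
  rw [Store.set_congr (hs₂ 16 (by decide))]
  congr 1
  split_ifs <;> ring

/-- The adjusted prices of a category, from the values of its children. -/
def adjustedPrice (d : MarketData ℚ) (V : (u : Fin d.m) → Option (Fin (d.n u)) → ℚ) (u : Fin d.m)
    (i : Option (Fin (d.n u))) : ℚ :=
  i.elim 0 (d.price u) + ∑ w, if d.edge u w = true then ∑ j, d.lam u w i j * V w j else 0

/-- All sums in the computation of the adjusted prices are short. -/
structure ShortAdjust (d : MarketData ℚ) (V : (u : Fin d.m) → Option (Fin (d.n u)) → ℚ)
    (u : Fin d.m) : Prop where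
  value : ∀ w, d.edge u w = true → ∀ j, bits (V w j) ≤ cellBits d.bitSize
  partial_sum : ∀ i (W : Finset (Fin d.m)), bits (i.elim 0 (d.price u) +
    ∑ w ∈ W, if d.edge u w = true then ∑ j, d.lam u w i j * V w j else 0) ≤ cellBits d.bitSize
  partial_sum_add : ∀ i (W : Finset (Fin d.m)) w (T : Finset (Option (Fin (d.n w)))),
    d.edge u w = true → bits (i.elim 0 (d.price u) +
      (∑ w ∈ W, if d.edge u w = true then ∑ j, d.lam u w i j * V w j else 0) +
      ∑ j ∈ T, d.lam u w i j * V w j) ≤ cellBits d.bitSize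

theorem filter_val_lt_succ {m x : ℕ} (hx : x < m) :
    Finset.univ.filter (fun w : Fin m => w.val < x + 1) =
      insert ⟨x, hx⟩ (Finset.univ.filter fun w : Fin m => w.val < x) := by
  ext w
  simp only [Finset.mem_filter, Finset.mem_univ, true_and, Finset.mem_insert, Fin.ext_iff]
  omega

theorem adjustProg_ok (hs : d.Loaded s) (hu : s 9 0 0 0 0 = (u : ℕ))
    {V : (u : Fin d.m) → Option (Fin (d.n u)) → ℚ}
    (hV : ∀ w, d.edge u w = true → ∀ j, s 16 w (optIdx j) 0 0 = V w j) (hshort : ShortAdjust d V u)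
    (hend : ∀ s', Agree adjustProg.mods s s' →
      (∀ o, row (d.n u) u (s' 15) o = adjustedPrice d V u o) →
      (∀ w ≠ (u : ℕ), s' 15 w = s 15 w) → Q s') :
    Ok d.bitSize (cellBits d.bitSize) adjustProg s Q := by
  have hn : ∀ u, d.n u + 1 ≤ d.bitSize := fun u => (d.size_lt_bitSize u).le
  have hb : d.bitSize + 1 ≤ cellBits d.bitSize := by have := le_cellBits d.bitSize; omega
  have evu : ∀ s', s' 9 = s 9 → (Expr.var 9).Evals (cellBits d.bitSize) s' (u : ℕ) := fun s' e =>
    .var (by rw [e, hu]) (bits_index_le u)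
  refine Ok.fillRow_opt (n := d.n u) (A := 15) (r := u) (f := adjustedPrice d V u)
    (by decide) (by decide) (hn u) hb
    (fun s' hs' => (hs.agree hs' (by decide)).evals_numOptions (evu s' (hs' 9 (by decide)))) ?_
    fun s' hs' h15 hrest => hend s' hs' h15 hrest
  intro i s₁ hs₁ hi _
  have L₁ : d.Loaded s₁ := hs.agree hs₁ (by decide)
  refine Ok.seq (Ok.setVar .zero' ?_)
  set s₂ := s₁.set 22 0 0 0 0 0 with hs₂
  have a₂ : Agree [22] s₁ s₂ := fun a ha => s₁.set_ne (by simpa using ha) _ _ _ _ _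
  have h13 : ∀ s', s' 13 = s₁ 13 →
      (Expr.var 13).Evals (cellBits d.bitSize) s' (optIdx i : ℕ) := fun s' e =>
    .var (by rw [e, hi]) (bits_optIdx_le i)
  -- Index `0` is no purchase. The price array holds no input there, so the accumulator keeps its
  -- initial `0`.
  have hprice : Ok d.bitSize (cellBits d.bitSize)
      (.ifLe (.lit 1) (.var 13) (.setVar 22 (.entry 3 (.var 9) (.var 13))) .skip) s₂
      fun s' => s' 22 0 0 0 0 = i.elim 0 (d.price u) := by
    refine Ok.ifLe .one (h13 s₂ (a₂ 13 (by decide))) (fun hle => ?_) fun hlt => ?_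
    · cases i with
      | none => norm_num [optIdx] at hle
      | some i =>
        refine Ok.setVar ((L₁.agree a₂ (by decide)).evals_price
          (evu s₂ (by rw [a₂ 9 (by decide), hs₁ 9 (by decide)])) (h13 s₂ (a₂ 13 (by decide)))) ?_
        exact s₂.set_same _ _ _ _ _ _
    · cases i with
      | none => exact Ok.skip (s₁.set_same _ _ _ _ _ _)
      | some i =>
        have : (1 : ℚ) ≤ (optIdx (some i) : ℕ) := by
          simp only [optIdx, Option.elim_some]
          exact_mod_cast Nat.succ_pos _
        exact absurd this (not_le.2 hlt)
  refine Ok.seq (hprice.mono fun s₃ hs₃ h22 => ?_)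
  have a₃ : Agree [22] s₁ s₃ := fun a ha => by rw [hs₃ a (by simpa [Imp.mods] using ha), a₂ a ha]
  refine Ok.seq ?_
  refine Ok.loop (n := d.m) (by decide) d.card_le_bitSize hb (fun x s' => s' 22 0 0 0 0 =
    i.elim 0 (d.price u) + ∑ w with w.val < x,
      if d.edge u w = true then ∑ j, d.lam u w i j * V w j else 0) ?_ ?_ ?_ ?_ ?_
  · intro x s s' h12 h
    rwa [h12 22 (by decide)]
  · exact fun s' hs' => ((L₁.agree a₃ (by decide)).agree hs' (by decide)).evals_num
  · simpa using h22
  · intro x hx s₄ hs₄ hxv hI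
    obtain ⟨w, rfl⟩ : ∃ w : Fin d.m, x = w.val := ⟨⟨x, hx⟩, rfl⟩
    have L₄ : d.Loaded s₄ := (L₁.agree a₃ (by decide)).agree hs₄ (by decide)
    have h9 : s₄ 9 = s 9 := by rw [hs₄ 9 (by decide), a₃ 9 (by decide), hs₁ 9 (by decide)]
    have h16 : s₄ 16 = s 16 := by rw [hs₄ 16 (by decide), a₃ 16 (by decide), hs₁ 16 (by decide)]
    have h13' : s₄ 13 = s₁ 13 := by rw [hs₄ 13 (by decide), a₃ 13 (by decide)]
    have evw : ∀ s', s' 11 = s₄ 11 → (Expr.var 11).Evals (cellBits d.bitSize) s' (w : ℕ) :=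
      fun s' e => .var (by rw [e, hxv]) (bits_index_le w)
    rw [filter_val_lt_succ hx, Finset.sum_insert (by simp)]
    -- A genuine branch instead of a factor: on non-edges the cells of `λ` are unspecified and may
    -- be arbitrarily long.
    refine Ok.ifLe .one (L₄.evals_edge (evu s₄ h9) (evw s₄ rfl)) (fun hle => ?_) fun hlt => ?_
    · have huw : d.edge u w = true := by
        by_contra hne
        rw [if_neg hne] at hle
        norm_num at hle
      rw [if_pos huw]
      refine Ok.sumLoop_opt (n := d.n w) (g := fun j => d.lam u w i j * V w j) (by decide) (hn w) hb
        hI ?_ ?_ ?_ ?_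
      · exact fun s' hs' => (L₄.agree hs' (by decide)).evals_numOptions (evw s' (hs' 11 (by decide)))
      · intro j s' hs' hj
        have ej : (Expr.var 21).Evals (cellBits d.bitSize) s' (optIdx j : ℕ) :=
          .var hj (bits_optIdx_le j)
        have ew := evw s' (hs' 11 (by decide))
        exact .mul ((L₄.agree hs' (by decide)).evals_lam huw
          (evu s' (by rw [hs' 9 (by decide), h9])) ew
          (h13 s' (by rw [hs' 13 (by decide), h13'])) ej)
          (.entry ew ej (by rw [hs' 16 (by decide), h16, hV w huw]) (hshort.value w huw j))
      · exact fun T => hshort.partial_sum_add i _ w T huw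
      · intro s' _ h
        rw [h]
        ring
    · have huw : ¬ d.edge u w = true := by
        intro hne
        rw [if_pos hne] at hlt
        exact lt_irrefl _ hlt
      rw [if_neg huw, zero_add]
      exact Ok.skip hI
  · intro s₅ hs₅ h22'
    rw [Finset.filter_true_of_mem fun w _ => w.2] at h22'
    have h9 : s₅ 9 = s 9 := by rw [hs₅ 9 (by decide), a₃ 9 (by decide), hs₁ 9 (by decide)]
    refine Ok.setEntry (evu s₅ h9) (h13 s₅ (by rw [hs₅ 13 (by decide), a₃ 13 (by decide)]))
      (.var h22' (hshort.partial_sum i _)) ?_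
    exact Store.set_congr (by rw [hs₅ 15 (by decide), a₃ 15 (by decide)]) _ _ _ _ _

end MarketData


/-! ## The whole program -/

/-- Processing of a category. -/
def categoryProg : Imp :=
  .seq adjustProg (.seq initProg (.seq sweepProg (.seq valueProg
    (.setEntry 10 (.lit 0) (.var 9) (.lit 1)))))

/-- Processing of a category if it is not settled and all its children are settled. -/
def visitProg : Imp :=
  .seq (.setVar 12 (.entry 10 (.lit 0) (.var 9)))
    (.seq
      (.sumLoop 12 11 (.var 0)
        (.mul (.entry 2 (.var 9) (.var 11)) (.sub (.lit 1) (.entry 10 (.lit 0) (.var 11)))))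
      (.ifLe (.var 12) (.lit 0) categoryProg .skip))

/-- Backward induction. -/
def backwardProg : Imp :=
  .seq (.loop 9 (.var 0) (.setEntry 10 (.lit 0) (.var 9) (.lit 0)))
    (.loop 8 (.var 0) (.loop 9 (.var 0) visitProg))

namespace MarketData

/-- The properties of valid rational data that the program relies on. -/
structure ValidRat (d : MarketData ℚ) : Prop where
  acyclic : ∀ u, ¬ Relation.TransGen (fun a b => d.edge a b = true) u u
  rho : ∀ u, Absorbs (d.rho u) none
  lam : ∀ u w, d.edge u w = true → ∀ i j, |d.lam u w i j| ≤ 1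

theorem Valid.validRat {d : MarketData ℚ} (h : d.toReal.Valid) : d.ValidRat where
  acyclic := h.acyclic
  rho u := by
    have h1 : ∀ i : Option (Fin (d.n u)), IsProb fun j => (d.rho u i j : ℝ) := (h.rho_trans u).1
    have h2 : ∀ i : Option (Fin (d.n u)),
        Relation.ReflTransGen (fun a b => (0 : ℝ) < d.rho u a b) i none := (h.rho_trans u).2
    refine ⟨fun i j => ?_, fun i => ?_, fun i =>
      Relation.ReflTransGen.mono (fun a b hab => ?_) _ _ (h2 i)⟩
    · have : (0 : ℝ) ≤ d.rho u i j := (h1 i).1 j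
      exact_mod_cast this
    · have : ∑ j, (d.rho u i j : ℝ) = 1 := (h1 i).2
      exact_mod_cast this
    · exact_mod_cast hab
  lam u w huw i j := by
    obtain ⟨h1, h2⟩ := h.lam_prob u w huw i
    have h3 : d.toReal.lam u w i j ≤ 1 :=
      h2 ▸ Finset.single_le_sum (f := d.toReal.lam u w i) (fun k _ => h1 k) (Finset.mem_univ j)
    have h4 : (0 : ℝ) ≤ (d.lam u w i j : ℝ) := h1 j
    have h5 : (d.lam u w i j : ℝ) ≤ 1 := h3
    rw [abs_of_nonneg (by exact_mod_cast h4)]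
    exact_mod_cast h5

variable {d : MarketData ℚ} {s s' : Store} {u : Fin d.m} {Q : Store → Prop}

/-! ### Bit lengths -/

/-- The exponent reached after `τ` visits plus the growth within one more visit stays in the budget:
`2 * (L * L)` for the first entry probabilities and `3 * L` for prices, transition vectors and sums.
-/
theorem stepBits_mul_le {L τ : ℕ} (hτ : τ ≤ L * L) :
    stepBits L * τ + 2 * (L * L) + 3 * L ≤ stepBits L * (L * L + 1) := by
  have h : stepBits L * τ ≤ stepBits L * (L * L) := Nat.mul_le_mul_left _ hτ
  have h5 : stepBits L = 2 * L * L + 3 * L := rfl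
  have h6 : stepBits L * (L * L + 1) = stepBits L * (L * L) + stepBits L := by ring
  rw [h6]
  linarith

theorem elim_price_fine {D : ℕ} (hD : ∀ i, HasDenom D (d.price u i)) (i : Option (Fin (d.n u))) :
    Fine D (2 ^ d.bitSize) (i.elim 0 (d.price u)) := by
  cases i with
  | none => exact Fine.zero (by positivity)
  | some i =>
    exact ⟨hD i, (abs_le_two_pow_bits _).trans
      (pow_le_pow_right₀ one_le_two (bits_price_le u i))⟩

/-- The alternative `T = ∅` covers the accumulator between two children, where no edge to `w` is at
hand to bound `d.lam u w`. -/
theorem partial_sum_fine (hd : d.ValidRat) {V : (u : Fin d.m) → Option (Fin (d.n u)) → ℚ}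
    {D E : ℕ} (hD1 : ∀ i, HasDenom D (d.price u i))
    (hD2 : ∀ w, d.edge u w = true → ∀ i j, HasDenom D (d.lam u w i j)) {f : ℕ}
    (hf : d.bitSize ≤ f) (hV : ∀ w, d.edge u w = true → ∀ j, Fine E (2 ^ f) (V w j))
    (i : Option (Fin (d.n u))) (W : Finset (Fin d.m)) (w : Fin d.m)
    (T : Finset (Option (Fin (d.n w)))) (hw : d.edge u w = true ∨ T = ∅) :
    Fine (D * E) (2 ^ (f + 2 * d.bitSize)) (i.elim 0 (d.price u) +
      (∑ w ∈ W, if d.edge u w = true then ∑ j, d.lam u w i j * V w j else 0) +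
      ∑ j ∈ T, d.lam u w i j * V w j) := by
  have hterm : ∀ w, d.edge u w = true → ∀ T : Finset (Option (Fin (d.n w))),
      Fine (D * E) (d.bitSize * 2 ^ f) (∑ j ∈ T, d.lam u w i j * V w j) := by
    intro w huw T
    refine (Fine.sum fun j _ => Fine.mul (M := 1) ⟨hD2 w huw i j, hd.lam u w huw i j⟩
      (hV w huw j)).mono dvd_rfl ?_
    rw [one_mul]
    refine mul_le_mul_of_nonneg_right ?_ (by positivity)
    have h1 := T.card_le_univ
    rw [Fintype.card_option, Fintype.card_fin] at h1
    exact_mod_cast h1.trans (d.size_lt_bitSize w).le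
  have hT : Fine (D * E) (d.bitSize * 2 ^ f) (∑ j ∈ T, d.lam u w i j * V w j) := by
    rcases hw with hw | rfl
    · exact hterm w hw T
    · simpa using Fine.zero (by positivity)
  have hW : Fine (D * E) (d.bitSize * (d.bitSize * 2 ^ f))
      (∑ w ∈ W, if d.edge u w = true then ∑ j, d.lam u w i j * V w j else 0) := by
    refine (Fine.sum (M := d.bitSize * 2 ^ f) fun w _ => ?_).mono dvd_rfl ?_
    · split_ifs with huw
      · exact hterm w huw _
      · exact Fine.zero (by positivity)
    · refine mul_le_mul_of_nonneg_right ?_ (by positivity)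
      have h1 := W.card_le_univ
      rw [Fintype.card_fin] at h1
      exact_mod_cast h1.trans d.card_le_bitSize
  refine ((((elim_price_fine hD1 i).mono (Dvd.intro _ rfl) le_rfl).add hW).add hT).mono dvd_rfl ?_
  have h1 : (2 : ℚ) ^ d.bitSize ≤ 2 ^ f := pow_le_pow_right₀ one_le_two hf
  have h2 : (d.bitSize : ℚ) + 1 ≤ 2 ^ d.bitSize := by exact_mod_cast Nat.lt_two_pow_self
  have h3 : (0 : ℚ) ≤ d.bitSize := Nat.cast_nonneg _
  have h4 : (0 : ℚ) < 2 ^ f := by positivity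
  have h5 : ((d.bitSize : ℚ) + 1) ^ 2 ≤ (2 ^ d.bitSize) ^ 2 := pow_le_pow_left₀ (by linarith) h2 2
  have h6 := mul_le_mul_of_nonneg_left h5 h4.le
  rw [← pow_mul, ← pow_add, mul_comm d.bitSize 2] at h6
  -- With `L` the input size, the absolute values add up to at most `(1 + L ^ 2 + L) * 2 ^ f ≤ (L +
  -- 1) ^ 2 * 2 ^ f ≤ 2 ^ (f + 2 * L)`.
  nlinarith [mul_nonneg h3 h4.le]

theorem expect_fine {r : Option (Fin (d.n u)) → ℚ} {E E' f : ℕ} (hr : ∀ i, Fine E (2 ^ f) (r i))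
    {B : Option (Fin (d.n u)) → Option (Fin (d.n u)) → ℚ} (hB : ∀ i j, Fine E' 1 (B i j))
    (i : Option (Fin (d.n u))) (T : Finset (Option (Fin (d.n u)))) :
    Fine (E' * E) (2 ^ (f + d.bitSize)) (∑ o ∈ T, B i o * r o) := by
  refine (Fine.sum fun j _ => (hB i j).mul (hr j)).mono dvd_rfl ?_
  rw [one_mul, pow_add, mul_comm]
  refine mul_le_mul_of_nonneg_left ?_ (by positivity)
  have h1 := T.card_le_univ
  rw [Fintype.card_option, Fintype.card_fin] at h1
  have h2 := (h1.trans (d.size_lt_bitSize u).le).trans Nat.lt_two_pow_self.le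
  exact_mod_cast h2

/-! ### Settled categories -/

/-- The stored assortments. -/
def storedAssortments (d : MarketData ℚ) (s : Store) : d.Assortments := fun u =>
  Finset.univ.filter fun i => s 7 u (optIdx (some i)) 0 0 = 1

/-- The stored values. -/
def storedValues (d : MarketData ℚ) (s : Store) (u : Fin d.m) : Option (Fin (d.n u)) → ℚ :=
  row (d.n u) u (s 16)

theorem storedAssortments_eq {S : Finset (Fin (d.n u))}
    (h : ∀ o : Option (Fin (d.n u)), s 7 u (optIdx o) 0 0 = if o ∈ Finset.insertNone S then 1 else 0) :
    storedAssortments d s u = S := by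
  ext i
  rw [storedAssortments, Finset.mem_filter, h]
  simp

/-- The assortment, the adjusted prices and the values of the category `u` are final. -/
structure Settled (d : MarketData ℚ) (s : Store) (u : Fin d.m) : Prop where
  value : IsStoppingValue (d.rho u) (row (d.n u) u (s 15)) (storedAssortments d s u)
    (storedValues d s u)
  indicator : ∀ o : Option (Fin (d.n u)), s 7 u (optIdx o) 0 0 =
    if o ∈ Finset.insertNone (storedAssortments d s u) then 1 else 0
  adjusted : ∀ i, row (d.n u) u (s 15) i = adjustedPrice d (storedValues d s) u i
  children : ∀ w, d.edge u w = true → s 10 0 w 0 0 = 1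

theorem adjustedPrice_congr {V V' : (u : Fin d.m) → Option (Fin (d.n u)) → ℚ}
    (h : ∀ w, d.edge u w = true → V w = V' w) (i : Option (Fin (d.n u))) :
    adjustedPrice d V u i = adjustedPrice d V' u i := by
  refine congrArg (_ + ·) (Finset.sum_congr rfl fun w _ => ?_)
  split_ifs with huw
  · rw [h w huw]
  · rfl

theorem storedValues_congr {w : Fin d.m} (h : s' 16 w = s 16 w) :
    storedValues d s' w = storedValues d s w := by
  funext i
  rw [storedValues, storedValues, row, row, h]

/-- Processing writes only to the row of an unsettled category. The field `children` guarantees that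
the values on which the adjusted prices of `u` rest belong to settled categories and are therefore
never overwritten. -/
theorem Settled.congr (h : Settled d s u)
    (h7 : s' 7 u = s 7 u) (h15 : s' 15 u = s 15 u) (h16 : s' 16 u = s 16 u)
    (hch : ∀ w, d.edge u w = true → s' 16 w = s 16 w)
    (hflag : ∀ w : Fin d.m, s 10 0 w 0 0 = 1 → s' 10 0 w 0 0 = 1) : Settled d s' u := by
  have e1 : storedAssortments d s' u = storedAssortments d s u := by
    simp only [storedAssortments, h7]
  have e2 : row (d.n u) u (s' 15) = row (d.n u) u (s 15) := by
    funext i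
    rw [row, row, h15]
  have e3 := storedValues_congr (d := d) h16
  refine ⟨?_, fun o => ?_, fun i => ?_, fun w huw => hflag w (h.children w huw)⟩
  · rw [e1, e2, e3]
    exact h.value
  · rw [e1, h7]
    exact h.indicator o
  · rw [e2, h.adjusted]
    exact adjustedPrice_congr (fun w huw => (storedValues_congr (hch w huw)).symm) i

/-- The invariant of backward induction after `τ` visits. -/
structure Inv (d : MarketData ℚ) (τ : ℕ) (s : Store) : Prop where
  flag : ∀ w : Fin d.m, s 10 0 w 0 0 = 0 ∨ s 10 0 w 0 0 = 1
  settled : ∀ w : Fin d.m, s 10 0 w 0 0 = 1 → Settled d s w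
  fine : ∃ E : ℕ, 0 < E ∧ E ≤ 2 ^ (stepBits d.bitSize * τ) ∧ ∀ w : Fin d.m, s 10 0 w 0 0 = 1 →
    ∀ j, Fine E (2 ^ (stepBits d.bitSize * τ + d.bitSize)) (storedValues d s w j)

theorem Inv.agree {τ : ℕ} (h : Inv d τ s) {l : List ℕ} (hs : Agree l s s')
    (hl : ∀ a ∈ [7, 10, 15, 16], a ∉ l) : Inv d τ s' := by
  have h7 : s' 7 = s 7 := hs 7 (hl 7 (by decide))
  have h10 : s' 10 = s 10 := hs 10 (hl 10 (by decide))
  have h15 : s' 15 = s 15 := hs 15 (hl 15 (by decide))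
  have h16 : s' 16 = s 16 := hs 16 (hl 16 (by decide))
  refine ⟨by rw [h10]; exact h.flag, fun w hw => ?_, ?_⟩
  · rw [h10] at hw
    exact (h.settled w hw).congr (by rw [h7]) (by rw [h15]) (by rw [h16]) (fun _ _ => by rw [h16])
      fun _ => by rw [h10]; exact id
  · obtain ⟨E, h1, h2, h3⟩ := h.fine
    refine ⟨E, h1, h2, fun w hw => ?_⟩
    rw [h10] at hw
    rw [storedValues_congr (by rw [h16])]
    exact h3 w hw

/-- A visit without effect is counted too. This keeps `τ` a plain loop count, at most `m * m`, at
the price of a coarser bound. -/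
theorem Inv.succ {τ : ℕ} (h : Inv d τ s) : Inv d (τ + 1) s := by
  obtain ⟨E, h1, h2, h3⟩ := h.fine
  have hτ : stepBits d.bitSize * τ ≤ stepBits d.bitSize * (τ + 1) :=
    Nat.mul_le_mul_left _ (Nat.le_succ τ)
  exact ⟨h.flag, h.settled, E, h1, h2.trans (Nat.pow_le_pow_right two_pos hτ), fun w hw j =>
    (h3 w hw j).mono dvd_rfl (pow_le_pow_right₀ one_le_two (Nat.add_le_add_right hτ _))⟩

/-- The common denominator `E` of the settled values is multiplied by `D` for the adjusted prices
and by the determinant bound for the first entry probabilities, while absolute values gain `3 * L`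
bits, with `L` the input size. Both increments fit into `stepBits`. -/
theorem categoryProg_ok (hd : d.ValidRat) (hs : d.Loaded s) (hu : s 9 0 0 0 0 = (u : ℕ)) {τ : ℕ}
    (hτ : τ ≤ d.bitSize * d.bitSize) (h : Inv d τ s) (hflag : s 10 0 u 0 0 = 0)
    (hch : ∀ w, d.edge u w = true → s 10 0 w 0 0 = 1) :
    Ok d.bitSize (cellBits d.bitSize) categoryProg s fun s' =>
      Inv d (τ + 1) s' ∧ s' 10 = s.set 10 0 u 0 0 1 10 := by
  obtain ⟨E, hE0, hE1, hE2⟩ := h.fine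
  obtain ⟨D, hD0, hD1, hD2, hD3⟩ := d.exists_denom_price_lam u
  have hexp := stepBits_mul_le hτ
  set c := stepBits d.bitSize * τ with hc
  have hρ := hd.rho u
  have hDE0 : 0 < D * E := Nat.mul_pos hD0 hE0
  have hDE : D * E ≤ 2 ^ (2 * d.bitSize + c) := by
    rw [pow_add]
    exact Nat.mul_le_mul hD1 hE1
  set V := storedValues d s with hV
  have hpart := partial_sum_fine hd hD2 hD3 (Nat.le_add_left _ c) (V := V) (E := E)
    fun w huw j => hE2 w (hch w huw) j
  have hpart' : ∀ i W, Fine (D * E) (2 ^ (c + d.bitSize + 2 * d.bitSize)) (i.elim 0 (d.price u) +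
      ∑ w ∈ W, if d.edge u w = true then ∑ j, d.lam u w i j * V w j else 0) := fun i W => by
    simpa using hpart i W u ∅ (Or.inr rfl)
  have hadjust : ShortAdjust d V u := by
    refine ⟨fun w huw j => ?_, fun i W => ?_, fun i W w T huw => ?_⟩
    · exact bits_le_cellBits (hE2 w (hch w huw) j) hE0 hE1 (by linarith)
    · exact bits_le_cellBits (hpart' i W) hDE0 hDE (by linarith)
    · exact bits_le_cellBits (hpart i W w T (Or.inl huw)) hDE0 hDE (by linarith)
  set r := adjustedPrice d V u with hr
  have hrfine : ∀ i, Fine (D * E) (2 ^ (c + d.bitSize + 2 * d.bitSize)) (r i) := fun i =>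
    hpart' i Finset.univ
  -- `D * E ∣ E'` makes `E'` a denominator also of the adjusted prices and of all values settled
  -- earlier.
  have hsum : ∀ S B, FirstEntry (d.rho u) (Finset.insertNone S) B → ∃ E', 0 < E' ∧
      E' ≤ 2 ^ (2 * d.bitSize * d.bitSize + (2 * d.bitSize + c)) ∧ D * E ∣ E' ∧
      ∀ i (T : Finset (Option (Fin (d.n u)))),
        Fine E' (2 ^ (c + d.bitSize + 2 * d.bitSize + d.bitSize)) (∑ o ∈ T, B i o * r o) := by
    intro S B hB
    obtain ⟨E', h1, h2, h3⟩ := exists_denom_firstEntry hρ hB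
    refine ⟨E' * (D * E), Nat.mul_pos h1 hDE0, ?_, Dvd.intro_left _ rfl, expect_fine hrfine h3⟩
    rw [pow_add]
    exact Nat.mul_le_mul h2 hDE
  have hshort : ShortSums d u r := by
    refine ⟨fun o => bits_le_cellBits (hrfine o) hDE0 hDE (by linarith), fun S B hB i T => ?_⟩
    obtain ⟨E', h1, h2, -, h3⟩ := hsum S B hB
    exact bits_le_cellBits (h3 i T) h1 h2 (by linarith)
  refine Ok.seq (adjustProg_ok hs hu (V := V) (fun _ _ _ => rfl) hadjust fun s₁ hs₁ h15 r15 => ?_)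
  have L₁ := hs.agree hs₁ (by decide)
  refine Ok.seq (initProg_ok L₁ hρ (by rw [hs₁ 9 (by decide), hu]) r fun s₂ hs₂ hel r7 => ?_)
  have L₂ := L₁.agree hs₂ (by decide)
  refine Ok.seq (sweepProg_ok L₂ hρ (by rw [hs₂ 9 (by decide), hs₁ 9 (by decide), hu])
    (by rw [hs₂ 15 (by decide)]; exact h15) hshort hel fun s₃ hs₃ S hS hbest r7' => ?_)
  have L₃ := L₂.agree hs₃ (by decide)
  refine Ok.seq (valueProg_ok L₃ hρ
    (by rw [hs₃ 9 (by decide), hs₂ 9 (by decide), hs₁ 9 (by decide), hu])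
    (by rw [hs₃ 15 (by decide), hs₂ 15 (by decide)]; exact h15) hshort hS fun s₄ hs₄ h16 r16 => ?_)
  have h9 : s₄ 9 = s 9 := by
    rw [hs₄ 9 (by decide), hs₃ 9 (by decide), hs₂ 9 (by decide), hs₁ 9 (by decide)]
  have h10 : s₄ 10 = s 10 := by
    rw [hs₄ 10 (by decide), hs₃ 10 (by decide), hs₂ 10 (by decide), hs₁ 10 (by decide)]
  refine Ok.setEntry .zero (.var (by rw [h9, hu]) (bits_index_le u)) .one ?_
  set s₅ := s₄.set 10 (0 : ℕ) u 0 0 1 with hs₅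
  have e₅ : ∀ a, a ≠ 10 → s₅ a = s₄ a := fun a ha => s₄.set_ne ha _ _ _ _ _
  have f10 : s₅ 10 = s.set 10 0 u 0 0 1 10 := Store.set_congr h10 _ _ _ _ _
  have f15 : s₅ 15 = s₁ 15 := by
    rw [e₅ 15 (by decide), hs₄ 15 (by decide), hs₃ 15 (by decide), hs₂ 15 (by decide)]
  have f7 : s₅ 7 = s₃ 7 := by rw [e₅ 7 (by decide), hs₄ 7 (by decide)]
  have f16 : s₅ 16 = s₄ 16 := e₅ 16 (by decide)
  have g7 : ∀ w ≠ (u : ℕ), s₅ 7 w = s 7 w := fun w hw => by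
    rw [f7, r7' w hw, r7 w hw, hs₁ 7 (by decide)]
  have g15 : ∀ w ≠ (u : ℕ), s₅ 15 w = s 15 w := fun w hw => by rw [f15, r15 w hw]
  have g16 : ∀ w ≠ (u : ℕ), s₅ 16 w = s 16 w := fun w hw => by
    rw [f16, r16 w hw, hs₃ 16 (by decide), hs₂ 16 (by decide), hs₁ 16 (by decide)]
  have gflag : ∀ w : Fin d.m, w ≠ u → s₅ 10 0 w 0 0 = s 10 0 w 0 0 := fun w hw => by
    have : (w : ℕ) ≠ u := fun e => hw (Fin.ext e)
    rw [f10]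
    simp [Store.set, this]
  have gflag_u : s₅ 10 0 u 0 0 = 1 := by
    rw [f10]
    exact s.set_same _ _ _ _ _ _
  -- The row being written is that of an unsettled category, so all settled rows survive.
  have hne : ∀ w : Fin d.m, s 10 0 w 0 0 = 1 → (w : ℕ) ≠ u := fun w hw e => by
    rw [Fin.ext e, hflag] at hw
    exact zero_ne_one hw
  have gmono : ∀ w : Fin d.m, s 10 0 w 0 0 = 1 → s₅ 10 0 w 0 0 = 1 := fun w hw => by
    rw [gflag w fun e => hne w hw (congrArg Fin.val e), hw]
  have hvalue : storedValues d s₅ u = fun i => if i ∈ Finset.insertNone S then r i else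
      ∑ j, mat (d.n u) (s₃ 17) i j * r j := by
    funext i
    rw [storedValues, f16, h16]
  have hassort : storedAssortments d s₅ u = S := storedAssortments_eq (by rw [f7]; exact hS.row)
  have hadj : row (d.n u) u (s₅ 15) = r := by
    funext i
    rw [f15, h15]
  refine ⟨⟨fun w => ?_, fun w hw => ?_, ?_⟩, f10⟩
  · by_cases hw : w = u
    · rw [hw]
      exact Or.inr gflag_u
    · rw [gflag w hw]
      exact h.flag w
  · by_cases hwu : w = u
    · subst hwu
      refine ⟨?_, ?_, fun i => ?_, fun v hv => gmono v (hch v hv)⟩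
      · rw [hassort, hvalue, hadj]
        exact hS.entry.isStoppingValue hS.off hbest
      · rw [hassort, f7]
        exact hS.row
      · rw [hadj]
        exact adjustedPrice_congr (fun v hv => (storedValues_congr (g16 v (hne v (hch v hv)))).symm) i
    · have hw' : s 10 0 w 0 0 = 1 := by rw [← gflag w hwu, hw]
      have hset := h.settled w hw'
      have hval : (w : ℕ) ≠ u := hne w hw'
      exact hset.congr (g7 w hval) (g15 w hval) (g16 w hval)
        (fun v hv => g16 v (hne v (hset.children v hv))) gmono
  · obtain ⟨E', h1, h2, h3, h4⟩ := hsum S _ hS.entry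
    have hstep : stepBits d.bitSize * (τ + 1) =
        c + (2 * d.bitSize * d.bitSize + 3 * d.bitSize) := by
      rw [hc, mul_add, mul_one]
      rfl
    refine ⟨E', h1, h2.trans (Nat.pow_le_pow_right two_pos (by linarith)), fun w hw j => ?_⟩
    by_cases hwu : w = u
    · subst hwu
      rw [hvalue]
      dsimp only
      split_ifs
      · exact (hrfine j).mono h3 (pow_le_pow_right₀ one_le_two (by nlinarith))
      · exact (h4 j _).mono dvd_rfl (pow_le_pow_right₀ one_le_two (by nlinarith))
    · have hw' : s 10 0 w 0 0 = 1 := by rw [← gflag w hwu, hw]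
      rw [storedValues_congr (g16 w (hne w hw'))]
      exact (hE2 w hw' j).mono ((Dvd.intro_left _ rfl).trans h3)
        (pow_le_pow_right₀ one_le_two (by linarith))

/-- Indicator of the children that are not settled. -/
def pending (d : MarketData ℚ) (u : Fin d.m) (s : Store) (x : ℕ) : ℕ :=
  if h : x < d.m then if d.edge u ⟨x, h⟩ = true ∧ s 10 0 x 0 0 = 0 then 1 else 0 else 0

theorem pending_le_one (x : ℕ) : pending d u s x ≤ 1 := by
  unfold pending
  split_ifs <;> omega

/-- The accumulator adds the flag of `u` to the number of its unsettled children. It is `0` exactly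
when `u` is unsettled and all its children are settled. -/
theorem visitProg_ok (hd : d.ValidRat) (hs : d.Loaded s) (hu : s 9 0 0 0 0 = (u : ℕ)) {τ : ℕ}
    (hτ : τ ≤ d.bitSize * d.bitSize) (h : Inv d τ s) :
    Ok d.bitSize (cellBits d.bitSize) visitProg s fun s' => Inv d (τ + 1) s' ∧
      (∀ w : Fin d.m, s 10 0 w 0 0 = 1 → s' 10 0 w 0 0 = 1) ∧
      ((∀ w, d.edge u w = true → s 10 0 w 0 0 = 1) → s' 10 0 u 0 0 = 1) := by
  have hb : d.bitSize + 1 ≤ cellBits d.bitSize := by have := le_cellBits d.bitSize; omega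
  have evu : ∀ s', s' 9 = s 9 → (Expr.var 9).Evals (cellBits d.bitSize) s' (u : ℕ) := fun s' e =>
    .var (by rw [e, hu]) (bits_index_le u)
  obtain ⟨a, ha1, ha⟩ : ∃ a : ℕ, a ≤ 1 ∧ s 10 0 u 0 0 = a := by
    rcases h.flag u with h0 | h1
    · exact ⟨0, zero_le_one, by simpa using h0⟩
    · exact ⟨1, le_rfl, by simpa using h1⟩
  have bflag : ∀ w : Fin d.m, bits (s 10 0 w 0 0) ≤ cellBits d.bitSize := by
    intro w
    rcases h.flag w with h0 | h1
    · rw [h0]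
      exact bits_zero_le _
    · rw [h1]
      exact bits_one_le _
  refine Ok.seq (Ok.setVar (.entry .zero (evu s rfl) rfl (bflag u)) ?_)
  set s₁ := s.set 12 0 0 0 0 (s 10 0 u 0 0) with hs₁
  have a₁ : Agree [12] s s₁ := fun b hb => s.set_ne (by simpa using hb) _ _ _ _ _
  have a₁' : ∀ s', Agree [11, 12] s₁ s' → Agree [11, 12] s s' := fun s' h b hb => by
    rw [h b hb, a₁ b fun e => hb (List.mem_cons_of_mem _ e)]
  refine Ok.seq (Ok.sumLoop (n := d.m) (a := a) (g := fun x => (pending d u s x : ℚ)) (by decide)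
    d.card_le_bitSize hb (by rw [hs₁, Store.set_same, ha])
    (fun s' hs' => (hs.agree (a₁' s' hs') (by decide)).evals_num) ?_ ?_ ?_)
  · intro x hx s' hs' hxv
    obtain ⟨w, rfl⟩ : ∃ w : Fin d.m, x = w.val := ⟨⟨x, hx⟩, rfl⟩
    have ew : (Expr.var 11).Evals (cellBits d.bitSize) s' (w : ℕ) := .var hxv (bits_index_le w)
    have key := Expr.Evals.mul ((hs.agree (a₁' s' hs') (by decide)).evals_edge
      (evu s' (a₁' s' hs' 9 (by decide))) ew) (.sub .one (.entry .zero ew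
        (by rw [a₁' s' hs' 10 (by decide)]) (bflag w)))
    have e : (if d.edge u w = true then (1 : ℚ) else 0) * (1 - s 10 0 w 0 0) =
        (pending d u s w : ℚ) := by
      rcases h.flag w with h0 | h1
      · simp [pending, h0]
      · simp [pending, h1]
    rwa [e] at key
  · intro x hx
    rw [← Nat.cast_sum, ← Nat.cast_add]
    have h1 : ∑ y ∈ Finset.range x, pending d u s y ≤ x := by
      refine (Finset.sum_le_sum fun y _ => pending_le_one y).trans ?_
      simp
    have h2 := d.card_le_bitSize
    exact bits_nat_le (by omega)
  · intro s₂ hs₂ h12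
    have A₂ := a₁' s₂ hs₂
    rw [← Nat.cast_sum, ← Nat.cast_add] at h12
    have hsum : ∑ y ∈ Finset.range d.m, pending d u s y ≤ d.m := by
      refine (Finset.sum_le_sum fun y _ => pending_le_one y).trans ?_
      simp
    have hI₂ : Inv d τ s₂ := h.agree A₂ (by decide)
    have h10 : s₂ 10 = s 10 := A₂ 10 (by decide)
    have hbits : a + ∑ y ∈ Finset.range d.m, pending d u s y ≤ d.bitSize + 1 := by
      have := d.card_le_bitSize
      omega
    refine Ok.ifLe (.var h12 ((bits_natCast_le _).trans ?_)) .zero' (fun hle => ?_) fun hlt => ?_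
    · have := le_cellBits d.bitSize
      omega
    · have h0 : a + ∑ y ∈ Finset.range d.m, pending d u s y = 0 := by
        have : a + ∑ y ∈ Finset.range d.m, pending d u s y ≤ 0 := by exact_mod_cast hle
        omega
      have ha0 : a = 0 := by omega
      have hp : ∀ y ∈ Finset.range d.m, pending d u s y = 0 :=
        Finset.sum_eq_zero_iff.1 (by omega)
      have hflag : s₂ 10 0 u 0 0 = 0 := by rw [h10, ha, ha0, Nat.cast_zero]
      have hch : ∀ w, d.edge u w = true → s₂ 10 0 w 0 0 = 1 := by
        intro w huw
        have := hp w (Finset.mem_range.2 w.2)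
        rw [h10]
        refine (h.flag w).resolve_left fun hw => ?_
        simp [pending, huw, hw] at this
      refine (categoryProg_ok hd (hs.agree A₂ (by decide)) (by rw [A₂ 9 (by decide), hu]) hτ hI₂ hflag
        hch).mono fun s₃ _ hI => ⟨hI.1, fun w hw => ?_, fun _ => ?_⟩
      · rw [hI.2]
        by_cases hwu : w = u
        · rw [hwu, Store.set_same]
        · have : (w : ℕ) ≠ u := fun e => hwu (Fin.ext e)
          rw [← hw, ← h10]
          simp [Store.set, this]
      · rw [hI.2, Store.set_same]
    · refine Ok.skip ⟨hI₂.succ, by rw [h10]; exact fun _ => id, fun hch => ?_⟩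
      rw [h10]
      refine (h.flag u).resolve_left fun h0 => ?_
      have ha0 : a = 0 := by
        rw [ha] at h0
        exact_mod_cast h0
      have hp : ∑ y ∈ Finset.range d.m, pending d u s y = 0 := by
        refine Finset.sum_eq_zero fun y hy => ?_
        have hy' := Finset.mem_range.1 hy
        have hne : ¬ (d.edge u ⟨y, hy'⟩ = true ∧ s 10 0 y 0 0 = 0) := fun hyy => by
          have := hch ⟨y, hy'⟩ hyy.1
          rw [hyy.2] at this
          exact zero_ne_one this
        rw [pending, dif_pos hy', if_neg hne]
      rw [hp, ha0] at hlt
      simp at hlt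

/-- No topological order is computed: after `t` rounds over all categories, those of rank below `t`
are settled, and all ranks are below `m`. -/
theorem backwardProg_ok (hd : d.ValidRat) (hs : d.Loaded s) :
    Ok d.bitSize (cellBits d.bitSize) backwardProg s fun s' => ∀ u, Settled d s' u := by
  obtain ⟨rank, hm, hrank⟩ := exists_rank hd.acyclic
  have hb : d.bitSize + 1 ≤ cellBits d.bitSize := by have := le_cellBits d.bitSize; omega
  -- `Loaded` says nothing about the working arrays, so the flags have to be cleared first.
  refine Ok.seq (Ok.fillRow (A := 10) (r := 0) (n := d.m) (f := fun _ => 0) (by decide) (by decide)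
    d.card_le_bitSize hb (fun s' hs' => (hs.agree hs' (by decide)).evals_num) ?_ ?_)
  · intro x hx s' _ hxv _
    exact Ok.setEntry .zero (.var hxv (bits_nat_le (hx.le.trans d.card_le_bitSize))) .zero' rfl
  intro s₁ hs₁ h10 _
  have L₁ : d.Loaded s₁ := hs.agree hs₁ (by decide)
  have hz : ∀ w : Fin d.m, s₁ 10 0 w 0 0 = 0 := fun w => h10 w w.2
  have hI₁ : Inv d 0 s₁ := ⟨fun w => Or.inl (hz w), fun w hw => by simp [hz w] at hw, 1, one_pos,
    Nat.one_le_two_pow, fun w hw => by simp [hz w] at hw⟩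
  refine Ok.loop (n := d.m) (by decide) d.card_le_bitSize hb (fun t s' => Inv d (t * d.m) s' ∧
    ∀ u, rank u < t → s' 10 0 u 0 0 = 1) ?_
    (fun s' hs' => (L₁.agree hs' (by decide)).evals_num) ⟨by simpa using hI₁, by simp⟩ ?_ ?_
  · intro t s s' hss h
    exact ⟨h.1.agree hss (by decide), by rw [hss 10 (by decide)]; exact h.2⟩
  · intro t ht s₂ hs₂ _ ⟨hI₂, hr₂⟩
    have L₂ : d.Loaded s₂ := L₁.agree hs₂ (by decide)
    -- Within round `t`, the categories of rank at most `t` and index below `x` are settled as well: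
    -- their children have rank below `t` and were settled in earlier rounds.
    refine Ok.loop (n := d.m) (by decide) d.card_le_bitSize hb (fun x s' => Inv d (t * d.m + x) s' ∧
      (∀ u, rank u < t → s' 10 0 u 0 0 = 1) ∧
      ∀ u : Fin d.m, rank u < t + 1 → u.val < x → s' 10 0 u 0 0 = 1) ?_
      (fun s' hs' => (L₂.agree hs' (by decide)).evals_num) ⟨by simpa using hI₂, hr₂, by simp⟩ ?_ ?_
    · intro t s s' hss h
      exact ⟨h.1.agree hss (by decide), by rw [hss 10 (by decide)]; exact h.2⟩
    · intro x hx s₃ hs₃ hxv ⟨hI₃, hr₃, hx₃⟩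
      obtain ⟨u, rfl⟩ : ∃ u : Fin d.m, x = u.val := ⟨⟨x, hx⟩, rfl⟩
      have hτ : t * d.m + u ≤ d.bitSize * d.bitSize := by
        have h1 : t * d.m + d.m ≤ d.m * d.m := by
          rw [← Nat.succ_mul]
          exact Nat.mul_le_mul_right _ ht
        have h2 := Nat.mul_le_mul d.card_le_bitSize d.card_le_bitSize
        omega
      refine (visitProg_ok hd (L₂.agree hs₃ (by decide)) hxv hτ hI₃).mono fun s₄ _ ⟨h1, h2, h3⟩ =>
        ⟨h1, fun w hw => h2 w (hr₃ w hw), fun w hw hwx => ?_⟩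
      rcases Nat.lt_succ_iff_lt_or_eq.1 hwx with h4 | h4
      · exact h2 w (hx₃ w hw h4)
      · obtain rfl : w = u := Fin.ext h4
        exact h3 fun v hv => hr₃ v (by have := hrank w v hv; omega)
    · intro s₃ _ ⟨h1, _, h3⟩
      refine ⟨?_, fun u hu => h3 u hu u.2⟩
      rwa [Nat.succ_mul]
  · intro s₂ _ ⟨h1, h2⟩ u
    exact h1.settled u (h2 u (hm u))

/-! ### The output -/

/-- The conditions are equations and weak inequalities between finite sums, so the certificate
computed over `ℚ` remains valid over `ℝ`, where optimality is stated. -/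
theorem _root_.CrossCat.IsStoppingValue.ratCast {n : ℕ} {ρ : Option (Fin n) → Option (Fin n) → ℚ}
    {r V : Option (Fin n) → ℚ} {S : Finset (Fin n)} (h : IsStoppingValue ρ r S V) :
    IsStoppingValue (fun i j => (ρ i j : ℝ)) (fun i => (r i : ℝ)) S fun i => (V i : ℝ) where
  stopped i hi := by rw [h.stopped i hi]
  running i hi := by exact_mod_cast h.running i hi
  reward_le i := by exact_mod_cast h.reward_le i
  excessive i hi := by exact_mod_cast h.excessive i hi

theorem isBackward_of_settled (hd : d.toReal.Valid) (h : ∀ u, Settled d s u) :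
    IsBackward (d := d.toReal) ⟨storedAssortments d s, fun u i => (row (d.n u) u (s 15) i : ℝ)⟩ := by
  have key : ∀ (u : Fin d.m) (i : Option (Fin (d.n u))), (row (d.n u) u (s 15) i : ℝ) =
      (i.elim 0 fun k => (d.price u k : ℝ)) + ∑ w with d.edge u w = true,
        ∑ j, (d.lam u w i j : ℝ) * (storedValues d s w j : ℝ) := by
    intro u i
    rw [(h u).adjusted, adjustedPrice, Rat.cast_add, Finset.sum_filter, Rat.cast_sum]
    congr 1
    · cases i with
      | none => exact Rat.cast_zero
      | some i => rfl
    · refine Finset.sum_congr rfl fun w _ => ?_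
      split_ifs <;> push_cast <;> rfl
  exact isBackward_of_isStoppingValue hd (V := fun u i => (storedValues d s u i : ℝ))
    (fun u => (h u).value.ratCast) key

theorem holds_storedAssortments (h : ∀ u, Settled d s u) : Holds (storedAssortments d s) s := by
  intro u i
  rw [(h u).indicator]
  simp

end MarketData

end CrossCat

open CrossCat in
theorem mainTheorem2 :
    -- for real data: the algorithm can be carried out, and each of its outputs is jointly optimal
    (∀ d : MarketData ℝ, d.Valid →
      (∃ S, d.IsAlgOutput S) ∧ ∀ S, d.IsAlgOutput S → d.IsOptimal S) ∧
    -- for rational data: it is carried out by one program within polynomial bit cost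
    (∃ (P : Cmd) (p : Polynomial ℕ), ∀ d : MarketData ℚ, d.toReal.Valid →
      ∀ s : Store, d.Loaded s →
        ∃ (t : ℕ) (s' : Store) (S : d.Assortments),
          Run P s t s' ∧ t ≤ p.eval d.bitSize ∧ MarketData.Holds S s' ∧
          d.toReal.IsAlgOutput S ∧ d.toReal.IsOptimal S) := by
  refine ⟨fun d hd => ⟨hd.exists_isAlgOutput, fun S hS => hS.isOptimal hd⟩, ?_⟩
  obtain ⟨K, e, hK⟩ := Imp.exists_time_le backwardProg
  -- The time bound `K * ((N + 1) ^ e * (b + 1))` at `N = L` and `b = cellBits L`, written out as a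
  -- polynomial in the input size `L`.
  open Polynomial in
  refine ⟨backwardProg.toCmd, C K * ((X + 1) ^ e *
    (3 * ((2 * X * X + 3 * X) * (X * X + 1)) + X + 2 + 1)), fun d hd s hs => ?_⟩
  obtain ⟨t, s', hrun, ht, -, hset⟩ :=
    MarketData.backwardProg_ok (MarketData.Valid.validRat hd) hs
  have hback := MarketData.isBackward_of_settled hd hset
  refine ⟨t, s', MarketData.storedAssortments d s', hrun, (ht.trans (hK _ _)).trans_eq ?_,
    MarketData.holds_storedAssortments hset, hback.isAlgOutput hd, hback.isOptimal hd⟩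
  simp [cellBits, stepBits]
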